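/- An elementary abelian $2$-group is a finite-dimensional $\mathbb F_2$-vector space $A$; $A^*=\mathrm{Hom}(A,C_2)$ is its group of characters, with trivial character $\epsilon$. **Equivariant formal group laws.** An $A$-equivariant formal group law $F=(k,R,\Delta,\theta,y(\epsilon))$ consists of a commutative ring $k$, a complete commutative topological $k$-algebra $R$, a continuous $k$-algebra map $\Delta\colon R\to R\hat\otimes_k R$, $k$-algebra maps $\theta(V)\colon R\to k$ for $V\in A^*$, and $y(\epsilon)\in R$, such that $\Delta$ is cocommutative, coassociative and counital for $\theta(\epsilon)$; $(\theta(V)\hat\otimes\theta(W))\circ\Delta=\theta(VW)$ for all $V,W\in A^*$; the finite products of the ideals $\ker\theta(V)$ form a basis of neighbourhoods of $0$ in $R$; and $y(\epsilon)$ is a regular element generating $\ker\theta(\epsilon)$. It is $2$-torsion if the composite $R\xrightarrow{\Delta}R\hat\otimes_k R\xrightarrow{\mathrm{mult}}R$ sends $y(\epsilon)$ to $0$. The Euler class of $V\in A^*$ is $e_V=\theta(V)(y(\epsilon))\in k$. A morphism is a pair of ring maps $k\to k'$, $R\to R'$ preserving all the structure. For a homomorphism $\alpha\colon B\to A$ and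 a $B$-equivariant formal group law $F$ over $k$, the push-forward $\alpha_*F$ is the $A$-equivariant formal group law over $k$ whose algebra is the completion of $R$ at the finite products of the ideals $\ker\theta(V\circ\alpha)$, $V\in A^*$, with the structure induced by that of $F$ (the augmentation at $V\in A^*$ is induced by $\theta(V\circ\alpha)$). **The global $2$-torsion Lazard ring.** $L^{2\text{-tor}}_A$ denotes the ground ring of an initial $2$-torsion $A$-equivariant formal group law $F_A$. For $\alpha\colon B\to A$ let $\alpha^*\colon L^{2\text{-tor}}_A\to L^{2\text{-tor}}_B$ be the ring map underlying the unique morphism $F_A\to\alpha_*F_B$. This defines a contravariant functor $\mathbf L^{2\text{-tor}}\colon A\mapsto L^{2\text{-tor}}_A$ from elementary abelian $2$-groups to commutative rings. Let $e_\sigma\in L^{2\text{-tor}}_{C_2}$ be the Euler class of the sign character $\sigma=\mathrm{id}_{C_2}$. **Global $2$-torsion group laws.** A global $2$-torsion group law is a contravariant functor $X$ from elementary abelian $2$-groups to commutative rings together with an element $e\in X(C_2)$, its coordinate, such that for every elementary abelian $2$-group $A$ and every non-trivial $V\in A^*$ the sequence $$0\to X(A)\xrightarrow{\;V^*(e)\cdot\;}X(A)\xrightarrow{\;\mathrm{res}\;}X(\ker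 V)\to 0$$ is exact. Morphisms are natural transformations of ring-valued functors preserving the coordinate. **Proposition.** There is an initial global $2$-torsion group law, and the global $2$-torsion Lazard ring $\mathbf L^{2\text{-tor}}$ exists (in particular, for every elementary abelian $2$-group $A$ there is an initial $2$-torsion $A$-equivariant formal group law). For every initial global $2$-torsion group law $(\widetilde{\mathbf L}^{2\text{-tor}},e)$ there is an isomorphism of functors $\mathbf L^{2\text{-tor}}\cong\widetilde{\mathbf L}^{2\text{-tor}}$ sending $e_\sigma$ to $e$, and it is the only such isomorphism. In particular $(\mathbf L^{2\text{-tor}},e_\sigma)$ is a global $2$-torsion group law, and for every elementary abelian $2$-group $A$ and every non-trivial $V\in A^*$ the Euler class $e_V$ is a regular element (a non-zero-divisor) of $L^{2\text{-tor}}_A$. -/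

import Mathlib

open CategoryTheory Opposite
open scoped TensorProduct

universe u

noncomputable section

/-! ### Completions at families of ideals -/

namespace IdealCompletion

variable {R S T k : Type u} [CommRing R] [CommRing S] [CommRing T] [CommRing k]
variable {ι κ μ : Type}

/-- The completion `lim R ⧸ I i` of `R` at a family of ideals, the limit being taken over all
inclusions between members of the family. -/
def Completion (I : ι → Ideal R) : Subring (∀ i, R ⧸ I i) where
  carrier := {x | ∀ i j (h : I i ≤ I j), Ideal.Quotient.factor h (x i) = x j}
  mul_mem' := fun hx hy i j h => by simp [hx i j h, hy i j h]
  one_mem' := fun i j h => by simp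
  add_mem' := fun hx hy i j h => by simp [hx i j h, hy i j h]
  zero_mem' := fun i j h => by simp
  neg_mem' := fun hx i j h => by simp [hx i j h]

/-- The completion map. -/
def of (I : ι → Ideal R) : R →+* Completion I :=
  RingHom.codRestrict (RingHom.pi fun i => Ideal.Quotient.mk (I i)) (Completion I)
    (fun x _ _ h => Ideal.Quotient.factor_mk h x)

/-- The projection of the completion to a quotient. Its kernels form the basis of neighbourhoods
of zero in the completion. -/
def proj (I : ι → Ideal R) (i : ι) : Completion I →+* R ⧸ I i :=
  (Pi.evalRingHom (fun i => R ⧸ I i) i).comp (Completion I).subtype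

@[simp]
lemma proj_of (I : ι → Ideal R) (i : ι) (x : R) :
    proj I i (of I x) = Ideal.Quotient.mk (I i) x := rfl

lemma factor_proj (I : ι → Ideal R) {i j : ι} (h : I i ≤ I j) (x : Completion I) :
    Ideal.Quotient.factor h (proj I i x) = proj I j x := x.2 i j h

/-- Continuity of a ring homomorphism into a completion, where the source carries the linear
topology with basis of neighbourhoods of zero the ideals `I i`. -/
def IsCont (I : ι → Ideal R) {J : κ → Ideal S} (f : R →+* Completion J) : Prop :=
  ∀ j, ∃ i, I i ≤ RingHom.ker ((proj J j).comp f)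

/-- The value at `j` of the continuous extension of `f` to the completion. -/
def extendAt {I : ι → Ideal R} {J : κ → Ideal S} {f : R →+* Completion J}
    (hf : IsCont I f) (j : κ) : Completion I →+* S ⧸ J j :=
  (Ideal.Quotient.lift (I (hf j).choose) ((proj J j).comp f)
    (fun _ ha => (hf j).choose_spec ha)).comp (proj I (hf j).choose)

lemma extendAt_apply {I : ι → Ideal R} (hI : Directed (· ≥ ·) I) {J : κ → Ideal S}
    {f : R →+* Completion J} (hf : IsCont I f) {i : ι} {j : κ}
    (h : I i ≤ RingHom.ker ((proj J j).comp f)) (x : Completion I) :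
    extendAt hf j x =
      Ideal.Quotient.lift (I i) ((proj J j).comp f) (fun _ ha => h ha) (proj I i x) := by
  obtain ⟨l, hl₁, hl₂⟩ := hI (hf j).choose i
  obtain ⟨r, hr⟩ := Ideal.Quotient.mk_surjective (proj I l x)
  have h₁ := factor_proj I hl₁ x
  have h₂ := factor_proj I hl₂ x
  rw [← hr] at h₁ h₂
  simp only [extendAt, RingHom.comp_apply, ← h₁, ← h₂, Ideal.Quotient.factor_mk]
  rfl

/-- The continuous extension to the completion of a continuous ring homomorphism. -/
def extend {I : ι → Ideal R} (hI : Directed (· ≥ ·) I) {J : κ → Ideal S}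
    {f : R →+* Completion J} (hf : IsCont I f) : Completion I →+* Completion J :=
  RingHom.codRestrict (RingHom.pi fun j => extendAt hf j) (Completion J) (by
    intro x j j' h
    have hle : I (hf j).choose ≤ RingHom.ker ((proj J j').comp f) := by
      intro a ha
      have := (hf j).choose_spec ha
      rw [RingHom.mem_ker, RingHom.comp_apply] at this ⊢
      rw [← factor_proj J h, this, map_zero]
    change Ideal.Quotient.factor h (extendAt hf j x) = extendAt hf j' x
    rw [extendAt_apply hI hf hle x]
    obtain ⟨r, hr⟩ := Ideal.Quotient.mk_surjective (proj I (hf j).choose x)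
    simp only [extendAt, RingHom.comp_apply, ← hr]
    exact factor_proj J h (f r))

lemma proj_extend {I : ι → Ideal R} (hI : Directed (· ≥ ·) I) {J : κ → Ideal S}
    {f : R →+* Completion J} (hf : IsCont I f) {i : ι} {j : κ}
    (h : I i ≤ RingHom.ker ((proj J j).comp f)) (x : Completion I) :
    proj J j (extend hI hf x) =
      Ideal.Quotient.lift (I i) ((proj J j).comp f) (fun _ ha => h ha) (proj I i x) :=
  extendAt_apply hI hf h x

lemma extend_of {I : ι → Ideal R} (hI : Directed (· ≥ ·) I) {J : κ → Ideal S}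
    {f : R →+* Completion J} (hf : IsCont I f) (x : R) :
    extend hI hf (of I x) = f x :=
  Subtype.ext (funext fun j => (extendAt_apply hI hf (hf j).choose_spec (of I x)).trans rfl)

lemma IsCont.extend_comp {I : ι → Ideal R} (hI : Directed (· ≥ ·) I) {J : κ → Ideal S}
    {f : R →+* Completion J} (hf : IsCont I f) {L : μ → Ideal T} {g : T →+* Completion I}
    (hg : IsCont L g) : IsCont L ((extend hI hf).comp g) := by
  intro j
  obtain ⟨i, hi⟩ := hf j
  obtain ⟨l, hl⟩ := hg i
  refine ⟨l, fun a ha => ?_⟩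
  have h0 : proj I i (g a) = 0 := hl ha
  rw [RingHom.mem_ker, RingHom.comp_apply, RingHom.comp_apply, proj_extend hI hf hi, h0, map_zero]

/-! ### Completed tensor products -/

/-- The ring homomorphism out of a tensor product of `k`-algebras determined by two ring
homomorphisms that agree on `k`. -/
def tensorLift [Algebra k R] [Algebra k S] (f : R →+* T) (g : S →+* T)
    (h : ∀ c : k, f (algebraMap k R c) = g (algebraMap k S c)) : R ⊗[k] S →+* T :=
  letI : Algebra k T := (f.comp (algebraMap k R)).toAlgebra
  (Algebra.TensorProduct.lift (A := R) (B := S) (C := T) (S := k) (R := k)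
    { f with commutes' := fun _ => rfl }
    { g with commutes' := fun c => (h c).symm }
    (fun _ _ => mul_comm _ _)).toRingHom

lemma tensorLift_tmul [Algebra k R] [Algebra k S] (f : R →+* T) (g : S →+* T)
    (h : ∀ c : k, f (algebraMap k R c) = g (algebraMap k S c)) (a : R) (b : S) :
    tensorLift f g h (a ⊗ₜ b) = f a * g b := rfl

/-- `a ↦ a ⊗ 1`. -/
def inl (k R S : Type u) [CommRing k] [CommRing R] [CommRing S] [Algebra k R] [Algebra k S] :
    R →+* R ⊗[k] S :=
  Algebra.TensorProduct.includeLeftRingHom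

/-- `b ↦ 1 ⊗ b`. -/
def inr (k R S : Type u) [CommRing k] [CommRing R] [CommRing S] [Algebra k R] [Algebra k S] :
    S →+* R ⊗[k] S :=
  (Algebra.TensorProduct.includeRight : S →ₐ[k] R ⊗[k] S).toRingHom

lemma inl_algebraMap (k R S : Type u) [CommRing k] [CommRing R] [CommRing S] [Algebra k R]
    [Algebra k S] (c : k) :
    inl k R S (algebraMap k R c) = inr k R S (algebraMap k S c) :=
  Algebra.TensorProduct.tmul_one_eq_one_tmul c

/-- The ideals `I i ⊗ S + R ⊗ J j` of `R ⊗ S`. -/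
def tensorIdeals (k : Type u) [CommRing k] [Algebra k R] [Algebra k S]
    (I : ι → Ideal R) (J : κ → Ideal S) (p : ι × κ) : Ideal (R ⊗[k] S) :=
  (I p.1).map (inl k R S) ⊔ (J p.2).map (inr k R S)

lemma directed_tensorIdeals [Algebra k R] [Algebra k S] {I : ι → Ideal R} {J : κ → Ideal S}
    (hI : Directed (· ≥ ·) I) (hJ : Directed (· ≥ ·) J) :
    Directed (· ≥ ·) (tensorIdeals k I J) := by
  rintro ⟨i, j⟩ ⟨i', j'⟩
  obtain ⟨a, ha, ha'⟩ := hI i i'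
  obtain ⟨b, hb, hb'⟩ := hJ j j'
  exact ⟨(a, b), sup_le_sup (Ideal.map_mono ha) (Ideal.map_mono hb),
    sup_le_sup (Ideal.map_mono ha') (Ideal.map_mono hb')⟩

/-- The completed tensor product `R ⊗̂ S` over `k` of two linearly topologized `k`-algebras:
the completion of `R ⊗ S` at the ideals `I i ⊗ S + R ⊗ J j`. -/
abbrev CompletedTensor (k : Type u) [CommRing k] [Algebra k R] [Algebra k S]
    (I : ι → Ideal R) (J : κ → Ideal S) := Completion (tensorIdeals k I J)

lemma isCont_tensorLift [Algebra k R] [Algebra k S] {I : ι → Ideal R} {J : κ → Ideal S}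
    {K : μ → Ideal T} {f : R →+* Completion K} {g : S →+* Completion K}
    (h : ∀ c : k, f (algebraMap k R c) = g (algebraMap k S c))
    (hf : IsCont I f) (hg : IsCont J g) :
    IsCont (tensorIdeals k I J) (tensorLift f g h) := by
  intro l
  obtain ⟨i, hi⟩ := hf l
  obtain ⟨j, hj⟩ := hg l
  refine ⟨(i, j), sup_le (Ideal.map_le_iff_le_comap.2 fun a ha => ?_)
    (Ideal.map_le_iff_le_comap.2 fun b hb => ?_)⟩
  · have h0 : proj K l (f a) = 0 := hi ha
    have h1 : tensorLift f g h (inl k R S a) = f a * g 1 := rfl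
    rw [Ideal.mem_comap, RingHom.mem_ker, RingHom.comp_apply, h1, map_mul, h0, zero_mul]
  · have h0 : proj K l (g b) = 0 := hj hb
    have h1 : tensorLift f g h (inr k R S b) = f 1 * g b := rfl
    rw [Ideal.mem_comap, RingHom.mem_ker, RingHom.comp_apply, h1, map_mul, h0, mul_zero]

/-- The continuous homomorphism `R ⊗̂ S → T^` determined by two continuous homomorphisms that
agree on `k`; it sends `a ⊗ b` to `f a * g b`. -/
def completedLift [Algebra k R] [Algebra k S] {I : ι → Ideal R} {J : κ → Ideal S}
    (hI : Directed (· ≥ ·) I) (hJ : Directed (· ≥ ·) J)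
    {K : μ → Ideal T} {f : R →+* Completion K} {g : S →+* Completion K}
    (hf : IsCont I f) (hg : IsCont J g)
    (h : ∀ c : k, f (algebraMap k R c) = g (algebraMap k S c)) :
    CompletedTensor k I J →+* Completion K :=
  extend (directed_tensorIdeals hI hJ) (isCont_tensorLift h hf hg)

lemma isCont_of (I : ι → Ideal R) : IsCont I (of I) := fun i => ⟨i, fun a ha => by
  rw [RingHom.mem_ker, RingHom.comp_apply, proj_of]
  exact Ideal.Quotient.eq_zero_iff_mem.2 ha⟩

lemma isCont_inl [Algebra k R] [Algebra k S] (I : ι → Ideal R) (J : κ → Ideal S) :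
    IsCont I ((of (tensorIdeals k I J)).comp (inl k R S)) := fun p => ⟨p.1, fun a ha => by
  rw [RingHom.mem_ker, RingHom.comp_apply, RingHom.comp_apply, proj_of]
  exact Ideal.Quotient.eq_zero_iff_mem.2 (Ideal.mem_sup_left (Ideal.mem_map_of_mem _ ha))⟩

lemma isCont_inr [Algebra k R] [Algebra k S] (I : ι → Ideal R) (J : κ → Ideal S) :
    IsCont J ((of (tensorIdeals k I J)).comp (inr k R S)) := fun p => ⟨p.2, fun a ha => by
  rw [RingHom.mem_ker, RingHom.comp_apply, RingHom.comp_apply, proj_of]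
  exact Ideal.Quotient.eq_zero_iff_mem.2 (Ideal.mem_sup_right (Ideal.mem_map_of_mem _ ha))⟩

lemma IsCont.of_comp {I : ι → Ideal R} {J : κ → Ideal S} {f : R →+* S}
    (hf : ∀ j, ∃ i, I i ≤ (J j).comap f) {K : μ → Ideal T} {g : S →+* Completion K}
    (hg : IsCont J g) : IsCont I (g.comp f) := fun l => by
  obtain ⟨j, hj⟩ := hg l
  obtain ⟨i, hi⟩ := hf j
  exact ⟨i, fun a ha => hj (hi ha)⟩

end IdealCompletion

/-! ### Equivariant formal group laws for elementary abelian 2-groups -/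

open IdealCompletion

/-- The group of characters of an elementary abelian 2-group, written additively, so that `0` is
the trivial character and `V + W` is the product of characters. -/
abbrev Character (A : Type) [AddCommGroup A] [Module (ZMod 2) A] := A →ₗ[ZMod 2] ZMod 2

/-- A commutative `k`-algebra `R` with augmentations `θ V : R → k` indexed by the characters. -/
structure AugmentedAlgebra (A : Type) [AddCommGroup A] [Module (ZMod 2) A]
    (k : Type u) [CommRing k] where
  R : Type u
  [commRing : CommRing R]
  [algebra : Algebra k R]
  θ : Character A → (R →ₐ[k] k)

attribute [instance] AugmentedAlgebra.commRing AugmentedAlgebra.algebra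

namespace AugmentedAlgebra

variable {A : Type} [AddCommGroup A] [Module (ZMod 2) A] {k : Type u} [CommRing k]
variable (F : AugmentedAlgebra A k)

/-- The finite products of the kernels of the augmentations. They form the basis of
neighbourhoods of zero of the topology of `R`. -/
def I (s : Multiset (Character A)) : Ideal F.R :=
  (s.map fun V => RingHom.ker (F.θ V)).prod

lemma I_singleton (V : Character A) : F.I {V} = RingHom.ker (F.θ V) := by simp [I]

lemma I_add (s t : Multiset (Character A)) : F.I (s + t) = F.I s * F.I t := by simp [I]

lemma directed_I : Directed (· ≥ ·) F.I := fun s t =>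
  ⟨s + t, (F.I_add s t).le.trans (Ideal.mul_le_inf.trans inf_le_left),
    (F.I_add s t).le.trans (Ideal.mul_le_inf.trans inf_le_right)⟩

/-- The completed tensor product `R ⊗̂ R`. -/
abbrev Tensor₂ := CompletedTensor k F.I F.I

/-- The completed tensor product `R ⊗̂ R ⊗̂ R`, the completion of `R ⊗ (R ⊗ R)` at the ideals
`I s ⊗ R ⊗ R + R ⊗ I t ⊗ R + R ⊗ R ⊗ I u`. -/
abbrev Tensor₃ := CompletedTensor k F.I (tensorIdeals k F.I F.I)

/-- `a ↦ a ⊗ 1`. -/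
def inc₁₂ : F.R →+* F.Tensor₂ := (of _).comp (inl k F.R F.R)

/-- `a ↦ 1 ⊗ a`. -/
def inc₂₂ : F.R →+* F.Tensor₂ := (of _).comp (inr k F.R F.R)

/-- `a ↦ a ⊗ 1 ⊗ 1`. -/
def inc₁₃ : F.R →+* F.Tensor₃ := (of _).comp (inl k F.R (F.R ⊗[k] F.R))

/-- `a ↦ 1 ⊗ a ⊗ 1`. -/
def inc₂₃ : F.R →+* F.Tensor₃ :=
  ((of _).comp (inr k F.R (F.R ⊗[k] F.R))).comp (inl k F.R F.R)

/-- `a ↦ 1 ⊗ 1 ⊗ a`. -/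
def inc₃₃ : F.R →+* F.Tensor₃ :=
  ((of _).comp (inr k F.R (F.R ⊗[k] F.R))).comp (inr k F.R F.R)

lemma isCont_inc₁₂ : IsCont F.I F.inc₁₂ := isCont_inl _ _

lemma isCont_inc₂₂ : IsCont F.I F.inc₂₂ := isCont_inr _ _

lemma isCont_inc₁₃ : IsCont F.I F.inc₁₃ := isCont_inl _ _

lemma isCont_inc₂₃ : IsCont F.I F.inc₂₃ :=
  IsCont.of_comp (J := tensorIdeals k F.I F.I)
    (fun p => ⟨p.1, Ideal.map_le_iff_le_comap.1 le_sup_left⟩) (isCont_inr _ _)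

lemma isCont_inc₃₃ : IsCont F.I F.inc₃₃ :=
  IsCont.of_comp (J := tensorIdeals k F.I F.I)
    (fun p => ⟨p.2, Ideal.map_le_iff_le_comap.1 le_sup_right⟩) (isCont_inr _ _)

lemma inc₁₂_algebraMap (c : k) :
    F.inc₁₂ (algebraMap k F.R c) = F.inc₂₂ (algebraMap k F.R c) :=
  congrArg (of _) (inl_algebraMap k F.R F.R c)

lemma inc₂₃_algebraMap (c : k) :
    F.inc₂₃ (algebraMap k F.R c) = F.inc₃₃ (algebraMap k F.R c) :=
  congrArg (fun z => of _ (inr k F.R (F.R ⊗[k] F.R) z)) (inl_algebraMap k F.R F.R c)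

lemma inc₁₃_algebraMap (c : k) :
    F.inc₁₃ (algebraMap k F.R c) = F.inc₂₃ (algebraMap k F.R c) :=
  congrArg (of _) (inl_algebraMap k F.R (F.R ⊗[k] F.R) c)

/-- `R ⊗̂ R → R ⊗̂ R ⊗̂ R`, `a ⊗ b ↦ a ⊗ b ⊗ 1`. -/
def j₁₂ : F.Tensor₂ →+* F.Tensor₃ :=
  completedLift F.directed_I F.directed_I F.isCont_inc₁₃ F.isCont_inc₂₃ F.inc₁₃_algebraMap

/-- `R ⊗̂ R → R ⊗̂ R ⊗̂ R`, `a ⊗ b ↦ 1 ⊗ a ⊗ b`. -/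
def j₂₃ : F.Tensor₂ →+* F.Tensor₃ :=
  completedLift F.directed_I F.directed_I F.isCont_inc₂₃ F.isCont_inc₃₃ F.inc₂₃_algebraMap

lemma j₁₂_inc₁₂ (x : F.R) : F.j₁₂ (F.inc₁₂ x) = F.inc₁₃ x := by
  refine (extend_of (directed_tensorIdeals F.directed_I F.directed_I) _ _).trans ?_
  exact (tensorLift_tmul _ _ _ x 1).trans (by rw [map_one, mul_one])

lemma j₂₃_inc₁₂ (x : F.R) : F.j₂₃ (F.inc₁₂ x) = F.inc₂₃ x := by
  refine (extend_of (directed_tensorIdeals F.directed_I F.directed_I) _ _).trans ?_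
  exact (tensorLift_tmul _ _ _ x 1).trans (by rw [map_one, mul_one])

/-- The multiplication `R ⊗̂ R → R`, where `R` is written as its own completion. -/
def mulHat : F.Tensor₂ →+* Completion F.I :=
  completedLift F.directed_I F.directed_I (isCont_of _) (isCont_of _) (fun _ => rfl)

/-- The interchange of the two factors of `R ⊗̂ R`. -/
def swapHat : F.Tensor₂ →+* F.Tensor₂ :=
  completedLift F.directed_I F.directed_I F.isCont_inc₂₂ F.isCont_inc₁₂
    (fun c => (F.inc₁₂_algebraMap c).symm)

lemma isCont_θ {ι : Type} {T : Type u} [CommRing T] {J : ι → Ideal T} (V : Character A)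
    (g : k →+* Completion J) :
    IsCont F.I (g.comp (F.θ V : F.R →+* k)) := fun _ => ⟨{V}, fun a ha => by
  rw [I_singleton, RingHom.mem_ker] at ha
  rw [RingHom.mem_ker, RingHom.comp_apply, RingHom.comp_apply, RingHom.coe_coe, ha, map_zero,
    map_zero]⟩

/-- The map `θ V ⊗̂ id : R ⊗̂ R → R`, where `R` is written as its own completion. -/
def θHatId (V : Character A) : F.Tensor₂ →+* Completion F.I :=
  completedLift F.directed_I F.directed_I
    (F.isCont_θ V ((of F.I).comp (algebraMap k F.R))) (isCont_of F.I) (fun c => by simp)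

/-- The map `θ V ⊗̂ θ W : R ⊗̂ R → k`, where the discrete ring `k` is written as its completion at
the zero ideal. -/
def θHatθ (V W : Character A) : F.Tensor₂ →+* Completion (fun _ : Unit => (⊥ : Ideal k)) :=
  completedLift F.directed_I F.directed_I (F.isCont_θ V (of _)) (F.isCont_θ W (of _))
    (fun c => by simp)

end AugmentedAlgebra

/-- An augmented algebra together with a continuous comultiplication of `k`-algebras
`R → R ⊗̂ R`. -/
structure AugmentedBialgebra (A : Type) [AddCommGroup A] [Module (ZMod 2) A]
    (k : Type u) [CommRing k] extends AugmentedAlgebra A k where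
  Δ : R →+* toAugmentedAlgebra.Tensor₂
  Δ_algebraMap : ∀ c : k, Δ (algebraMap k R c) = toAugmentedAlgebra.inc₁₂ (algebraMap k R c)
  Δ_cont : IsCont toAugmentedAlgebra.I Δ

namespace AugmentedBialgebra

variable {A : Type} [AddCommGroup A] [Module (ZMod 2) A] {k : Type u} [CommRing k]
variable (F : AugmentedBialgebra A k)

/-- `Δ ⊗̂ id : R ⊗̂ R → R ⊗̂ R ⊗̂ R`. -/
def ΔHatId : F.Tensor₂ →+* F.Tensor₃ :=
  completedLift F.directed_I F.directed_I
    (f := F.j₁₂.comp F.Δ) (g := F.inc₃₃)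
    (IsCont.extend_comp (directed_tensorIdeals F.directed_I F.directed_I) _ F.Δ_cont) F.isCont_inc₃₃
    (fun c => by
      rw [RingHom.comp_apply, F.Δ_algebraMap, F.j₁₂_inc₁₂, F.inc₁₃_algebraMap,
        F.inc₂₃_algebraMap])

/-- `id ⊗̂ Δ : R ⊗̂ R → R ⊗̂ R ⊗̂ R`. -/
def idHatΔ : F.Tensor₂ →+* F.Tensor₃ :=
  completedLift F.directed_I F.directed_I
    (f := F.inc₁₃) (g := F.j₂₃.comp F.Δ)
    F.isCont_inc₁₃ (IsCont.extend_comp (directed_tensorIdeals F.directed_I F.directed_I) _ F.Δ_cont)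
    (fun c => by
      rw [RingHom.comp_apply, F.Δ_algebraMap, F.j₂₃_inc₁₂, F.inc₁₃_algebraMap])

end AugmentedBialgebra

/-- An `A`-equivariant formal group law `(k, R, Δ, θ, y(ε))` with ground ring `k`, for an elementary
abelian 2-group `A`. The topology of `R` is the one generated by the finite products of the kernels
of the augmentations, so it is determined by `θ` and not recorded separately. -/
structure EquivariantFGL (A : Type) [AddCommGroup A] [Module (ZMod 2) A]
    (k : Type u) [CommRing k] extends AugmentedBialgebra A k where
  /-- The orientation `y(ε)`. -/
  y : R
  /-- `R` is complete (and separated). -/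
  complete : Function.Bijective (of toAugmentedAlgebra.I)
  cocomm : ∀ x, toAugmentedAlgebra.swapHat (Δ x) = Δ x
  coassoc : ∀ x, toAugmentedBialgebra.ΔHatId (Δ x) = toAugmentedBialgebra.idHatΔ (Δ x)
  /-- The left counit law; the right one follows by cocommutativity. -/
  counit : ∀ x, toAugmentedAlgebra.θHatId 0 (Δ x) = of _ x
  /-- The compatibility of `θ` with the comultiplication. -/
  θ_Δ : ∀ V W x, toAugmentedAlgebra.θHatθ V W (Δ x) = of _ (θ (V + W) x)
  y_regular : y ∈ nonZeroDivisors R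
  span_y : Ideal.span {y} = RingHom.ker (θ 0)

namespace EquivariantFGL

variable {A B C : Type} [AddCommGroup A] [Module (ZMod 2) A] [AddCommGroup B] [Module (ZMod 2) B]
variable {k k' : Type u} [CommRing k] [CommRing k']

/-- The Euler class `e_V = θ(V)(y(ε))`. -/
def euler (F : EquivariantFGL A k) (V : Character A) : k := F.θ V F.y

/-- The formal group law is 2-torsion if the composite `R → R ⊗̂ R → R` of comultiplication and
multiplication sends `y(ε)` to zero. -/
def IsTwoTorsion (F : EquivariantFGL A k) : Prop := F.mulHat (F.Δ F.y) = 0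

/-- The part of the definition of a morphism that does not involve the comultiplication: for
homomorphisms `α : B → A` and `f : k → k'`, a ring homomorphism `R → R'` over `f` that is compatible
with the orientations and with the augmentations, where the augmentations of the source are indexed
by the characters of `A` through `α`. -/
structure PreHom (α : B →ₗ[ZMod 2] A) (f : k →+* k')
    (F : EquivariantFGL B k) (G : EquivariantFGL A k') where
  φ : F.R →+* G.R
  map_algebraMap : ∀ c, φ (algebraMap k F.R c) = algebraMap k' G.R (f c)
  map_θ : ∀ (V : Character A) (x : F.R), G.θ V (φ x) = f (F.θ (V ∘ₗ α) x)
  map_y : φ F.y = G.y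

namespace PreHom

variable {α : B →ₗ[ZMod 2] A} {f : k →+* k'} {F : EquivariantFGL B k} {G : EquivariantFGL A k'}

lemma I_le_comap (g : PreHom α f F G) (s : Multiset (Character A)) :
    F.I (s.map fun V => V ∘ₗ α) ≤ (G.I s).comap g.φ := by
  induction s using Multiset.induction_on with
  | empty => simp [AugmentedAlgebra.I]
  | cons V s ih =>
    have h1 : F.I ((V ::ₘ s).map fun V => V ∘ₗ α) =
        RingHom.ker (F.θ (V ∘ₗ α)) * F.I (s.map fun V => V ∘ₗ α) := by
      simp [AugmentedAlgebra.I]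
    have h2 : G.I (V ::ₘ s) = RingHom.ker (G.θ V) * G.I s := by
      simp [AugmentedAlgebra.I]
    rw [h1, h2, Ideal.mul_le]
    intro a ha b hb
    rw [Ideal.mem_comap, map_mul]
    refine Ideal.mul_mem_mul ?_ (ih hb)
    rw [RingHom.mem_ker] at ha ⊢
    rw [g.map_θ, ha, map_zero]

/-- The map `φ ⊗̂ φ : R ⊗̂ R → R' ⊗̂ R'`. -/
def hat (g : PreHom α f F G) : F.Tensor₂ →+* G.Tensor₂ :=
  completedLift F.directed_I F.directed_I
    (f := G.inc₁₂.comp g.φ) (g := G.inc₂₂.comp g.φ)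
    (IsCont.of_comp (fun s => ⟨_, g.I_le_comap s⟩) G.isCont_inc₁₂)
    (IsCont.of_comp (fun s => ⟨_, g.I_le_comap s⟩) G.isCont_inc₂₂)
    (fun c => by
      rw [RingHom.comp_apply, RingHom.comp_apply, g.map_algebraMap, G.inc₁₂_algebraMap])

end PreHom

/-- The structure preserving maps over `α : B → A` and `f : k → k'` from a `B`-equivariant to an
`A`-equivariant formal group law. For `α = id` these are the morphisms of `A`-equivariant formal
group laws with first component `f`. -/
structure HomOver (α : B →ₗ[ZMod 2] A) (f : k →+* k')
    (F : EquivariantFGL B k) (G : EquivariantFGL A k') extends PreHom α f F G where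
  map_Δ : ∀ x, G.Δ (φ x) = toPreHom.hat (F.Δ x)

/-- A morphism `F → G` of `A`-equivariant formal group laws is a pair of a map of ground rings and
a map of algebras over it, preserving all structure. -/
def Hom (F : EquivariantFGL A k) (G : EquivariantFGL A k') :=
  Σ f : k →+* k', HomOver (LinearMap.id : A →ₗ[ZMod 2] A) f F G

/-- `G` is the push-forward `α_* F` of the `B`-equivariant formal group law `F` along `α : B → A`:
it has the same ground ring and its algebra is the completion of the algebra `R` of `F` at the
finite products of the ideals `I_V` with `V` in the image of `α^*`, in such a way that all the
structure of `G` is induced from that of `F` along the completion map `c : R → R_α`. -/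
def IsPushforward (α : B →ₗ[ZMod 2] A) (F : EquivariantFGL B k) (G : EquivariantFGL A k) : Prop :=
  ∃ c : HomOver α (RingHom.id k) F G, ∀ s : Multiset (Character A),
    Function.Bijective
      (Ideal.quotientMap (G.I s) c.φ (c.I_le_comap s) :
        F.R ⧸ F.I (s.map fun V => V ∘ₗ α) →+* G.R ⧸ G.I s)

/-- `F` is an initial object of the category of 2-torsion `A`-equivariant formal group laws. -/
def IsUniversalTwoTorsion (F : EquivariantFGL A k) : Prop :=
  F.IsTwoTorsion ∧ ∀ (k' : Type u) [CommRing k'] (G : EquivariantFGL A k'),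
    G.IsTwoTorsion → Nonempty (Unique (Hom F G))

end EquivariantFGL

/-! ### Global 2-torsion group laws -/

/-- The category of elementary abelian 2-groups. -/
abbrev El₂ := FGModuleCat.{0} (ZMod 2)

/-- The group with two elements. -/
abbrev C₂ : El₂ := FGModuleCat.of (ZMod 2) (ZMod 2)

/-- A functor from elementary abelian 2-groups to commutative rings. -/
abbrev El₂Algebra := El₂ᵒᵖ ⥤ CommRingCat.{u}

namespace El₂Algebra

/-- The restriction homomorphism `α^* : X(A) → X(B)` for `α : B → A`. -/
def res (X : El₂Algebra.{u}) {A B : El₂} (α : B ⟶ A) : X.obj (op A) →+* X.obj (op B) :=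
  (X.map α.op).hom

/-- The pullback `e_V = V^* e` of a class `e ∈ X(C₂)` along a character `V`. -/
def pullback (X : El₂Algebra.{u}) (e : X.obj (op C₂)) {A : El₂} (V : Character A) :
    X.obj (op A) :=
  X.res (A := C₂) (B := A) (FGModuleCat.ofHom V) e

/-- The inclusion of the kernel of a character. -/
def kerInclusion {A : El₂} (V : Character A) :
    FGModuleCat.of (ZMod 2) (LinearMap.ker V) ⟶ A :=
  FGModuleCat.ofHom (LinearMap.ker V).subtype

/-- A class `e ∈ X(C₂)` is a coordinate if for every non-trivial character `V` of every elementary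
abelian 2-group `A` the sequence `0 → X(A) → X(A) → X(ker V) → 0`, given by multiplication by `e_V`
and by restriction, is exact. -/
def IsCoordinate (X : El₂Algebra.{u}) (e : X.obj (op C₂)) : Prop :=
  ∀ (A : El₂) (V : Character A), V ≠ 0 →
    Function.Injective (fun x => X.pullback e V * x) ∧
    Function.Exact (fun x => X.pullback e V * x) (X.res (kerInclusion V)) ∧
    Function.Surjective (X.res (kerInclusion V))

end El₂Algebra

/-- A global 2-torsion group law. -/
structure GlobalGroupLaw where
  X : El₂Algebra.{u}
  e : X.obj (op C₂)
  isCoordinate : X.IsCoordinate e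

/-- `X` is an initial global 2-torsion group law: there is exactly one map of algebras preserving
the coordinate into every other one. -/
def GlobalGroupLaw.IsInitial (X : GlobalGroupLaw.{u}) : Prop :=
  ∀ Y : GlobalGroupLaw.{u}, ∃! φ : X.X ⟶ Y.X, (φ.app (op C₂)).hom X.e = Y.e

/-- A global 2-torsion Lazard ring: a functor whose value at `A` is the ground ring `L_A` of an
initial 2-torsion `A`-equivariant formal group law, and whose value at `α : B → A` is the map
`L_A → L_B` underlying the unique morphism from the initial `A`-equivariant formal group law to the
push-forward along `α` of the initial `B`-equivariant one. These data are unique up to unique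
isomorphism. -/
structure GlobalLazardRing where
  L : El₂Algebra.{u}
  F : ∀ A : El₂, EquivariantFGL A (L.obj (op A))
  universal : ∀ A, (F A).IsUniversalTwoTorsion
  res_classifies : ∀ {A B : El₂} (α : B ⟶ A), ∃ G : EquivariantFGL A (L.obj (op B)),
    EquivariantFGL.IsPushforward α.hom.hom (F B) G ∧
      Nonempty (EquivariantFGL.HomOver (LinearMap.id : A →ₗ[ZMod 2] A) (L.res α) (F A) G)

/-- The universal Euler class `e_σ ∈ L_{C₂}` of the sign character of `C₂`. -/
def GlobalLazardRing.eσ (𝓛 : GlobalLazardRing.{u}) : 𝓛.L.obj (op C₂) :=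
  (𝓛.F C₂).euler (LinearMap.id : ZMod 2 →ₗ[ZMod 2] ZMod 2)

end

/-!
The continuous points of a 2-torsion `A`-equivariant formal group law `F` over `k`, with values in
varying `k`-algebras, form elementary abelian 2-groups. The natural functions on the homomorphisms
`x` from `B^*` to points of `F` form a ring, contravariant in `B`. The coordinate `x ↦ y(x(V))` of
a character `V` generates the kernel of the restriction to `ker V`, and it is regular: fix `b` with
`V(b) = 1` and let the values of `x` at the characters that are non-trivial on `b` be translated by
a variable point; at `V` the coordinate becomes the coordinate `y` of the variable point, and the
divided difference in this variable inverts the multiplication by it. So these functions form a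
global group law. The initial global group law `L` maps to it, and the evaluation at the
homomorphism `θ : A^* → points` is a ring homomorphism `L(A) → k`, the classifying homomorphism
of `F`.

Conversely, for every global group law `X`, the completion of `X(A × C₂)` at the Euler classes
of the graphs of the characters of `A` is a 2-torsion `A`-equivariant formal group law over `X(A)`,
compatibly with restriction. For `X = L` its classifying homomorphism `L(A) → L(A)` is natural in
`A` and preserves the coordinate, hence is the identity, and evaluating elements of `L(A × C₂)` at
points of `F` gives the morphism to `F`. So this formal group law is universal.
-/

universe v w

noncomputable section

namespace IdealCompletion

variable {R S T T' k : Type u} [CommRing R] [CommRing S] [CommRing T] [CommRing T'] [CommRing k]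
variable {ι κ μ : Type} {I : ι → Ideal R} {J : κ → Ideal S}

lemma ker_le_ker_comp (f : R →+* T) (φ : T →+* T') : RingHom.ker f ≤ RingHom.ker (φ.comp f) :=
  (Ideal.ker_le_comap f).trans_eq (RingHom.comap_ker φ f)

/-- Continuity of a ring homomorphism from a completion to a discrete ring: it vanishes on the
kernel of one of the projections. -/
def IsDiscreteCont (Φ : Completion I →+* T) : Prop :=
  ∃ i, RingHom.ker (proj I i) ≤ RingHom.ker Φ

lemma isDiscreteCont_proj (I : ι → Ideal R) (i : ι) : IsDiscreteCont (proj I i) := ⟨i, le_rfl⟩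

lemma ker_proj_mono {i j : ι} (h : I i ≤ I j) :
    RingHom.ker (proj I i) ≤ RingHom.ker (proj I j) := by
  intro x hx
  rw [RingHom.mem_ker] at hx ⊢
  rw [← factor_proj I h, hx, map_zero]

lemma exists_sub_of_mem_ker_proj (I : ι → Ideal R) (i : ι) (x : Completion I) :
    ∃ r, x - of I r ∈ RingHom.ker (proj I i) := by
  obtain ⟨r, hr⟩ := Ideal.Quotient.mk_surjective (proj I i x)
  exact ⟨r, by rw [RingHom.mem_ker, map_sub, proj_of, hr, sub_self]⟩

lemma Completion.ext_proj {x y : Completion I} (h : ∀ i, proj I i x = proj I i y) : x = y :=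
  Subtype.ext (funext h)

namespace IsDiscreteCont

lemma comp_left {Φ : Completion I →+* T} (h : IsDiscreteCont Φ) (φ : T →+* T') :
    IsDiscreteCont (φ.comp Φ) :=
  h.imp fun _ hi => hi.trans (ker_le_ker_comp Φ φ)

lemma comp_extend (hI : Directed (· ≥ ·) I) {f : R →+* Completion J} (hf : IsCont I f)
    {Φ : Completion J →+* T} (h : IsDiscreteCont Φ) : IsDiscreteCont (Φ.comp (extend hI hf)) := by
  obtain ⟨j, hj⟩ := h
  obtain ⟨i, hi⟩ := hf j
  refine ⟨i, fun x hx => hj ?_⟩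
  rw [RingHom.mem_ker] at hx ⊢
  rw [proj_extend hI hf hi, hx, map_zero]

lemma exists_le_ker_comp {f : R →+* Completion J} (hf : IsCont I f) {Φ : Completion J →+* T}
    (h : IsDiscreteCont Φ) : ∃ i, I i ≤ RingHom.ker (Φ.comp f) := by
  obtain ⟨j, hj⟩ := h
  exact (hf j).imp fun _ hi a ha => hj (hi ha)

lemma ext (hI : Directed (· ≥ ·) I) {Φ Ψ : Completion I →+* T} (hΦ : IsDiscreteCont Φ)
    (hΨ : IsDiscreteCont Ψ) (h : ∀ r, Φ (of I r) = Ψ (of I r)) : Φ = Ψ := by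
  obtain ⟨i, hi⟩ := hΦ
  obtain ⟨j, hj⟩ := hΨ
  obtain ⟨l, hli, hlj⟩ := hI i j
  ext x
  obtain ⟨r, hr⟩ := exists_sub_of_mem_ker_proj I l x
  have hΦr : Φ (x - of I r) = 0 := hi (ker_proj_mono hli hr)
  have hΨr : Ψ (x - of I r) = 0 := hj (ker_proj_mono hlj hr)
  rw [map_sub, sub_eq_zero] at hΦr hΨr
  rw [hΦr, hΨr, h]

end IsDiscreteCont

/-- The continuous extension to the completion of a continuous homomorphism to a discrete ring. -/
def extendDiscrete (f : R →+* T) (hf : ∃ i, I i ≤ RingHom.ker f) : Completion I →+* T :=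
  (Ideal.Quotient.lift (I hf.choose) f fun _ ha => hf.choose_spec ha).comp (proj I hf.choose)

lemma isDiscreteCont_extendDiscrete {f : R →+* T} (hf : ∃ i, I i ≤ RingHom.ker f) :
    IsDiscreteCont (extendDiscrete f hf) :=
  (isDiscreteCont_proj I _).comp_left _

variable [Algebra k R] [Algebra k S]

lemma tmul_eq_inl_mul_inr (a : R) (b : S) : a ⊗ₜ[k] b = inl k R S a * inr k R S b := by
  simp [inl, inr]

lemma tensor_ringHom_ext {f g : R ⊗[k] S →+* T} (hl : ∀ a, f (inl k R S a) = g (inl k R S a))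
    (hr : ∀ b, f (inr k R S b) = g (inr k R S b)) : f = g := by
  refine RingHom.ext fun x => ?_
  induction x using TensorProduct.induction_on with
  | zero => rw [map_zero, map_zero]
  | tmul a b => rw [tmul_eq_inl_mul_inr, map_mul, map_mul, hl, hr]
  | add x y hx hy => rw [map_add, map_add, hx, hy]

lemma completedTensor_ringHom_ext (hI : Directed (· ≥ ·) I) (hJ : Directed (· ≥ ·) J)
    {Φ Ψ : CompletedTensor k I J →+* T} (hΦ : IsDiscreteCont Φ) (hΨ : IsDiscreteCont Ψ)
    (hl : ∀ a, Φ (of _ (inl k R S a)) = Ψ (of _ (inl k R S a)))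
    (hr : ∀ b, Φ (of _ (inr k R S b)) = Ψ (of _ (inr k R S b))) : Φ = Ψ :=
  hΦ.ext (directed_tensorIdeals hI hJ) hΨ fun r =>
    RingHom.congr_fun (tensor_ringHom_ext (f := Φ.comp (of _)) (g := Ψ.comp (of _)) hl hr) r

section tensorLift

variable {f : R →+* T} {g : S →+* T} (h : ∀ c : k, f (algebraMap k R c) = g (algebraMap k S c))

lemma tensorLift_inl (a : R) : tensorLift f g h (inl k R S a) = f a :=
  (tensorLift_tmul f g h a 1).trans (by rw [map_one, mul_one])

lemma tensorLift_inr (b : S) : tensorLift f g h (inr k R S b) = g b :=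
  (tensorLift_tmul f g h 1 b).trans (by rw [map_one, one_mul])

lemma exists_tensorIdeals_le_ker_tensorLift (hf : ∃ i, I i ≤ RingHom.ker f)
    (hg : ∃ j, J j ≤ RingHom.ker g) :
    ∃ p, tensorIdeals k I J p ≤ RingHom.ker (tensorLift f g h) := by
  obtain ⟨i, hi⟩ := hf
  obtain ⟨j, hj⟩ := hg
  refine ⟨(i, j), sup_le (Ideal.map_le_iff_le_comap.2 fun a ha => ?_)
    (Ideal.map_le_iff_le_comap.2 fun b hb => ?_)⟩
  · rw [Ideal.mem_comap, RingHom.mem_ker, tensorLift_inl]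
    exact hi ha
  · rw [Ideal.mem_comap, RingHom.mem_ker, tensorLift_inr]
    exact hj hb

end tensorLift

section completedLift

variable (hI : Directed (· ≥ ·) I) (hJ : Directed (· ≥ ·) J)
    {K : μ → Ideal T} {f : R →+* Completion K} {g : S →+* Completion K}
    (hf : IsCont I f) (hg : IsCont J g) (h : ∀ c : k, f (algebraMap k R c) = g (algebraMap k S c))

lemma completedLift_inl (a : R) : completedLift hI hJ hf hg h (of _ (inl k R S a)) = f a :=
  (extend_of (directed_tensorIdeals hI hJ) _ _).trans (tensorLift_inl h a)

lemma completedLift_inr (b : S) : completedLift hI hJ hf hg h (of _ (inr k R S b)) = g b :=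
  (extend_of (directed_tensorIdeals hI hJ) _ _).trans (tensorLift_inr h b)

lemma IsDiscreteCont.comp_completedLift {Φ : Completion K →+* T'} (hΦ : IsDiscreteCont Φ) :
    IsDiscreteCont (Φ.comp (completedLift hI hJ hf hg h)) :=
  hΦ.comp_extend _ _

end completedLift

end IdealCompletion

open IdealCompletion

namespace AugmentedAlgebra

variable {A : Type} [AddCommGroup A] [Module (ZMod 2) A] {k : Type u} [CommRing k]
variable {T T' : Type u} [CommRing T] [CommRing T']

/-- The points of the formal scheme `Spf R` with values in a `k`-algebra `T`, given by its
structure map `η`: the continuous homomorphisms of `k`-algebras `R → T`. The structure map is a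
parameter, and not an instance, since it changes under base change. -/
@[ext]
structure Point (F : AugmentedAlgebra A k) (η : k →+* T) where
  hom : F.R →+* T
  hom_algebraMap : ∀ c, hom (algebraMap k F.R c) = η c
  cont : ∃ s, F.I s ≤ RingHom.ker hom

namespace Point

variable {F : AugmentedAlgebra A k} {η : k →+* T} {η' : k →+* T'}

lemma agree (p q : F.Point η) (c : k) :
    p.hom (algebraMap k F.R c) = q.hom (algebraMap k F.R c) := by
  rw [p.hom_algebraMap, q.hom_algebraMap]

/-- Base change of points. -/
def map (φ : T →+* T') (p : F.Point η) : F.Point (φ.comp η) where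
  hom := φ.comp p.hom
  hom_algebraMap c := congrArg φ (p.hom_algebraMap c)
  cont := p.cont.imp fun _ hs => hs.trans (ker_le_ker_comp p.hom φ)

/-- The relation `φ ∘ p = p'` between points with values in two rings. It replaces the equation
`p.map φ = p'`, whose two sides need not have syntactically equal types. -/
def MapsTo (φ : T →+* T') (p : F.Point η) (p' : F.Point η') : Prop :=
  ∀ a, φ (p.hom a) = p'.hom a

lemma mapsTo_map (φ : T →+* T') (p : F.Point η) : MapsTo φ p (p.map φ) := fun _ => rfl

lemma MapsTo.comp_eq {φ : T →+* T'} {p : F.Point η} {p' : F.Point η'} (h : MapsTo φ p p') :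
    φ.comp η = η' := by
  ext c
  rw [← p'.hom_algebraMap, ← h, p.hom_algebraMap, RingHom.comp_apply]

/-- The points given by the augmentations. -/
def ofθ (F : AugmentedAlgebra A k) (η : k →+* T) (V : Character A) : F.Point η where
  hom := η.comp (F.θ V : F.R →+* k)
  hom_algebraMap c := by simp
  cont := ⟨{V}, by
    rw [F.I_singleton]
    exact ker_le_ker_comp _ η⟩

lemma mapsTo_ofθ {φ : T →+* T'} (h : φ.comp η = η') (V : Character A) :
    MapsTo φ (ofθ F η V) (ofθ F η' V) :=
  fun a => RingHom.congr_fun h (F.θ V a)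

/-- The homomorphism from the completion of `R` to `T` determined by a point. -/
def eval₁ (p : F.Point η) : Completion F.I →+* T := extendDiscrete p.hom p.cont

/-- The homomorphism `R ⊗̂ R → T` determined by two points. -/
def eval₂ (p q : F.Point η) : F.Tensor₂ →+* T :=
  extendDiscrete (tensorLift p.hom q.hom (p.agree q))
    (exists_tensorIdeals_le_ker_tensorLift (p.agree q) p.cont q.cont)

lemma agree_tensorLift (p q r : F.Point η) (c : k) :
    p.hom (algebraMap k F.R c) =
      tensorLift q.hom r.hom (q.agree r) (algebraMap k (F.R ⊗[k] F.R) c) :=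
  (p.agree q c).trans (tensorLift_inl (q.agree r) _).symm

/-- The homomorphism `R ⊗̂ R ⊗̂ R → T` determined by three points. -/
def eval₃ (p q r : F.Point η) : F.Tensor₃ →+* T :=
  extendDiscrete (tensorLift p.hom (tensorLift q.hom r.hom (q.agree r)) (p.agree_tensorLift q r))
    (exists_tensorIdeals_le_ker_tensorLift (p.agree_tensorLift q r) p.cont
      (exists_tensorIdeals_le_ker_tensorLift (q.agree r) q.cont r.cont))

lemma isDiscreteCont_eval₁ (p : F.Point η) : IsDiscreteCont p.eval₁ :=
  isDiscreteCont_extendDiscrete _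

lemma isDiscreteCont_eval₂ (p q : F.Point η) : IsDiscreteCont (p.eval₂ q) :=
  isDiscreteCont_extendDiscrete _

lemma isDiscreteCont_eval₃ (p q r : F.Point η) : IsDiscreteCont (p.eval₃ q r) :=
  isDiscreteCont_extendDiscrete _

lemma eval₁_of (p : F.Point η) (a : F.R) : p.eval₁ (of _ a) = p.hom a := rfl

lemma eval₂_inc₁₂ (p q : F.Point η) (a : F.R) : p.eval₂ q (F.inc₁₂ a) = p.hom a :=
  tensorLift_inl (p.agree q) a

lemma eval₂_inc₂₂ (p q : F.Point η) (a : F.R) : p.eval₂ q (F.inc₂₂ a) = q.hom a :=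
  tensorLift_inr (p.agree q) a

lemma eval₃_inc₁₃ (p q r : F.Point η) (a : F.R) : p.eval₃ q r (F.inc₁₃ a) = p.hom a :=
  tensorLift_inl (p.agree_tensorLift q r) a

lemma eval₃_inc₂₃ (p q r : F.Point η) (a : F.R) : p.eval₃ q r (F.inc₂₃ a) = q.hom a :=
  (tensorLift_inr (p.agree_tensorLift q r) _).trans (tensorLift_inl (q.agree r) a)

lemma eval₃_inc₃₃ (p q r : F.Point η) (a : F.R) : p.eval₃ q r (F.inc₃₃ a) = r.hom a :=
  (tensorLift_inr (p.agree_tensorLift q r) _).trans (tensorLift_inr (q.agree r) a)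

lemma eq_eval₁ {Φ : Completion F.I →+* T} (hΦ : IsDiscreteCont Φ) (p : F.Point η)
    (h : ∀ a, Φ (of _ a) = p.hom a) : Φ = p.eval₁ :=
  hΦ.ext F.directed_I p.isDiscreteCont_eval₁ h

lemma eq_eval₂ {Φ : F.Tensor₂ →+* T} (hΦ : IsDiscreteCont Φ) (p q : F.Point η)
    (h₁ : ∀ a, Φ (F.inc₁₂ a) = p.hom a) (h₂ : ∀ a, Φ (F.inc₂₂ a) = q.hom a) : Φ = p.eval₂ q :=
  completedTensor_ringHom_ext F.directed_I F.directed_I hΦ (isDiscreteCont_eval₂ p q)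
    (fun a => (h₁ a).trans (eval₂_inc₁₂ p q a).symm)
    (fun a => (h₂ a).trans (eval₂_inc₂₂ p q a).symm)

lemma eq_eval₃ {Φ : F.Tensor₃ →+* T} (hΦ : IsDiscreteCont Φ) (p q r : F.Point η)
    (h₁ : ∀ a, Φ (F.inc₁₃ a) = p.hom a) (h₂ : ∀ a, Φ (F.inc₂₃ a) = q.hom a)
    (h₃ : ∀ a, Φ (F.inc₃₃ a) = r.hom a) : Φ = p.eval₃ q r :=
  completedTensor_ringHom_ext F.directed_I (directed_tensorIdeals F.directed_I F.directed_I) hΦ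
    (isDiscreteCont_eval₃ p q r) (fun a => (h₁ a).trans (eval₃_inc₁₃ p q r a).symm)
    (RingHom.congr_fun (tensor_ringHom_ext
      (f := (Φ.comp (of _)).comp (inr k F.R (F.R ⊗[k] F.R)))
      (g := ((p.eval₃ q r).comp (of _)).comp (inr k F.R (F.R ⊗[k] F.R)))
      (fun a => (h₂ a).trans (eval₃_inc₂₃ p q r a).symm)
      (fun a => (h₃ a).trans (eval₃_inc₃₃ p q r a).symm)))

lemma MapsTo.eval₂ {φ : T →+* T'} {p q : F.Point η} {p' q' : F.Point η'} (hp : MapsTo φ p p')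
    (hq : MapsTo φ q q') (x : F.Tensor₂) : φ (p.eval₂ q x) = p'.eval₂ q' x :=
  RingHom.congr_fun (eq_eval₂ ((isDiscreteCont_eval₂ p q).comp_left φ) p' q'
    (fun a => (congrArg φ (eval₂_inc₁₂ p q a)).trans (hp a))
    (fun a => (congrArg φ (eval₂_inc₂₂ p q a)).trans (hq a))) x

lemma comp_completedLift {ι : Type} {S : Type u} [CommRing S] {K : ι → Ideal S}
    {f g : F.R →+* Completion K} (hf : IsCont F.I f) (hg : IsCont F.I g)
    (h : ∀ c : k, f (algebraMap k F.R c) = g (algebraMap k F.R c)) {Φ : Completion K →+* T}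
    (hΦ : IsDiscreteCont Φ) (p q : F.Point η) (h₁ : ∀ a, Φ (f a) = p.hom a)
    (h₂ : ∀ a, Φ (g a) = q.hom a) (x : F.Tensor₂) :
    Φ (completedLift F.directed_I F.directed_I hf hg h x) = p.eval₂ q x :=
  RingHom.congr_fun (eq_eval₂ (hΦ.comp_completedLift F.directed_I F.directed_I hf hg h) p q
    (fun a => (congrArg Φ (completedLift_inl F.directed_I F.directed_I hf hg h a)).trans (h₁ a))
    (fun a => (congrArg Φ (completedLift_inr F.directed_I F.directed_I hf hg h a)).trans (h₂ a))) x

lemma eval₂_swapHat (p q : F.Point η) (x : F.Tensor₂) :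
    p.eval₂ q (F.swapHat x) = q.eval₂ p x := by
  unfold swapHat
  exact comp_completedLift _ _ _ (isDiscreteCont_eval₂ p q) _ _ (eval₂_inc₂₂ p q)
    (eval₂_inc₁₂ p q) x

lemma eval₁_mulHat (p : F.Point η) (x : F.Tensor₂) : p.eval₁ (F.mulHat x) = p.eval₂ p x := by
  unfold mulHat
  exact comp_completedLift _ _ _ (isDiscreteCont_eval₁ p) _ _ (eval₁_of p) (eval₁_of p) x

lemma eval₁_θHatId (p : F.Point η) (V : Character A) (x : F.Tensor₂) :
    p.eval₁ (F.θHatId V x) = (ofθ F η V).eval₂ p x := by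
  unfold θHatId
  exact comp_completedLift _ _ _ (isDiscreteCont_eval₁ p) _ _ (fun _ => p.hom_algebraMap _)
    (eval₁_of p) x

lemma proj_θHatθ (V W : Character A) (x : F.Tensor₂) :
    proj _ () (F.θHatθ V W x) =
      (ofθ F (Ideal.Quotient.mk _) V).eval₂ (ofθ F (Ideal.Quotient.mk _) W) x := by
  unfold θHatθ
  exact comp_completedLift _ _ _ (isDiscreteCont_proj _ ()) _ _ (fun _ => rfl) (fun _ => rfl) x

lemma eval₃_j₁₂ (p q r : F.Point η) (x : F.Tensor₂) :
    p.eval₃ q r (F.j₁₂ x) = p.eval₂ q x := by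
  unfold j₁₂
  exact comp_completedLift _ _ _ (isDiscreteCont_eval₃ p q r) _ _ (eval₃_inc₁₃ p q r)
    (eval₃_inc₂₃ p q r) x

lemma eval₃_j₂₃ (p q r : F.Point η) (x : F.Tensor₂) :
    p.eval₃ q r (F.j₂₃ x) = q.eval₂ r x := by
  unfold j₂₃
  exact comp_completedLift _ _ _ (isDiscreteCont_eval₃ p q r) _ _ (eval₃_inc₂₃ p q r)
    (eval₃_inc₃₃ p q r) x

/-- The image of a point under the map of formal schemes defined by a continuous homomorphism of
algebras over a homomorphism `f` of ground rings. -/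
def comap {B : Type} [AddCommGroup B] [Module (ZMod 2) B] {k' : Type u} [CommRing k']
    {G : AugmentedAlgebra B k'} {f : k →+* k'} {ξ : k' →+* T} (φ : F.R →+* G.R)
    (hφ : ∀ c, φ (algebraMap k F.R c) = algebraMap k' G.R (f c))
    (hI : ∀ s, ∃ t, F.I t ≤ (G.I s).comap φ) (p : G.Point ξ) : F.Point (ξ.comp f) where
  hom := p.hom.comp φ
  hom_algebraMap c := by
    rw [RingHom.comp_apply, hφ, p.hom_algebraMap, RingHom.comp_apply]
  cont := by
    obtain ⟨s, hs⟩ := p.cont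
    exact (hI s).imp fun _ ht a ha => hs (ht ha)

/-- The tautological point of `R` with values in `R ⧸ I s`. -/
def taut (F : AugmentedAlgebra A k) (s : Multiset (Character A)) :
    F.Point ((Ideal.Quotient.mk (F.I s)).comp (algebraMap k F.R)) where
  hom := Ideal.Quotient.mk (F.I s)
  hom_algebraMap _ := rfl
  cont := ⟨s, by rw [Ideal.mk_ker]⟩

variable (F) (i : Multiset (Character A) × Multiset (Character A))

/-- The structure map of the universal pair of points of `R`, whose values lie in the discrete
quotients of `R ⊗̂ R`. -/
def pairη : k →+* (F.R ⊗[k] F.R) ⧸ tensorIdeals k F.I F.I i :=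
  ((proj _ i).comp F.inc₁₂).comp (algebraMap k F.R)

/-- The first point of the universal pair. -/
def pairFst : F.Point (pairη F i) :=
  ⟨(proj _ i).comp F.inc₁₂, fun _ => rfl, F.isCont_inc₁₂ i⟩

/-- The second point of the universal pair. -/
def pairSnd : F.Point (pairη F i) :=
  ⟨(proj _ i).comp F.inc₂₂, fun c => congrArg (proj _ i) (F.inc₁₂_algebraMap c).symm,
    F.isCont_inc₂₂ i⟩

end Point

variable (F : AugmentedAlgebra A k)

lemma I_cons (V : Character A) (s : Multiset (Character A)) :
    F.I (V ::ₘ s) = RingHom.ker (F.θ V) * F.I s := by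
  rw [← Multiset.singleton_add, F.I_add, F.I_singleton]

lemma completion_ext_eval₁ {x y : Completion F.I}
    (h : ∀ (T : Type u) [CommRing T] (η : k →+* T) (p : F.Point η), p.eval₁ x = p.eval₁ y) :
    x = y := by
  refine Completion.ext_proj fun s => ?_
  rw [Point.eq_eval₁ (isDiscreteCont_proj _ s) (Point.taut F s) (fun _ => rfl)]
  exact h _ _ _

lemma tensor₂_ext_eval₂ {x y : F.Tensor₂}
    (h : ∀ (T : Type u) [CommRing T] (η : k →+* T) (p q : F.Point η), p.eval₂ q x = p.eval₂ q y) :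
    x = y := by
  refine Completion.ext_proj fun i => ?_
  rw [Point.eq_eval₂ (isDiscreteCont_proj _ i) (Point.pairFst F i) (Point.pairSnd F i)
    (fun _ => rfl) (fun _ => rfl)]
  exact h _ _ _ _

lemma tensor₃_ext_eval₃ {x y : F.Tensor₃}
    (h : ∀ (T : Type u) [CommRing T] (η : k →+* T) (p q r : F.Point η),
      p.eval₃ q r x = p.eval₃ q r y) : x = y := by
  refine Completion.ext_proj fun i => ?_
  let Φ := proj (tensorIdeals k F.I (tensorIdeals k F.I F.I)) i
  let η : k →+* _ := (Φ.comp F.inc₁₃).comp (algebraMap k F.R)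
  let p : F.Point η := ⟨Φ.comp F.inc₁₃, fun _ => rfl, F.isCont_inc₁₃ i⟩
  let q : F.Point η :=
    ⟨Φ.comp F.inc₂₃, fun c => congrArg Φ (F.inc₁₃_algebraMap c).symm, F.isCont_inc₂₃ i⟩
  let r : F.Point η :=
    ⟨Φ.comp F.inc₃₃, fun c => congrArg Φ
      ((F.inc₂₃_algebraMap c).symm.trans (F.inc₁₃_algebraMap c).symm), F.isCont_inc₃₃ i⟩
  rw [Point.eq_eval₃ (isDiscreteCont_proj _ i) p q r (fun _ => rfl) (fun _ => rfl) (fun _ => rfl)]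
  exact h _ η p q r

end AugmentedAlgebra

open AugmentedAlgebra

namespace AugmentedBialgebra

variable {A : Type} [AddCommGroup A] [Module (ZMod 2) A] {k : Type u} [CommRing k]
variable {T T' : Type u} [CommRing T] [CommRing T']
variable (F : AugmentedBialgebra A k) {η : k →+* T} {η' : k →+* T'}

/-- The sum of two points, defined by the comultiplication. -/
def addPoint (p q : F.Point η) : F.Point η where
  hom := (p.eval₂ q).comp F.Δ
  hom_algebraMap c := by
    rw [RingHom.comp_apply, F.Δ_algebraMap, Point.eval₂_inc₁₂, p.hom_algebraMap]
  cont := (Point.isDiscreteCont_eval₂ p q).exists_le_ker_comp F.Δ_cont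

lemma eval₃_ΔHatId (p q r : F.Point η) (x : F.Tensor₂) :
    p.eval₃ q r (F.ΔHatId x) = (F.addPoint p q).eval₂ r x := by
  unfold ΔHatId
  exact Point.comp_completedLift _ _ _ (Point.isDiscreteCont_eval₃ p q r) _ _
    (fun _ => Point.eval₃_j₁₂ p q r _) (Point.eval₃_inc₃₃ p q r) x

lemma eval₃_idHatΔ (p q r : F.Point η) (x : F.Tensor₂) :
    p.eval₃ q r (F.idHatΔ x) = p.eval₂ (F.addPoint q r) x := by
  unfold idHatΔ
  exact Point.comp_completedLift _ _ _ (Point.isDiscreteCont_eval₃ p q r) _ _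
    (Point.eval₃_inc₁₃ p q r) (fun _ => Point.eval₃_j₂₃ p q r _) x

end AugmentedBialgebra

namespace EquivariantFGL

variable {A : Type} [AddCommGroup A] [Module (ZMod 2) A] {k : Type u} [CommRing k]
variable {T T' : Type u} [CommRing T] [CommRing T']
variable (F : EquivariantFGL A k) {η : k →+* T} {η' : k →+* T'}

instance : Add (F.Point η) := ⟨F.addPoint⟩

instance : Zero (F.Point η) := ⟨Point.ofθ _ η 0⟩

instance : AddCommMonoid (F.Point η) where
  nsmul := nsmulRec
  add_assoc p q r := Point.ext <| RingHom.ext fun x =>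
    (F.eval₃_ΔHatId p q r (F.Δ x)).symm.trans
      ((congrArg (p.eval₃ q r) (F.coassoc x)).trans (F.eval₃_idHatΔ p q r (F.Δ x)))
  add_comm p q := Point.ext <| RingHom.ext fun x =>
    (Point.eval₂_swapHat q p (F.Δ x)).symm.trans (congrArg (q.eval₂ p) (F.cocomm x))
  zero_add p := Point.ext <| RingHom.ext fun x =>
    (Point.eval₁_θHatId p 0 (F.Δ x)).symm.trans (congrArg p.eval₁ (F.counit x))
  add_zero p := Point.ext <| RingHom.ext fun x =>
    (Point.eval₂_swapHat _ p (F.Δ x)).symm.trans <|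
      (congrArg ((Point.ofθ _ η 0).eval₂ p) (F.cocomm x)).trans
        ((Point.eval₁_θHatId p 0 (F.Δ x)).symm.trans (congrArg p.eval₁ (F.counit x)))

variable {F} in
lemma mapsTo_add {φ : T →+* T'} {p q : F.Point η} {p' q' : F.Point η'}
    (hp : Point.MapsTo φ p p') (hq : Point.MapsTo φ q q') :
    Point.MapsTo φ (p + q) (p' + q') :=
  fun x => hp.eval₂ hq (F.Δ x)

variable {F} in
lemma mapsTo_zero {φ : T →+* T'} (h : φ.comp η = η') :
    Point.MapsTo φ (0 : F.Point η) (0 : F.Point η') :=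
  Point.mapsTo_ofθ h 0

lemma θ_y : F.θ 0 F.y = 0 := by
  rw [← RingHom.mem_ker, ← F.span_y]
  exact Ideal.mem_span_singleton_self F.y

lemma zero_hom_y : (0 : F.Point η).hom F.y = 0 :=
  (congrArg η F.θ_y).trans (map_zero η)

lemma exists_y_mul_eq (r : F.R) : ∃ q, F.y * q = r - algebraMap k F.R (F.θ 0 r) := by
  have hr : r - algebraMap k F.R (F.θ 0 r) ∈ RingHom.ker (F.θ 0) := by
    rw [RingHom.mem_ker, map_sub, AlgHom.commutes, Algebra.algebraMap_self_apply, sub_self]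
  rw [← F.span_y, Ideal.mem_span_singleton] at hr
  exact hr.imp fun _ hq => hq.symm

lemma eq_zero_of_hom_y {p : F.Point η} (h : p.hom F.y = 0) : p = 0 := by
  refine Point.ext (RingHom.ext fun r => ?_)
  obtain ⟨q, hq⟩ := F.exists_y_mul_eq r
  have hr := congrArg p.hom hq
  rw [map_mul, h, zero_mul, map_sub, p.hom_algebraMap] at hr
  exact sub_eq_zero.1 hr.symm

variable {F} in
lemma IsTwoTorsion.add_self (hF : F.IsTwoTorsion) (p : F.Point η) : p + p = 0 :=
  F.eq_zero_of_hom_y <| (Point.eval₁_mulHat p (F.Δ F.y)).symm.trans <|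
    (congrArg p.eval₁ hF).trans (map_zero p.eval₁)

lemma ofθ_add (V W : Character A) :
    Point.ofθ F.toAugmentedAlgebra η V + Point.ofθ F.toAugmentedAlgebra η W =
      Point.ofθ F.toAugmentedAlgebra η (V + W) := by
  refine Point.ext (RingHom.ext fun x => ?_)
  let v : F.Point (RingHom.id k) := Point.ofθ F.toAugmentedAlgebra _ V
  let w : F.Point (RingHom.id k) := Point.ofθ F.toAugmentedAlgebra _ W
  have mk_injective : Function.Injective (Ideal.Quotient.mk (⊥ : Ideal k)) := by
    rw [RingHom.injective_iff_ker_eq_bot, Ideal.mk_ker]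
  have eval₂_universal : v.eval₂ w (F.Δ x) = F.θ (V + W) x := by
    refine mk_injective (((Point.mapsTo_ofθ (RingHom.comp_id _) V).eval₂
      (Point.mapsTo_ofθ (RingHom.comp_id _) W) (F.Δ x)).trans ?_)
    rw [← Point.proj_θHatθ, F.θ_Δ, proj_of]
  exact ((Point.mapsTo_ofθ (RingHom.comp_id η) V).eval₂
    (Point.mapsTo_ofθ (RingHom.comp_id η) W) (F.Δ x)).symm.trans (congrArg η eval₂_universal)

/-- The homomorphism from the group of characters to the group of points given by the
augmentations. -/
def θPoint (η : k →+* T) : Character A →+ F.Point η where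
  toFun V := Point.ofθ _ η V
  map_zero' := rfl
  map_add' V W := (F.ofθ_add V W).symm

/-- Base change of points as a homomorphism. -/
def mapPoint (η : k →+* T) (φ : T →+* T') : F.Point η →+ F.Point (φ.comp η) where
  toFun p := p.map φ
  map_zero' := Point.ext rfl
  map_add' p q := Point.ext <| RingHom.ext <|
    mapsTo_add (Point.mapsTo_map φ p) (Point.mapsTo_map φ q)

end EquivariantFGL

/-! ### Functions on the scheme of homomorphisms to a formal group law -/

namespace Character

variable {B C : Type} [AddCommGroup B] [Module (ZMod 2) B] [AddCommGroup C] [Module (ZMod 2) C]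

lemma eq_zero_or_one (V : Character B) (b : B) : V b = 0 ∨ V b = 1 :=
  (eq_or_ne (V b) 0).imp_right (Fin.eq_one_of_ne_zero (V b))

/-- Restriction of characters. -/
def comap (β : B →ₗ[ZMod 2] C) : Character C →+ Character B where
  toFun V := V ∘ₗ β
  map_zero' := LinearMap.zero_comp β
  map_add' V W := LinearMap.add_comp β W V

/-- The modification of a homomorphism out of a group of characters by `t` times the evaluation at
`b`. -/
@[simps]
def twist {M : Type*} [AddCommMonoid M] (b : B) (x : Character B →+ M) (t : M) (ht : t + t = 0) :
    Character B →+ M where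
  toFun W := x W + if W b = 0 then 0 else t
  map_zero' := by rw [map_zero, LinearMap.zero_apply, if_pos rfl, add_zero]
  map_add' V W := by
    rw [map_add, add_add_add_comm, LinearMap.add_apply]
    congr 1
    rcases eq_zero_or_one V b with h | h <;> rcases eq_zero_or_one W b with h' | h' <;>
      simp [h, h', ht, show (1 : ZMod 2) + 1 = 0 from rfl]

end Character

section TestPoint

variable {A B C : Type} [AddCommGroup A] [Module (ZMod 2) A] [AddCommGroup B] [Module (ZMod 2) B]
  [AddCommGroup C] [Module (ZMod 2) C]
variable {k : Type u} [CommRing k]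

namespace EquivariantFGL

variable (F : EquivariantFGL A k)

/-- A `k`-algebra `T`, with structure map `η`, together with a homomorphism from the characters of
`B` to the `T`-valued points of a formal group law over `k`. -/
structure TestPoint (B : Type) [AddCommGroup B] [Module (ZMod 2) B] : Type (u + 1) where
  T : Type u
  [commRing : CommRing T]
  η : k →+* T
  x : Character B →+ F.Point η

attribute [instance] TestPoint.commRing

variable {F}

/-- A ring homomorphism that transforms one test point into another. -/
def TestPoint.MapsTo {p q : F.TestPoint B} (φ : p.T →+* q.T) : Prop :=
  ∀ W, Point.MapsTo φ (p.x W) (q.x W)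

variable (F)

/-- The ring of functions on the scheme of homomorphisms from the characters of `B` to a formal
group law, consisting of the natural families of values at all test points. -/
def functions (B : Type) [AddCommGroup B] [Module (ZMod 2) B] :
    Subring (∀ p : F.TestPoint B, p.T) where
  carrier := {h | ∀ (p q : F.TestPoint B) (φ : p.T →+* q.T), TestPoint.MapsTo φ → φ (h p) = h q}
  mul_mem' ha hb p q φ hφ := by rw [Pi.mul_apply, Pi.mul_apply, map_mul, ha p q φ hφ, hb p q φ hφ]
  one_mem' _ _ φ _ := map_one φ
  add_mem' ha hb p q φ hφ := by rw [Pi.add_apply, Pi.add_apply, map_add, ha p q φ hφ, hb p q φ hφ]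
  zero_mem' _ _ φ _ := map_zero φ
  neg_mem' ha p q φ hφ := by rw [Pi.neg_apply, Pi.neg_apply, map_neg, ha p q φ hφ]

/-- The image of a test point under a homomorphism of groups. -/
def TestPoint.push {F : EquivariantFGL A k} (β : B →ₗ[ZMod 2] C) (p : F.TestPoint B) :
    F.TestPoint C where
  T := p.T
  η := p.η
  x := p.x.comp (Character.comap β)

/-- The restriction of functions along a homomorphism of groups. -/
def functionsMap (β : B →ₗ[ZMod 2] C) : F.functions C →+* F.functions B where
  toFun h := ⟨fun p => h.1 (p.push β), fun p q φ hφ =>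
    h.2 (p.push β) (q.push β) φ fun W => hφ (W ∘ₗ β)⟩
  map_one' := rfl
  map_mul' _ _ := rfl
  map_zero' := rfl
  map_add' _ _ := rfl

/-- The coordinate function pulled back along a character. -/
def coordinate (V : Character B) : F.functions B :=
  ⟨fun p => (p.x V).hom F.y, fun _ _ _ h => h V F.y⟩

end EquivariantFGL

end TestPoint

/-! ### Divided differences -/

section BaseChange

variable {A : Type} [AddCommGroup A] [Module (ZMod 2) A] {k : Type u} [CommRing k]
variable {T T' : Type u} [CommRing T] [Algebra k T] [CommRing T'] [Algebra k T']

namespace AugmentedAlgebra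

variable (F : AugmentedAlgebra A k)

variable (T) in
/-- The ideals of `T ⊗ R` generated by the ideals `I s` of `R`. The base change of `Spf R` to `T`
is the formal scheme defined by `T ⊗ R` and these ideals. -/
def baseChangeI (s : Multiset (Character A)) : Ideal (T ⊗[k] F.R) := (F.I s).map (inr k T F.R)

/-- The base change of `R` along a homomorphism of `k`-algebras. -/
abbrev baseChangeMap (φ : T →ₐ[k] T') : T ⊗[k] F.R →+* T' ⊗[k] F.R :=
  (Algebra.TensorProduct.map φ (AlgHom.id k F.R)).toRingHom

lemma baseChangeMap_inl (φ : T →ₐ[k] T') (c : T) :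
    F.baseChangeMap φ (inl k T F.R c) = inl k T' F.R (φ c) :=
  congrArg (φ c ⊗ₜ[k] ·) (map_one (AlgHom.id k F.R))

lemma baseChangeMap_inr (φ : T →ₐ[k] T') (a : F.R) :
    F.baseChangeMap φ (inr k T F.R a) = inr k T' F.R a :=
  congrArg (· ⊗ₜ[k] a) (map_one φ)

lemma baseChangeI_le_comap (φ : T →ₐ[k] T') {s t : Multiset (Character A)} (hst : F.I s ≤ F.I t) :
    F.baseChangeI T s ≤ (F.baseChangeI T' t).comap (F.baseChangeMap φ) :=
  Ideal.map_le_iff_le_comap.2 fun a ha => by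
    rw [Ideal.mem_comap, Ideal.mem_comap, baseChangeMap_inr]
    exact Ideal.mem_map_of_mem _ (hst ha)

namespace Point

variable {F} in
/-- A ring homomorphism that transforms one point into another, as a homomorphism of
`k`-algebras. -/
def MapsTo.algHom {φ : T →+* T'} {t : F.Point (algebraMap k T)} {t' : F.Point (algebraMap k T')}
    (h : MapsTo φ t t') : T →ₐ[k] T' :=
  { φ with commutes' := RingHom.congr_fun h.comp_eq }

variable {F} (t : F.Point (algebraMap k T)) {t' : F.Point (algebraMap k T')}

/-- The `T`-linear extension to `T ⊗ R` of a point with values in `T`. -/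
def linearExtend : T ⊗[k] F.R →+* T :=
  tensorLift (RingHom.id T) t.hom fun c => (t.hom_algebraMap c).symm

lemma linearExtend_inl (c : T) : t.linearExtend (inl k T F.R c) = c := tensorLift_inl _ c

lemma linearExtend_inr (a : F.R) : t.linearExtend (inr k T F.R a) = t.hom a := tensorLift_inr _ a

variable {t}

lemma baseChangeI_le_ker_linearExtend {s : Multiset (Character A)}
    (h : F.I s ≤ RingHom.ker t.hom) : F.baseChangeI T s ≤ RingHom.ker t.linearExtend :=
  Ideal.map_le_iff_le_comap.2 fun a ha => by
    rw [Ideal.mem_comap, RingHom.mem_ker, linearExtend_inr]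
    exact h ha

lemma MapsTo.linearExtend {φ : T →+* T'} (h : MapsTo φ t t') (d : T ⊗[k] F.R) :
    t'.linearExtend (F.baseChangeMap h.algHom d) = φ (t.linearExtend d) :=
  RingHom.congr_fun (tensor_ringHom_ext
    (f := t'.linearExtend.comp (F.baseChangeMap h.algHom)) (g := φ.comp t.linearExtend)
    (fun c => by
      rw [RingHom.comp_apply, baseChangeMap_inl, linearExtend_inl, RingHom.comp_apply,
        linearExtend_inl]
      rfl)
    (fun a => by
      rw [RingHom.comp_apply, baseChangeMap_inr, linearExtend_inr, RingHom.comp_apply,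
        linearExtend_inr]
      exact (h a).symm)) d

end Point

variable (T) in
/-- The structure map of a quotient of `T ⊗ R` as a `T`-algebra. -/
def baseChangeUnit (s : Multiset (Character A)) : T →+* (T ⊗[k] F.R) ⧸ F.baseChangeI T s :=
  (Ideal.Quotient.mk _).comp (inl k T F.R)

variable (T) in
/-- The universal point of `R` with values in a quotient of `T ⊗ R`. -/
def universalPoint (s : Multiset (Character A)) :
    F.Point ((F.baseChangeUnit T s).comp (algebraMap k T)) where
  hom := (Ideal.Quotient.mk (F.baseChangeI T s)).comp (inr k T F.R)
  hom_algebraMap c := congrArg (Ideal.Quotient.mk _) (inl_algebraMap k T F.R c).symm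
  cont := ⟨s, fun a ha => by
    rw [RingHom.mem_ker, RingHom.comp_apply]
    exact Ideal.Quotient.eq_zero_iff_mem.2 (Ideal.mem_map_of_mem _ ha)⟩

end AugmentedAlgebra

namespace EquivariantFGL

variable (F : EquivariantFGL A k)

lemma y_mul_cancel {a b : F.R} (h : F.y * a = F.y * b) : a = b :=
  (mul_cancel_left_mem_nonZeroDivisors F.y_regular).1 h

/-- The operator `r ↦ (r - θ(ε)(r)) / y(ε)`. -/
def dividedDifference : F.R →ₗ[k] F.R where
  toFun r := (F.exists_y_mul_eq r).choose
  map_add' a b := F.y_mul_cancel (by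
    rw [mul_add, (F.exists_y_mul_eq _).choose_spec, (F.exists_y_mul_eq _).choose_spec,
      (F.exists_y_mul_eq _).choose_spec, map_add, map_add]
    ring)
  map_smul' c a := F.y_mul_cancel (by
    rw [mul_smul_comm, RingHom.id_apply, (F.exists_y_mul_eq _).choose_spec,
      (F.exists_y_mul_eq _).choose_spec, map_smul, smul_sub, smul_eq_mul, map_mul,
      ← Algebra.smul_def])

lemma y_mul_dividedDifference (r : F.R) :
    F.y * F.dividedDifference r = r - algebraMap k F.R (F.θ 0 r) :=
  (F.exists_y_mul_eq r).choose_spec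

lemma dividedDifference_y_mul (r : F.R) : F.dividedDifference (F.y * r) = r :=
  F.y_mul_cancel (by
    rw [y_mul_dividedDifference, map_mul, F.θ_y, zero_mul, map_zero, sub_zero])

lemma inr_mul_tmul (t : T) (a b : F.R) : inr k T F.R a * t ⊗ₜ[k] b = t ⊗ₜ[k] (a * b) :=
  (Algebra.TensorProduct.tmul_mul_tmul 1 t a b).trans (by rw [one_mul])

lemma baseChange_dividedDifference_y_mul (d : T ⊗[k] F.R) :
    F.dividedDifference.baseChange T (inr k T F.R F.y * d) = d := by
  induction d using TensorProduct.induction_on with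
  | zero => rw [mul_zero, map_zero]
  | tmul t r => rw [inr_mul_tmul, LinearMap.baseChange_tmul, dividedDifference_y_mul]
  | add a b ha hb => rw [mul_add, map_add, ha, hb]

lemma y_mul_baseChange_dividedDifference (d : T ⊗[k] F.R) :
    inr k T F.R F.y * F.dividedDifference.baseChange T d =
      d - inl k T F.R ((0 : F.Point (algebraMap k T)).linearExtend d) := by
  induction d using TensorProduct.induction_on with
  | zero => rw [map_zero, mul_zero, map_zero, map_zero, sub_zero]
  | tmul t r =>
    have linearExtend_tmul : (0 : F.Point (algebraMap k T)).linearExtend (t ⊗ₜ[k] r) =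
        t * algebraMap k T (F.θ 0 r) := rfl
    rw [LinearMap.baseChange_tmul, inr_mul_tmul, y_mul_dividedDifference, TensorProduct.tmul_sub,
      linearExtend_tmul, map_mul, inl_algebraMap, tmul_eq_inl_mul_inr t (algebraMap k F.R _)]
  | add a b ha hb =>
    rw [map_add, mul_add, ha, hb, map_add, map_add]
    ring

lemma baseChange_dividedDifference_baseChangeMap (φ : T →ₐ[k] T') (d : T ⊗[k] F.R) :
    F.dividedDifference.baseChange T' (F.baseChangeMap φ d) =
      F.baseChangeMap φ (F.dividedDifference.baseChange T d) := by
  induction d using TensorProduct.induction_on with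
  | zero => simp only [map_zero]
  | tmul t r => rfl
  | add a b ha hb => simp only [map_add, ha, hb]

lemma I_cons_zero (s : Multiset (Character A)) : F.I (0 ::ₘ s) = Ideal.span {F.y} * F.I s := by
  rw [F.I_cons, F.span_y]

lemma mem_baseChangeI_cons_zero {s : Multiset (Character A)} {z : T ⊗[k] F.R} :
    z ∈ F.baseChangeI T (0 ::ₘ s) ↔ ∃ w ∈ F.baseChangeI T s, inr k T F.R F.y * w = z := by
  rw [AugmentedAlgebra.baseChangeI, I_cons_zero, Ideal.map_mul, Ideal.map_span,
    Set.image_singleton, Ideal.mem_span_singleton_mul]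
  rfl

lemma baseChange_dividedDifference_mem {s : Multiset (Character A)} {z : T ⊗[k] F.R}
    (h : z ∈ F.baseChangeI T (0 ::ₘ s)) :
    F.dividedDifference.baseChange T z ∈ F.baseChangeI T s := by
  obtain ⟨w, hw, rfl⟩ := F.mem_baseChangeI_cons_zero.1 h
  rwa [baseChange_dividedDifference_y_mul]

lemma I_cons_zero_le (s : Multiset (Character A)) : F.I (0 ::ₘ s) ≤ F.I s :=
  (F.I_cons_zero s).trans_le Ideal.mul_le_right

end EquivariantFGL

end BaseChange

/-! ### Division by the coordinate function -/

namespace EquivariantFGL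

variable {A B : Type} [AddCommGroup A] [Module (ZMod 2) A] [AddCommGroup B] [Module (ZMod 2) B]
variable {k : Type u} [CommRing k] {F : EquivariantFGL A k}

namespace TestPoint

instance (p : F.TestPoint B) : Algebra k p.T := p.η.toAlgebra

lemma mapsTo_twist {T T' : Type u} [CommRing T] [CommRing T'] {η : k →+* T} {η' : k →+* T'}
    {φ : T →+* T'} {b : B} {x : Character B →+ F.Point η} {x' : Character B →+ F.Point η'}
    {t : F.Point η} {t' : F.Point η'} {ht : t + t = 0} {ht' : t' + t' = 0}
    (hx : ∀ W, Point.MapsTo φ (x W) (x' W)) (h : Point.MapsTo φ t t') (W : Character B) :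
    Point.MapsTo φ (Character.twist b x t ht W) (Character.twist b x' t' ht' W) := by
  refine mapsTo_add (hx W) ?_
  split_ifs
  · exact mapsTo_zero h.comp_eq
  · exact h

/-- Base change of test points. -/
def baseChange (p : F.TestPoint B) {T : Type u} [CommRing T] (φ : p.T →+* T) : F.TestPoint B where
  T := T
  η := φ.comp p.η
  x := (F.mapPoint p.η φ).comp p.x

/-- The modification of a test point in the direction of `b` whose value at the character `V` is
the point `t` if `V b = 1`. -/
def shift (hF : F.IsTwoTorsion) (b : B) (V : Character B) (p : F.TestPoint B) (t : F.Point p.η) :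
    F.TestPoint B where
  T := p.T
  η := p.η
  x := Character.twist b p.x (t + p.x V) (hF.add_self _)

/-- The universal deformation of a test point in the direction of `b`. -/
def deform (hF : F.IsTwoTorsion) (b : B) (V : Character B) (p : F.TestPoint B)
    (s : Multiset (Character A)) : F.TestPoint B :=
  (p.baseChange (F.baseChangeUnit p.T s)).shift hF b V (F.universalPoint p.T s)

variable {hF : F.IsTwoTorsion} {b : B} {V : Character B} {p q : F.TestPoint B}

lemma MapsTo.shift {φ : p.T →+* q.T} (hφ : MapsTo φ) {t : F.Point p.η} {t' : F.Point q.η}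
    (ht : Point.MapsTo φ t t') : MapsTo (p := p.shift hF b V t) (q := q.shift hF b V t') φ :=
  mapsTo_twist (ht := hF.add_self _) (ht' := hF.add_self _) hφ (mapsTo_add ht (hφ V))

lemma shift_x_self (hb : V b = 1) (t : F.Point p.η) : (p.shift hF b V t).x V = t := by
  refine (Character.twist_apply b p.x _ (hF.add_self _) V).trans ?_
  rw [hb, if_neg one_ne_zero, add_left_comm, hF.add_self, add_zero]

lemma mapsTo_shift_self :
    MapsTo (p := p.shift hF b V (p.x V)) (q := p) (RingHom.id p.T) := fun W a => by
  have x_eq : (p.shift hF b V (p.x V)).x W = p.x W :=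
    (Character.twist_apply b p.x _ (hF.add_self _) W).trans (by
      rw [hF.add_self, ite_self, add_zero])
  exact congrArg (fun z : F.Point p.η => z.hom a) x_eq

/-- The change of rings between the universal deformations. -/
abbrev deformMap {φ : p.T →+* q.T} (hφ : Point.MapsTo φ (p.x V) (q.x V))
    {s t : Multiset (Character A)} (hst : F.I s ≤ F.I t) :
    (p.T ⊗[k] F.R) ⧸ F.baseChangeI p.T s →+* (q.T ⊗[k] F.R) ⧸ F.baseChangeI q.T t :=
  Ideal.quotientMap (F.baseChangeI q.T t) (F.baseChangeMap hφ.algHom)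
    (F.baseChangeI_le_comap hφ.algHom hst)

lemma mapsTo_deformMap {φ : p.T →+* q.T} (hφ : MapsTo φ) {s t : Multiset (Character A)}
    (hst : F.I s ≤ F.I t) :
    MapsTo (p := p.deform hF b V s) (q := q.deform hF b V t) (deformMap (hφ V) hst) := by
  refine MapsTo.shift (p := p.baseChange _) (q := q.baseChange _) (fun W a => ?_) fun a => ?_
  · exact congrArg (Ideal.Quotient.mk _)
      ((F.baseChangeMap_inl _ _).trans (congrArg (inl k q.T F.R) (hφ W a)))
  · exact congrArg (Ideal.Quotient.mk _) (F.baseChangeMap_inr _ a)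

lemma linearExtend_eq_apply_shift (h : F.functions B) {t : F.Point p.η}
    {s : Multiset (Character A)} (hs : F.I s ≤ RingHom.ker t.hom) {w : p.T ⊗[k] F.R}
    (hw : Ideal.Quotient.mk _ w = h.1 (p.deform hF b V s)) :
    Point.linearExtend (T := p.T) t w = h.1 (p.shift hF b V t) := by
  let ψ : (p.T ⊗[k] F.R) ⧸ F.baseChangeI p.T s →+* p.T :=
    Ideal.Quotient.lift _ (Point.linearExtend (T := p.T) t) fun _ ha =>
      Point.baseChangeI_le_ker_linearExtend hs ha
  rw [← h.2 (p.deform hF b V s) (p.shift hF b V t) ψ, ← hw]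
  · rfl
  · exact MapsTo.shift (p := p.baseChange _) (fun W a => Point.linearExtend_inl _ _)
      (Point.linearExtend_inr _)

lemma linearExtend_eq_apply (h : F.functions B) {s : Multiset (Character A)}
    (hs : F.I s ≤ RingHom.ker (p.x V).hom) {w : p.T ⊗[k] F.R}
    (hw : Ideal.Quotient.mk _ w = h.1 (p.deform hF b V s)) :
    Point.linearExtend (T := p.T) (p.x V) w = h.1 p := by
  exact (linearExtend_eq_apply_shift h hs hw).trans
    (h.2 (p.shift hF b V (p.x V)) p (RingHom.id p.T) mapsTo_shift_self)

variable (hb : V b = 1)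
include hb

lemma eq_zero_of_coordinate_mul_eq_zero (hF : F.IsTwoTorsion) {g : F.functions B}
    (hg : F.coordinate V * g = 0) : g = 0 := by
  refine Subtype.ext (funext fun p => ?_)
  obtain ⟨s, hs⟩ := (p.x V).cont
  let P := p.deform hF b V (0 ::ₘ s)
  obtain ⟨w, hw⟩ := Ideal.Quotient.mk_surjective (I := F.baseChangeI p.T (0 ::ₘ s)) (g.1 P)
  have y_mul_apply : (P.x V).hom F.y * g.1 P = 0 := congrFun (congrArg Subtype.val hg) P
  have mk_y_mul : Ideal.Quotient.mk (F.baseChangeI p.T (0 ::ₘ s)) (inr k p.T F.R F.y * w) = 0 := by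
    rw [show P.x V = F.universalPoint p.T (0 ::ₘ s) from shift_x_self hb _, ← hw] at y_mul_apply
    exact (map_mul _ _ _).trans y_mul_apply
  have w_mem := F.baseChange_dividedDifference_mem (Ideal.Quotient.eq_zero_iff_mem.1 mk_y_mul)
  rw [baseChange_dividedDifference_y_mul] at w_mem
  rw [← linearExtend_eq_apply g ((F.I_cons_zero_le s).trans hs) hw]
  exact Point.baseChangeI_le_ker_linearExtend (T := p.T) hs w_mem

omit hb in
lemma apply_linearExtend_dividedDifference {h : F.functions B} {φ : p.T →+* q.T} (hφ : MapsTo φ)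
    {s t : Multiset (Character A)} (hst : F.I s ≤ F.I t) (ht : F.I t ≤ RingHom.ker (q.x V).hom)
    {w : p.T ⊗[k] F.R} {w' : q.T ⊗[k] F.R}
    (hw : Ideal.Quotient.mk _ w = h.1 (p.deform hF b V (0 ::ₘ s)))
    (hw' : Ideal.Quotient.mk _ w' = h.1 (q.deform hF b V (0 ::ₘ t))) :
    φ (Point.linearExtend (T := p.T) (p.x V) (F.dividedDifference.baseChange p.T w)) =
      Point.linearExtend (T := q.T) (q.x V) (F.dividedDifference.baseChange q.T w') := by
  have hst' : F.I (0 ::ₘ s) ≤ F.I (0 ::ₘ t) := by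
    rw [I_cons_zero, I_cons_zero]
    exact Ideal.mul_mono_right hst
  have mk_eq := h.2 _ (q.deform hF b V (0 ::ₘ t)) _ (mapsTo_deformMap (hF := hF) (b := b) hφ hst')
  rw [← hw, ← hw'] at mk_eq
  have sub_mem := F.baseChange_dividedDifference_mem
    (Ideal.Quotient.eq.1 (Ideal.quotientMap_mk.symm.trans mk_eq))
  rw [map_sub, baseChange_dividedDifference_baseChangeMap] at sub_mem
  have linearExtend_sub := Point.baseChangeI_le_ker_linearExtend (T := q.T) ht sub_mem
  rw [RingHom.mem_ker, map_sub, sub_eq_zero] at linearExtend_sub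
  exact ((hφ V).linearExtend (T := p.T) (T' := q.T) _).symm.trans linearExtend_sub

lemma linearExtend_zero_eq_zero {h : F.functions B}
    (h0 : ∀ q : F.TestPoint B, q.x V = 0 → h.1 q = 0) {s : Multiset (Character A)}
    {w : p.T ⊗[k] F.R} (hw : Ideal.Quotient.mk _ w = h.1 (p.deform hF b V (0 ::ₘ s))) :
    (0 : F.Point (algebraMap k p.T)).linearExtend w = 0 := by
  have hs : F.I (0 ::ₘ s) ≤ RingHom.ker (0 : F.Point p.η).hom :=
    (F.I_cons_zero s).trans_le
      (Ideal.mul_le_left.trans ((Ideal.span_singleton_le_iff_mem _).2 F.zero_hom_y))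
  exact (linearExtend_eq_apply_shift h hs hw).trans (h0 _ (shift_x_self hb 0))

lemma exists_eq_coordinate_mul (hF : F.IsTwoTorsion) {h : F.functions B}
    (h0 : ∀ q : F.TestPoint B, q.x V = 0 → h.1 q = 0) :
    ∃ g : F.functions B, h = F.coordinate V * g := by
  have exists_lift (p : F.TestPoint B) : ∃ (s : Multiset (Character A)) (w : p.T ⊗[k] F.R),
      F.I s ≤ RingHom.ker (p.x V).hom ∧
        Ideal.Quotient.mk _ w = h.1 (p.deform hF b V (0 ::ₘ s)) := by
    obtain ⟨s, hs⟩ := (p.x V).cont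
    exact ⟨s, (Ideal.Quotient.mk_surjective _).imp fun _ hw => ⟨hs, hw⟩⟩
  choose s w hs hw using exists_lift
  refine ⟨⟨fun p => Point.linearExtend (T := p.T) (p.x V)
    (F.dividedDifference.baseChange p.T (w p)), fun p q φ hφ => ?_⟩,
    Subtype.ext (funext fun p => ?_)⟩
  · obtain ⟨m, hm, hm'⟩ := F.directed_I (s p) (s q)
    obtain ⟨w', hw'⟩ := Ideal.Quotient.mk_surjective (h.1 (p.deform hF b V (0 ::ₘ m)))
    have eq_of_p := apply_linearExtend_dividedDifference (p := p) (φ := RingHom.id _)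
      (fun _ _ => rfl) hm (hs p) hw' (hw p)
    have eq_of_q := apply_linearExtend_dividedDifference hφ hm' (hs q) hw' (hw q)
    exact (congrArg φ eq_of_p.symm).trans eq_of_q
  · have extend_y_mul := congrArg (Point.linearExtend (T := p.T) (p.x V))
      (F.y_mul_baseChange_dividedDifference (w p))
    rw [linearExtend_zero_eq_zero hb h0 (hw p), map_zero, sub_zero, map_mul,
      Point.linearExtend_inr] at extend_y_mul
    exact ((linearExtend_eq_apply h ((F.I_cons_zero_le _).trans (hs p)) (hw p)).symm.trans
      extend_y_mul.symm)

end TestPoint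
end EquivariantFGL

/-! ### Global group laws -/

namespace Character

section

variable {B : Type} [AddCommGroup B] [Module (ZMod 2) B] (V W : Character B) (b : B)

lemma exists_eq_one {V : Character B} (hV : V ≠ 0) : ∃ b, V b = 1 := by
  by_contra! h
  exact hV (LinearMap.ext fun b => (V.eq_zero_or_one b).resolve_right (h b))

/-- The endomorphism `a ↦ a - V(a) b`. If `V(b) = 1` it is a projection onto the kernel of `V`. -/
def projKer : B →ₗ[ZMod 2] B := LinearMap.id - V.smulRight b

lemma projKer_apply (a : B) : V.projKer b a = a - V a • b := rfl

lemma projKer_comp_subtype : V.projKer b ∘ₗ (LinearMap.ker V).subtype = (LinearMap.ker V).subtype :=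
  LinearMap.ext fun a => by
    rw [LinearMap.comp_apply, Submodule.subtype_apply, projKer_apply, LinearMap.mem_ker.1 a.2,
      zero_smul, sub_zero]

lemma comp_projKer_add_ite : W ∘ₗ V.projKer b + (if W b = 0 then 0 else V) = W := by
  ext c
  rcases W.eq_zero_or_one b with h | h <;> simp [projKer_apply, h]

variable {V b} (hb : V b = 1)

include hb

lemma ne_zero_of_eq_one : V ≠ 0 := by
  rintro rfl
  exact zero_ne_one hb

lemma projKer_mem_ker (a : B) : V.projKer b a ∈ LinearMap.ker V := by
  simp [projKer_apply, hb]

/-- The projection onto the kernel of `V`, with its kernel as codomain. -/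
def toKer : B →ₗ[ZMod 2] LinearMap.ker V :=
  (V.projKer b).codRestrict (LinearMap.ker V) (projKer_mem_ker hb)

lemma toKer_comp_subtype : toKer hb ∘ₗ (LinearMap.ker V).subtype = LinearMap.id :=
  LinearMap.ext fun a =>
    Subtype.ext (LinearMap.congr_fun (V.projKer_comp_subtype b) a)

lemma projKer_comp_projKer : V.projKer b ∘ₗ V.projKer b = V.projKer b :=
  congrArg (· ∘ₗ toKer hb) (V.projKer_comp_subtype b)

end

/-- The kernel of a character, as an object of the category of elementary abelian 2-groups. -/
abbrev kerObj {A : El₂} (V : Character A) : El₂ := FGModuleCat.of (ZMod 2) (LinearMap.ker V)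

end Character

namespace El₂Algebra

variable (X : El₂Algebra.{u}) {A B C : El₂}

/-- Restriction along a linear map: `El₂Algebra.res` without the bundling of morphisms. -/
def restrict (α : B →ₗ[ZMod 2] A) : X.obj (op A) →+* X.obj (op B) :=
  X.res (A := A) (B := B) (FGModuleCat.ofHom α)

lemma restrict_restrict (α : B →ₗ[ZMod 2] A) (β : C →ₗ[ZMod 2] B) (x : X.obj (op A)) :
    X.restrict β (X.restrict α x) = X.restrict (α ∘ₗ β) x :=
  (RingHom.congr_fun (congrArg CommRingCat.Hom.hom
    (X.map_comp (FGModuleCat.ofHom α : B ⟶ A).op (FGModuleCat.ofHom β : C ⟶ B).op)) x).symm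

lemma restrict_id (x : X.obj (op A)) : X.restrict (LinearMap.id : A →ₗ[ZMod 2] A) x = x :=
  RingHom.congr_fun (congrArg CommRingCat.Hom.hom (X.map_id (op A))) x

lemma restrict_pullback (e : X.obj (op C₂)) (V : Character A) (β : B →ₗ[ZMod 2] A) :
    X.restrict β (X.pullback e V) = X.pullback e (V ∘ₗ β) :=
  X.restrict_restrict (A := C₂) V β e

lemma pullback_id (e : X.obj (op C₂)) :
    X.pullback (A := C₂) e (LinearMap.id : ZMod 2 →ₗ[ZMod 2] ZMod 2) = e :=
  X.restrict_id (A := C₂) e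

lemma restrict_toKer_res_kerInclusion {V : Character A} {b : A} (hb : V b = 1) (x : X.obj (op A)) :
    X.restrict (A := V.kerObj) (Character.toKer hb) (X.res (kerInclusion V) x) =
      X.restrict (V.projKer b) x :=
  X.restrict_restrict (B := V.kerObj) (LinearMap.ker V).subtype (Character.toKer hb) x

lemma res_kerInclusion_restrict_toKer {V : Character A} {b : A} (hb : V b = 1)
    (x : X.obj (op V.kerObj)) :
    X.res (kerInclusion V) (X.restrict (A := V.kerObj) (Character.toKer hb) x) = x := by
  refine (X.restrict_restrict (A := V.kerObj) (C := V.kerObj) (Character.toKer hb)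
    (LinearMap.ker V).subtype x).trans ?_
  rw [Character.toKer_comp_subtype]
  exact X.restrict_id x

lemma res_kerInclusion_restrict_projKer (V : Character A) (b : A) (x : X.obj (op A)) :
    X.res (kerInclusion V) (X.restrict (V.projKer b) x) = X.res (kerInclusion V) x := by
  refine (X.restrict_restrict (C := V.kerObj) (V.projKer b) (LinearMap.ker V).subtype x).trans ?_
  rw [V.projKer_comp_subtype]
  rfl

lemma res_kerInclusion_pullback (e : X.obj (op C₂)) (V : Character A) :
    X.res (kerInclusion V) (X.pullback e V) = X.pullback e (0 : Character V.kerObj) :=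
  (X.restrict_pullback (B := V.kerObj) e V (LinearMap.ker V).subtype).trans
    (congrArg (X.pullback e) (LinearMap.ext fun a : LinearMap.ker V => a.2))

variable {X}

/-- A vector `b` with `V(b) = 1` splits the inclusion of `ker V`, so that exactness can be tested on
the values at `A` alone. -/
lemma isCoordinate_of_projKer {e : X.obj (op C₂)}
    (pullback_zero : ∀ A : El₂, X.pullback e (0 : Character A) = 0)
    (regular : ∀ {A : El₂} {V : Character A} {b : A}, V b = 1 → ∀ x,
      X.pullback e V * x = 0 → x = 0)
    (dvd : ∀ {A : El₂} {V : Character A} {b : A}, V b = 1 → ∀ x,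
      X.restrict (V.projKer b) x = 0 → X.pullback e V ∣ x) : X.IsCoordinate e := by
  intro A V hV
  obtain ⟨b, hb⟩ := Character.exists_eq_one hV
  refine ⟨fun x y hxy => ?_, fun x => ⟨fun hx => ?_, ?_⟩,
    fun x => ⟨_, X.res_kerInclusion_restrict_toKer hb x⟩⟩
  · refine sub_eq_zero.1 (regular hb _ ?_)
    rw [mul_sub, sub_eq_zero]
    exact hxy
  · obtain ⟨g, hg⟩ := dvd hb x (by rw [← X.restrict_toKer_res_kerInclusion hb, hx, map_zero])
    exact ⟨g, hg.symm⟩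
  · rintro ⟨g, rfl⟩
    rw [map_mul, X.res_kerInclusion_pullback, pullback_zero, zero_mul]

end El₂Algebra

namespace GlobalGroupLaw

variable (X : GlobalGroupLaw.{u}) {A B C : El₂}

/-- The Euler class of a character in a global group law. -/
def euler (V : Character A) : X.X.obj (op A) := X.X.pullback X.e V

lemma restrict_euler (V : Character A) (β : B →ₗ[ZMod 2] A) :
    X.X.restrict β (X.euler V) = X.euler (V ∘ₗ β) := X.X.restrict_pullback X.e V β

lemma euler_id : X.euler (A := C₂) (LinearMap.id : ZMod 2 →ₗ[ZMod 2] ZMod 2) = X.e :=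
  X.X.pullback_id X.e

variable {V : Character A} {b : A} (hb : V b = 1)

include hb in
lemma euler_mul_cancel {x y : X.X.obj (op A)} (h : X.euler V * x = X.euler V * y) : x = y :=
  (X.isCoordinate A V (Character.ne_zero_of_eq_one hb)).1 h

include hb in
lemma euler_dvd {x : X.X.obj (op A)} (h : X.X.restrict (V.projKer b) x = 0) : X.euler V ∣ x := by
  have hres : X.X.res (El₂Algebra.kerInclusion V) x = 0 := by
    rw [← X.X.res_kerInclusion_restrict_projKer V b, h, map_zero]
  obtain ⟨g, hg⟩ := ((X.isCoordinate A V (Character.ne_zero_of_eq_one hb)).2.1 x).1 hres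
  exact ⟨g, hg.symm⟩

include hb in
lemma euler_dvd_sub (x : X.X.obj (op A)) : X.euler V ∣ x - X.X.restrict (V.projKer b) x :=
  X.euler_dvd hb (by
    rw [map_sub, X.X.restrict_restrict, Character.projKer_comp_projKer hb, sub_self])

lemma euler_zero : X.euler (0 : Character A) = 0 := by
  let σ : Character C₂ := LinearMap.id
  have hσ : σ ≠ 0 := Character.ne_zero_of_eq_one (b := (1 : ZMod 2)) rfl
  have hres : X.X.pullback X.e (0 : Character σ.kerObj) = 0 := by
    rw [← X.X.res_kerInclusion_pullback X.e σ]
    exact ((X.isCoordinate C₂ σ hσ).2.1 _).2 ⟨1, mul_one _⟩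
  have h := congrArg (X.X.restrict (B := A) 0) hres
  rwa [X.X.restrict_pullback, LinearMap.comp_zero, map_zero] at h

/-- A morphism of global group laws, whose values may lie in different universes. -/
structure Hom (X : GlobalGroupLaw.{u}) (Y : GlobalGroupLaw.{v}) where
  app : ∀ A : El₂, X.X.obj (op A) →+* Y.X.obj (op A)
  naturality : ∀ {A B : El₂} (α : B →ₗ[ZMod 2] A) (x : X.X.obj (op A)),
    app B (X.X.restrict α x) = Y.X.restrict α (app A x)
  app_e : app C₂ X.e = Y.e

namespace Hom

variable {X} {Y : GlobalGroupLaw.{v}}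

lemma app_euler (φ : X.Hom Y) (V : Character A) : φ.app A (X.euler V) = Y.euler V :=
  (φ.naturality (A := C₂) V X.e).trans (congrArg (Y.X.restrict (A := C₂) V) φ.app_e)

/-- The composite of two morphisms of global group laws. -/
def comp {Z : GlobalGroupLaw.{w}} (ψ : Y.Hom Z) (φ : X.Hom Y) : X.Hom Z where
  app A := (ψ.app A).comp (φ.app A)
  naturality α x := by
    rw [RingHom.comp_apply, φ.naturality, ψ.naturality, RingHom.comp_apply]
  app_e := by rw [RingHom.comp_apply, φ.app_e, ψ.app_e]

variable {Y : GlobalGroupLaw.{u}}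

/-- The morphism of global group laws given by a natural transformation. -/
def ofNatTrans (ψ : X.X ⟶ Y.X) (h : (ψ.app (op C₂)).hom X.e = Y.e) : X.Hom Y where
  app A := (ψ.app (op A)).hom
  naturality {A B} α x :=
    congrArg (fun f => f.hom x) (ψ.naturality (FGModuleCat.ofHom α : B ⟶ A).op)
  app_e := h

/-- The natural transformation underlying a morphism of global group laws. -/
def toNatTrans (φ : X.Hom Y) : X.X ⟶ Y.X where
  app A := CommRingCat.ofHom (φ.app A.unop)
  naturality _ _ f := CommRingCat.hom_ext <| RingHom.ext fun x => φ.naturality f.unop.hom.hom x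

end Hom

end GlobalGroupLaw

/-! ### Change of universe -/

namespace El₂Algebra

variable (X : El₂Algebra.{u}) [∀ A : El₂ᵒᵖ, Small.{v} (X.obj A)]

/-- A model of a functor from elementary abelian 2-groups to rings in another universe. -/
def shrink : El₂Algebra.{v} where
  obj A := CommRingCat.of (Shrink.{v} (X.obj A))
  map {A B} f := CommRingCat.ofHom
    (((Shrink.ringEquiv (X.obj B)).symm.toRingHom.comp (X.map f).hom).comp
      (Shrink.ringEquiv (X.obj A)).toRingHom)
  map_id A := by
    ext x
    simp
  map_comp f g := by
    ext x
    simp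

/-- The comparison of a functor with its model in another universe. -/
def shrinkEquiv (A : El₂) : X.shrink.obj (op A) ≃+* X.obj (op A) := Shrink.ringEquiv (X.obj (op A))

lemma shrinkEquiv_restrict {A B : El₂} (α : B →ₗ[ZMod 2] A) (x : X.shrink.obj (op A)) :
    X.shrinkEquiv B (X.shrink.restrict α x) = X.restrict α (X.shrinkEquiv A x) :=
  (X.shrinkEquiv B).apply_symm_apply _

end El₂Algebra

namespace GlobalGroupLaw

variable (Y : GlobalGroupLaw.{u}) [∀ A : El₂ᵒᵖ, Small.{v} (Y.X.obj A)]

lemma shrinkEquiv_pullback {A : El₂} (V : Character A) :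
    Y.X.shrinkEquiv A (Y.X.shrink.pullback ((Y.X.shrinkEquiv C₂).symm Y.e) V) = Y.euler V := by
  refine (Y.X.shrinkEquiv_restrict (A := C₂) V _).trans ?_
  rw [RingEquiv.apply_symm_apply]
  rfl

/-- A model of a global group law in another universe. -/
def shrink : GlobalGroupLaw.{v} where
  X := Y.X.shrink
  e := (Y.X.shrinkEquiv C₂).symm Y.e
  isCoordinate := by
    refine El₂Algebra.isCoordinate_of_projKer (fun A => ?_) (fun {A V b} hb x hx => ?_)
      (fun {A V b} hb x hx => ?_)
    · rw [← (Y.X.shrinkEquiv A).map_eq_zero_iff, shrinkEquiv_pullback, euler_zero]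
    · rw [← (Y.X.shrinkEquiv A).map_eq_zero_iff] at hx ⊢
      refine Y.euler_mul_cancel hb ?_
      rw [mul_zero, ← hx, map_mul, shrinkEquiv_pullback]
    · rw [← map_dvd_iff (Y.X.shrinkEquiv A), shrinkEquiv_pullback]
      refine Y.euler_dvd hb ?_
      rw [← El₂Algebra.shrinkEquiv_restrict, hx, map_zero]

/-- The isomorphism from the model of a global group law in another universe. -/
def ofShrink : Y.shrink.Hom Y where
  app A := (Y.X.shrinkEquiv A).toRingHom
  naturality := Y.X.shrinkEquiv_restrict
  app_e := (Y.X.shrinkEquiv C₂).apply_symm_apply Y.e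

/-- The isomorphism to the model of a global group law in another universe. -/
def toShrink : Y.Hom Y.shrink where
  app A := (Y.X.shrinkEquiv A).symm.toRingHom
  naturality {A B} α x := by
    refine (Y.X.shrinkEquiv B).injective (Eq.trans ?_ (Y.X.shrinkEquiv_restrict α _).symm)
    exact ((Y.X.shrinkEquiv B).apply_symm_apply _).trans
      (congrArg _ ((Y.X.shrinkEquiv A).apply_symm_apply x).symm)
  app_e := rfl

end GlobalGroupLaw

/-! ### The global group law of functions on a formal group law -/

namespace EquivariantFGL

variable {A : Type} [AddCommGroup A] [Module (ZMod 2) A] {k : Type u} [CommRing k]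
variable (F : EquivariantFGL A k)

/-- The rings of functions on the schemes of homomorphisms from the groups of characters to a
formal group law. -/
def functionsAlgebra : El₂Algebra.{u + 1} where
  obj B := CommRingCat.of (F.functions B.unop)
  map f := CommRingCat.ofHom (F.functionsMap f.unop.hom.hom)
  map_id _ := rfl
  map_comp _ _ := rfl

variable {F}

lemma apply_push_projKer {B : Type} [AddCommGroup B] [Module (ZMod 2) B] {V : Character B} {b : B}
    (h : F.functions B) {q : F.TestPoint B} (hq : q.x V = 0) :
    h.1 (q.push (V.projKer b)) = h.1 q := by
  refine h.2 (q.push (V.projKer b)) q (RingHom.id q.T) fun W a => ?_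
  have hW := congrArg q.x (V.comp_projKer_add_ite W b)
  rw [map_add, apply_ite q.x, hq, map_zero, ite_self, add_zero] at hW
  exact congrArg (fun p => Point.hom p a) hW

/-- The global group law of functions on a 2-torsion formal group law. -/
def functionsLaw (hF : F.IsTwoTorsion) : GlobalGroupLaw.{u + 1} where
  X := F.functionsAlgebra
  e := F.coordinate (B := ZMod 2) LinearMap.id
  isCoordinate := by
    refine El₂Algebra.isCoordinate_of_projKer (fun B => ?_)
      (fun hb x hx => TestPoint.eq_zero_of_coordinate_mul_eq_zero hb hF hx)
      (fun {B V b} hb x hx =>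
        TestPoint.exists_eq_coordinate_mul hb hF (h := x) fun q hq => ?_)
    · refine Subtype.ext (funext fun p => ?_)
      change (p.x 0).hom F.y = 0
      rw [map_zero, F.zero_hom_y]
    · rw [← apply_push_projKer (b := b) x hq]
      exact congrFun (congrArg Subtype.val hx) _

end EquivariantFGL

/-! ### The initial global group law -/

namespace El₂

/-- The group `(ℤ/2)ⁿ`. -/
abbrev cube (n : ℕ) : El₂ := FGModuleCat.of (ZMod 2) (Fin n → ZMod 2)

variable (A : El₂)

/-- The dimension of an elementary abelian 2-group. -/
abbrev dim : ℕ := Module.finrank (ZMod 2) A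

/-- The coordinates with respect to a basis. -/
def toCube : A →ₗ[ZMod 2] cube A.dim := (Module.finBasis (ZMod 2) A).equivFun.toLinearMap

/-- The inverse of the coordinates with respect to a basis. -/
def ofCube : cube A.dim →ₗ[ZMod 2] A := (Module.finBasis (ZMod 2) A).equivFun.symm.toLinearMap

lemma ofCube_comp_toCube : A.ofCube ∘ₗ A.toCube = LinearMap.id :=
  LinearMap.ext (Module.finBasis (ZMod 2) A).equivFun.symm_apply_apply

end El₂

/-- Formal expressions for elements of the values of a global group law at the groups `(ℤ/2)ⁿ`,
built from Euler classes by the ring operations, restriction, and division by Euler classes. -/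
inductive LawTerm : ℕ → Type
  | zero {n : ℕ} : LawTerm n
  | one {n : ℕ} : LawTerm n
  | add {n : ℕ} (s t : LawTerm n) : LawTerm n
  | neg {n : ℕ} (t : LawTerm n) : LawTerm n
  | mul {n : ℕ} (s t : LawTerm n) : LawTerm n
  | res {m n : ℕ} (α : (Fin m → ZMod 2) →ₗ[ZMod 2] (Fin n → ZMod 2)) (t : LawTerm n) : LawTerm m
  | euler {n : ℕ} (V : Character (Fin n → ZMod 2)) : LawTerm n
  | div {n : ℕ} (V : Character (Fin n → ZMod 2)) (b : Fin n → ZMod 2) (hb : V b = 1)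
      (t : LawTerm n) : LawTerm n

/-- The value of an expression in a global group law. The expression `div V b hb t` stands for the
quotient of `t - p^* t` by the Euler class of `V`, where `p` is the projection onto `ker V`. -/
def LawTerm.eval (Y : GlobalGroupLaw.{u}) : ∀ {n : ℕ}, LawTerm n → Y.X.obj (op (El₂.cube n))
  | _, .zero => 0
  | _, .one => 1
  | _, .add s t => s.eval Y + t.eval Y
  | _, .neg t => -t.eval Y
  | _, .mul s t => s.eval Y * t.eval Y
  | _, .res (m := m) (n := n) α t => Y.X.restrict (A := El₂.cube n) (B := El₂.cube m) α (t.eval Y)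
  | n, .euler V => Y.euler (A := El₂.cube n) V
  | n, .div _ _ hb t => (Y.euler_dvd_sub (A := El₂.cube n) hb (t.eval Y)).choose

namespace GlobalGroupLaw

variable {A B : El₂}

/-- The ring of those families of elements of the values at `A` of all global group laws that are
given by an expression. -/
def definable (A : El₂) : Subring (∀ Y : GlobalGroupLaw.{v}, Y.X.obj (op A)) where
  carrier := {f | ∃ t : LawTerm A.dim, ∀ Y, f Y = Y.X.restrict A.toCube (t.eval Y)}
  mul_mem' := by
    rintro _ _ ⟨s, hs⟩ ⟨t, ht⟩
    exact ⟨.mul s t, fun Y => by rw [Pi.mul_apply, hs, ht, LawTerm.eval, map_mul]⟩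
  one_mem' := ⟨.one, fun Y => by rw [Pi.one_apply, LawTerm.eval, map_one]⟩
  add_mem' := by
    rintro _ _ ⟨s, hs⟩ ⟨t, ht⟩
    exact ⟨.add s t, fun Y => by rw [Pi.add_apply, hs, ht, LawTerm.eval, map_add]⟩
  zero_mem' := ⟨.zero, fun Y => by rw [Pi.zero_apply, LawTerm.eval, map_zero]⟩
  neg_mem' := by
    rintro _ ⟨t, ht⟩
    exact ⟨.neg t, fun Y => by rw [Pi.neg_apply, ht, LawTerm.eval, map_neg]⟩

lemma restrict_mem_definable {f : ∀ Y : GlobalGroupLaw.{v}, Y.X.obj (op A)} (hf : f ∈ definable A)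
    (α : B →ₗ[ZMod 2] A) : (fun Y => Y.X.restrict α (f Y)) ∈ definable B := by
  obtain ⟨t, ht⟩ := hf
  refine ⟨.res (A.toCube ∘ₗ α ∘ₗ B.ofCube) t, fun Y => ?_⟩
  beta_reduce
  rw [ht, LawTerm.eval, Y.X.restrict_restrict, Y.X.restrict_restrict, LinearMap.comp_assoc,
    LinearMap.comp_assoc, El₂.ofCube_comp_toCube, LinearMap.comp_id]

lemma eval_mem_definable {n : ℕ} (t : LawTerm n) :
    (fun Y : GlobalGroupLaw.{v} => t.eval Y) ∈ definable (El₂.cube n) := by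
  refine ⟨.res (El₂.cube n).ofCube t, fun Y => ?_⟩
  rw [LawTerm.eval, Y.X.restrict_restrict, El₂.ofCube_comp_toCube, Y.X.restrict_id]

lemma euler_mem_definable (V : Character A) :
    (fun Y : GlobalGroupLaw.{v} => Y.euler V) ∈ definable A := by
  refine ⟨.euler (V ∘ₗ A.ofCube), fun Y => ?_⟩
  rw [LawTerm.eval, Y.restrict_euler, LinearMap.comp_assoc, El₂.ofCube_comp_toCube,
    LinearMap.comp_id]

lemma exists_mem_definable_sub_eq_euler_mul {f : ∀ Y : GlobalGroupLaw.{v}, Y.X.obj (op A)}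
    (hf : f ∈ definable A) {V : Character A} {b : A} (hb : V b = 1) :
    ∃ g ∈ definable A, ∀ Y, f Y - Y.X.restrict (V.projKer b) (f Y) = Y.euler V * g Y := by
  obtain ⟨t, ht⟩ := hf
  have ofCube_toCube (a : A) : A.ofCube (A.toCube a) = a :=
    LinearMap.congr_fun A.ofCube_comp_toCube a
  have hb' : (V ∘ₗ A.ofCube) (A.toCube b) = 1 := by rw [LinearMap.comp_apply, ofCube_toCube, hb]
  have projKer_comp_toCube : Character.projKer (V ∘ₗ A.ofCube) (A.toCube b) ∘ₗ A.toCube =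
      A.toCube ∘ₗ V.projKer b := by
    ext a : 1
    simp [Character.projKer_apply, ofCube_toCube]
  refine ⟨_, ⟨.div (V ∘ₗ A.ofCube) (A.toCube b) hb' t, fun Y => rfl⟩, fun Y => ?_⟩
  have hdiv := congrArg (Y.X.restrict A.toCube)
    (Y.euler_dvd_sub (A := El₂.cube A.dim) hb' (t.eval Y)).choose_spec
  rwa [map_mul, Y.restrict_euler, LinearMap.comp_assoc, El₂.ofCube_comp_toCube, LinearMap.comp_id,
    map_sub, Y.X.restrict_restrict, projKer_comp_toCube, ← Y.X.restrict_restrict, ← ht] at hdiv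

lemma small_definable (A : El₂) : Small.{u} (definable.{v} A) := by
  let f (t : LawTerm A.dim) : definable.{v} A :=
    ⟨fun Y => Y.X.restrict A.toCube (t.eval Y), t, fun _ => rfl⟩
  exact small_of_surjective (f := f)
    fun ⟨_, t, ht⟩ => ⟨t, Subtype.ext (funext fun Y => (ht Y).symm)⟩

/-- The restriction of definable families. -/
def definableMap (α : B →ₗ[ZMod 2] A) : definable.{v} A →+* definable.{v} B where
  toFun f := ⟨fun Y => Y.X.restrict α (f.1 Y), restrict_mem_definable f.2 α⟩
  map_one' := Subtype.ext (funext fun Y => map_one (Y.X.restrict α))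
  map_mul' f g := Subtype.ext (funext fun Y => map_mul (Y.X.restrict α) (f.1 Y) (g.1 Y))
  map_zero' := Subtype.ext (funext fun Y => map_zero (Y.X.restrict α))
  map_add' f g := Subtype.ext (funext fun Y => map_add (Y.X.restrict α) (f.1 Y) (g.1 Y))

/-- The functor of definable families. -/
def definableAlgebra : El₂Algebra.{v + 1} where
  obj A := CommRingCat.of (definable.{v} A.unop)
  map f := CommRingCat.ofHom (definableMap f.unop.hom.hom)
  map_id _ := CommRingCat.hom_ext <| RingHom.ext fun _ =>
    Subtype.ext (funext fun Y => Y.X.restrict_id _)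
  map_comp _ _ := CommRingCat.hom_ext <| RingHom.ext fun _ =>
    Subtype.ext (funext fun Y => (Y.X.restrict_restrict _ _ _).symm)

/-- The global group law of definable families. Its values lie in a large universe, but are
small. -/
def definableLaw : GlobalGroupLaw.{v + 1} where
  X := definableAlgebra
  e := (⟨fun Y => Y.euler (A := C₂) LinearMap.id, euler_mem_definable _⟩ : definable.{v} C₂)
  isCoordinate := by
    have pullback_val (A : El₂) (V : Character A) (Y : GlobalGroupLaw.{v}) :
        Y.X.restrict (A := C₂) V (Y.euler (A := C₂) LinearMap.id) = Y.euler V :=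
      Y.restrict_euler (A := C₂) LinearMap.id V
    refine El₂Algebra.isCoordinate_of_projKer (fun A => ?_) (fun {A V b} hb x hx => ?_)
      (fun {A V b} hb x hx => ?_)
    · exact Subtype.ext (funext fun Y => (pullback_val A 0 Y).trans Y.euler_zero)
    · refine Subtype.ext (funext fun Y => Y.euler_mul_cancel hb ?_)
      rw [← pullback_val]
      exact (congrFun (congrArg Subtype.val hx) Y).trans (mul_zero _).symm
    · obtain ⟨g, hg, hmul⟩ := exists_mem_definable_sub_eq_euler_mul x.2 hb
      refine ⟨⟨g, hg⟩, Subtype.ext (funext fun Y => ?_)⟩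
      have hxY : Y.X.restrict (V.projKer b) (x.1 Y) = 0 := congrFun (congrArg Subtype.val hx) Y
      have hmulY := hmul Y
      rw [hxY, sub_zero, ← pullback_val] at hmulY
      exact hmulY

instance (A : El₂ᵒᵖ) : Small.{u} (definableLaw.{v}.X.obj A) := small_definable A.unop

/-- The morphism from the law of definable families to a global group law given by evaluation. -/
def ofDefinable (Y : GlobalGroupLaw.{v}) : definableLaw.{v}.Hom Y where
  app A := (Pi.evalRingHom (fun Y : GlobalGroupLaw.{v} => (Y.X.obj (op A) : Type v)) Y).comp
    (definable A).subtype
  naturality _ _ := rfl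
  app_e := Y.euler_id

end GlobalGroupLaw

open GlobalGroupLaw

/-- The definable family given by an expression. -/
def LawTerm.family {n : ℕ} (t : LawTerm n) : definableLaw.{v}.X.obj (op (El₂.cube n)) :=
  (⟨fun Y => t.eval Y, eval_mem_definable t⟩ : definable.{v} (El₂.cube n))

namespace GlobalGroupLaw

lemma euler_definableLaw {n : ℕ} (V : Character (Fin n → ZMod 2)) :
    (LawTerm.euler V).family = definableLaw.{v}.euler (A := El₂.cube n) V :=
  Subtype.ext (funext fun Y => (Y.restrict_euler (A := C₂) (B := El₂.cube n) LinearMap.id V).symm)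

lemma euler_mul_family_div {n : ℕ} {V : Character (Fin n → ZMod 2)} {b : Fin n → ZMod 2}
    (hb : V b = 1) (t : LawTerm n) :
    definableLaw.{v}.euler (A := El₂.cube n) V * (LawTerm.div V b hb t).family =
      t.family - definableLaw.X.restrict (A := El₂.cube n) (B := El₂.cube n) (V.projKer b)
        t.family := by
  rw [← euler_definableLaw]
  exact Subtype.ext (funext fun Y =>
    (Y.euler_dvd_sub (A := El₂.cube n) hb (t.eval Y)).choose_spec.symm)

lemma Hom.app_family {Y : GlobalGroupLaw.{w}} (φ ψ : definableLaw.{v}.Hom Y) {n : ℕ}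
    (t : LawTerm n) : φ.app _ t.family = ψ.app _ t.family := by
  induction t with
  | zero => exact (map_zero _).trans (map_zero _).symm
  | one => exact (map_one _).trans (map_one _).symm
  | add s t hs ht =>
    exact (map_add _ s.family t.family).trans
      ((congrArg₂ _ hs ht).trans (map_add _ s.family t.family).symm)
  | neg t ht =>
    exact (map_neg _ t.family).trans ((congrArg _ ht).trans (map_neg _ t.family).symm)
  | mul s t hs ht =>
    exact (map_mul _ s.family t.family).trans
      ((congrArg₂ _ hs ht).trans (map_mul _ s.family t.family).symm)
  | @res m n α t ht =>
    exact (φ.naturality (A := El₂.cube n) (B := El₂.cube m) α t.family).trans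
      ((congrArg _ ht).trans (ψ.naturality (A := El₂.cube n) (B := El₂.cube m) α t.family).symm)
  | euler V => rw [euler_definableLaw, φ.app_euler, ψ.app_euler]
  | @div n V b hb t ht =>
    refine Y.euler_mul_cancel (A := El₂.cube n) hb ?_
    rw [← φ.app_euler, ← map_mul, φ.app_euler, ← ψ.app_euler, ← map_mul, euler_mul_family_div,
      map_sub, map_sub, φ.naturality, ψ.naturality, ht]

lemma Hom.definable_ext {Y : GlobalGroupLaw.{w}} (φ ψ : definableLaw.{v}.Hom Y) (A : El₂) :
    φ.app A = ψ.app A := by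
  ext x
  obtain ⟨t, ht⟩ := x.2
  have hx : x = definableLaw.X.restrict (A := El₂.cube A.dim) A.toCube t.family :=
    Subtype.ext (funext ht)
  rw [hx, φ.naturality, ψ.naturality, φ.app_family ψ]

end GlobalGroupLaw

/-- The initial global group law in the universe `u`, built from the laws in the next universe, as
the laws of functions on formal group laws live there. -/
def lazardLaw : GlobalGroupLaw.{u} := GlobalGroupLaw.definableLaw.{u + 1}.shrink

/-- The values of the initial global group law. -/
abbrev Laz (A : El₂) : Type u := lazardLaw.{u}.X.obj (op A)

namespace GlobalGroupLaw

/-- The morphism from the initial law to a global group law in the next universe. -/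
def ofLazard (Y : GlobalGroupLaw.{u + 1}) : lazardLaw.{u}.Hom Y :=
  (ofDefinable Y).comp definableLaw.ofShrink

lemma Hom.lazard_ext {Y : GlobalGroupLaw.{w}} (φ ψ : lazardLaw.{u}.Hom Y) (A : El₂) :
    φ.app A = ψ.app A := by
  ext x
  obtain ⟨z, rfl⟩ := (definableLaw.X.shrinkEquiv A).symm.surjective x
  exact RingHom.congr_fun
    (Hom.definable_ext (φ.comp definableLaw.toShrink) (ψ.comp definableLaw.toShrink) A) z

lemma lazardLaw_isInitial : lazardLaw.{u}.IsInitial := fun Y =>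
  haveI (A : El₂ᵒᵖ) : Small.{u + 1} (Y.X.obj A) := small_succ _
  let φ : lazardLaw.{u}.Hom Y := (ofShrink.{u, u + 1} Y).comp (ofLazard (shrink.{u, u + 1} Y))
  ⟨φ.toNatTrans, φ.app_e, fun ψ hψ => NatTrans.ext <| funext fun A =>
    CommRingCat.hom_ext <| Hom.lazard_ext (.ofNatTrans ψ hψ) φ A.unop⟩

end GlobalGroupLaw

/-! ### Morphisms of formal group laws -/

namespace EquivariantFGL

section Hom

variable {A B C : Type} [AddCommGroup A] [Module (ZMod 2) A] [AddCommGroup B] [Module (ZMod 2) B]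
  [AddCommGroup C] [Module (ZMod 2) C]
variable {k k' k'' T : Type u} [CommRing k] [CommRing k'] [CommRing k''] [CommRing T]
variable {η : k' →+* T} {α : B →ₗ[ZMod 2] A} {f : k →+* k'}
variable {F : EquivariantFGL B k} {G : EquivariantFGL A k'}

/-- The image of a point under a morphism. -/
def PreHom.pull (g : PreHom α f F G) (p : G.Point η) : F.Point (η.comp f) :=
  p.comap g.φ g.map_algebraMap fun s => ⟨_, g.I_le_comap s⟩

lemma PreHom.eval₂_hat (g : PreHom α f F G) (p q : G.Point η) (x : F.Tensor₂) :
    p.eval₂ q (g.hat x) = (g.pull p).eval₂ (g.pull q) x := by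
  unfold PreHom.hat
  exact Point.comp_completedLift _ _ _ (Point.isDiscreteCont_eval₂ p q) (g.pull p) (g.pull q)
    (fun _ => Point.eval₂_inc₁₂ p q _) (fun _ => Point.eval₂_inc₂₂ p q _) x

namespace HomOver

/-- The homomorphism of groups of points induced by a morphism. -/
def pullHom (g : HomOver α f F G) (η : k' →+* T) : G.Point η →+ F.Point (η.comp f) where
  toFun p := g.toPreHom.pull p
  map_zero' := Point.ext <| RingHom.ext fun x => by
    change η (G.θ 0 (g.φ x)) = η (f (F.θ 0 x))
    rw [g.map_θ, LinearMap.zero_comp]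
  map_add' p q := Point.ext <| RingHom.ext fun x =>
    (congrArg (p.eval₂ q) (g.map_Δ x)).trans (g.eval₂_hat p q (F.Δ x))

variable (F) in
/-- The identity morphism. -/
def id : HomOver (LinearMap.id : B →ₗ[ZMod 2] B) (RingHom.id k) F F where
  φ := RingHom.id _
  map_algebraMap _ := rfl
  map_θ _ _ := rfl
  map_y := rfl
  map_Δ x := F.tensor₂_ext_eval₂ fun T _ η p q => by
    rw [PreHom.eval₂_hat]
    exact RingHom.congr_fun (Point.eq_eval₂ (η := η.comp (RingHom.id k))
      (Point.isDiscreteCont_eval₂ p q) _ _ (Point.eval₂_inc₁₂ p q) (Point.eval₂_inc₂₂ p q)) _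

/-- The composite of morphisms. -/
def comp {H : EquivariantFGL C k''} {β : A →ₗ[ZMod 2] C} {γ : B →ₗ[ZMod 2] C}
    {f' : k' →+* k''} (g' : HomOver β f' G H) (g : HomOver α f F G) (hγ : β ∘ₗ α = γ) :
    HomOver γ (f'.comp f) F H where
  φ := g'.φ.comp g.φ
  map_algebraMap c := by
    rw [RingHom.comp_apply, g.map_algebraMap, g'.map_algebraMap, RingHom.comp_apply]
  map_θ V x := by
    rw [RingHom.comp_apply, g'.map_θ, g.map_θ, ← hγ, LinearMap.comp_assoc, RingHom.comp_apply]
  map_y := by rw [RingHom.comp_apply, g.map_y, g'.map_y]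
  map_Δ x := H.tensor₂_ext_eval₂ fun T _ η p q => by
    rw [PreHom.eval₂_hat, RingHom.comp_apply, g'.map_Δ, g.map_Δ, PreHom.eval₂_hat,
      PreHom.eval₂_hat]
    rfl

/-- The image of a test point under a morphism. -/
def pullTestPoint (g : HomOver α f F G) (p : G.TestPoint C) : F.TestPoint C where
  T := p.T
  η := p.η.comp f
  x := (g.pullHom p.η).comp p.x

/-- The action of a morphism on functions. -/
def mapFunctions (g : HomOver α f F G) (C : Type) [AddCommGroup C] [Module (ZMod 2) C] :
    F.functions C →+* G.functions C where
  toFun h := ⟨fun p => h.1 (g.pullTestPoint p), fun p q φ hφ =>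
    h.2 (g.pullTestPoint p) (g.pullTestPoint q) φ fun W a => hφ W (g.φ a)⟩
  map_one' := rfl
  map_mul' _ _ := rfl
  map_zero' := rfl
  map_add' _ _ := rfl

/-- The action of a morphism on the global group laws of functions. -/
def functionsLawHom (g : HomOver α f F G) (hF : F.IsTwoTorsion) (hG : G.IsTwoTorsion) :
    (functionsLaw hF).Hom (functionsLaw hG) where
  app C := g.mapFunctions C
  naturality _ _ := rfl
  app_e := Subtype.ext <| funext fun p => congrArg (p.x LinearMap.id).hom g.map_y

end HomOver

end Hom

/-! ### The classifying homomorphism of a formal group law -/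

section lazEval

variable {A A' : Type} [AddCommGroup A] [Module (ZMod 2) A] [AddCommGroup A'] [Module (ZMod 2) A']
variable {k k' T T' : Type u} [CommRing k] [CommRing k'] [CommRing T] [CommRing T']
variable {F : EquivariantFGL A k} {G : EquivariantFGL A' k'} {η : k →+* T} {η' : k →+* T'}
variable {B C : El₂} (hF : F.IsTwoTorsion) (hG : G.IsTwoTorsion)

/-- The functions defined by elements of the initial global group law, evaluated at a homomorphism
to the points of a formal group law. -/
def lazEval (x : Character B →+ F.Point η) : Laz.{u} B →+* T :=
  ((Pi.evalRingHom (fun p : F.TestPoint B => p.T) ⟨T, η, x⟩).comp (F.functions B).subtype).comp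
    ((functionsLaw hF).ofLazard.app B)

lemma map_lazEval {φ : T →+* T'} {x : Character B →+ F.Point η} {x' : Character B →+ F.Point η'}
    (h : ∀ W, Point.MapsTo φ (x W) (x' W)) (z : Laz.{u} B) :
    φ (lazEval hF x z) = lazEval hF x' z :=
  Subtype.prop (p := (· ∈ F.functions B)) ((functionsLaw hF).ofLazard.app B z)
    ⟨T, η, x⟩ ⟨T', η', x'⟩ φ h

lemma lazEval_restrict (x : Character B →+ F.Point η) (β : B →ₗ[ZMod 2] C) (z : Laz.{u} C) :
    lazEval hF x (lazardLaw.X.restrict β z) = lazEval hF (x.comp (Character.comap β)) z :=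
  congrFun (congrArg (Subtype.val (p := (· ∈ F.functions B)))
    ((functionsLaw hF).ofLazard.naturality β z)) ⟨T, η, x⟩

lemma lazEval_euler (x : Character B →+ F.Point η) (V : Character B) :
    lazEval hF x (lazardLaw.euler V) = (x V).hom F.y :=
  congrFun (congrArg (Subtype.val (p := (· ∈ F.functions B)))
    ((functionsLaw hF).ofLazard.app_euler V)) ⟨T, η, x⟩

lemma lazEval_pullHom {α : A →ₗ[ZMod 2] A'} {f : k →+* k'} (g : HomOver α f F G) {η : k' →+* T}
    (x : Character B →+ G.Point η) (z : Laz.{u} B) :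
    lazEval hF ((g.pullHom η).comp x) z = lazEval hG x z :=
  congrFun (congrArg (Subtype.val (p := (· ∈ G.functions B)))
    (RingHom.congr_fun (GlobalGroupLaw.Hom.lazard_ext
      ((g.functionsLawHom hF hG).comp (functionsLaw hF).ofLazard)
      (functionsLaw hG).ofLazard B) z)) ⟨T, η, x⟩

end lazEval

section classify

variable {A B : El₂} {k k' : Type u} [CommRing k] [CommRing k']
variable {F : EquivariantFGL A k} {G : EquivariantFGL B k'}
variable (hF : F.IsTwoTorsion) (hG : G.IsTwoTorsion)

/-- The homomorphism from the value at `A` of the initial global group law to the ground ring of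
a 2-torsion `A`-equivariant formal group law. -/
def classify : Laz.{u} A →+* k := lazEval hF (F.θPoint (RingHom.id k))

lemma classify_euler (V : Character A) : classify hF (lazardLaw.euler V) = F.euler V :=
  lazEval_euler hF _ V

lemma classify_eq_of_homOver {α : A →ₗ[ZMod 2] B} {f : k →+* k'} (g : HomOver α f F G)
    (z : Laz.{u} B) : classify hG z = f (classify hF (lazardLaw.X.restrict α z)) := by
  rw [classify, classify, lazEval_restrict, ← lazEval_pullHom hF hG g]
  exact (map_lazEval hF (fun W a => (g.map_θ W a).symm) z).symm

end classify

end EquivariantFGL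

/-! ### Completion of augmented algebras -/

namespace IdealCompletion

variable {R T : Type u} [CommRing R] [CommRing T] {ι : Type}

lemma IsDiscreteCont.exists_factor {I : ι → Ideal R} {Φ : Completion I →+* T}
    (h : IsDiscreteCont Φ) : ∃ (i : ι) (ψ : R ⧸ I i →+* T), ∀ x, Φ x = ψ (proj I i x) := by
  obtain ⟨i, hi⟩ := h
  refine ⟨i, Ideal.Quotient.lift (I i) (Φ.comp (of I)) fun a ha => hi ?_, fun x => ?_⟩
  · rw [RingHom.mem_ker, proj_of]
    exact Ideal.Quotient.eq_zero_iff_mem.2 ha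
  · obtain ⟨r, hr⟩ := exists_sub_of_mem_ker_proj I i x
    have Φ_eq := hi hr
    rw [RingHom.mem_ker, map_sub, sub_eq_zero] at Φ_eq hr
    rw [Φ_eq, hr]
    rfl

lemma bijective_of_ker_proj (I : ι → Ideal R) :
    Function.Bijective (of fun i => RingHom.ker (proj I i)) := by
  refine ⟨(injective_iff_map_eq_zero _).2 fun x hx => ?_, fun y => ?_⟩
  · refine Completion.ext_proj fun i => ?_
    rw [map_zero, ← RingHom.mem_ker, ← Ideal.Quotient.eq_zero_iff_mem]
    exact (congrArg (proj (fun i => RingHom.ker (proj I i)) i) hx).trans (map_zero _)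
  · choose z hz using fun i => Ideal.Quotient.mk_surjective (proj _ i y)
    have proj_z {i j : ι} (h : I i ≤ I j) : proj I j (z i) = proj I j (z j) := by
      have mk_eq := factor_proj (fun i => RingHom.ker (proj I i)) (ker_proj_mono h) y
      rw [← hz, ← hz, Ideal.Quotient.factor_mk, Ideal.Quotient.eq, RingHom.mem_ker, map_sub,
        sub_eq_zero] at mk_eq
      exact mk_eq
    refine ⟨⟨fun i => proj I i (z i), fun i j h => (factor_proj I h (z i)).trans (proj_z h)⟩,
      Completion.ext_proj fun i => ?_⟩
    rw [proj_of, ← hz, Ideal.Quotient.eq, RingHom.mem_ker, map_sub, sub_eq_zero]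
    rfl

end IdealCompletion

namespace AugmentedAlgebra

variable {A B : Type} [AddCommGroup A] [Module (ZMod 2) A] [AddCommGroup B] [Module (ZMod 2) B]
variable {k k' T : Type u} [CommRing k] [CommRing k'] [CommRing T]

lemma I_le_comap {F : AugmentedAlgebra B k} {G : AugmentedAlgebra A k'} {δ : B →ₗ[ZMod 2] A}
    {f : k →+* k'} {φ : F.R →+* G.R} (hφ : ∀ V x, G.θ V (φ x) = f (F.θ (V ∘ₗ δ) x))
    (s : Multiset (Character A)) : F.I (s.map fun V => V ∘ₗ δ) ≤ (G.I s).comap φ := by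
  induction s using Multiset.induction_on with
  | empty => simp [I]
  | cons V s ih =>
    rw [Multiset.map_cons, I_cons, I_cons, Ideal.mul_le]
    intro a ha b hb
    rw [Ideal.mem_comap, map_mul]
    refine Ideal.mul_mem_mul ?_ (ih hb)
    rw [RingHom.mem_ker] at ha ⊢
    rw [hφ, ha, map_zero]

variable (F : AugmentedAlgebra A k)

lemma I_add_le_left (s t : Multiset (Character A)) : F.I (s + t) ≤ F.I s :=
  (F.I_add s t).trans_le Ideal.mul_le_left

lemma I_add_le_right (s t : Multiset (Character A)) : F.I (s + t) ≤ F.I t :=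
  (F.I_add s t).trans_le Ideal.mul_le_right

/-- The augmentations of the completion. -/
def completionθ (V : Character A) : Completion F.I →+* k :=
  (Ideal.Quotient.lift (F.I {V}) (F.θ V : F.R →+* k)
    (fun _ ha => (F.I_singleton V).le ha)).comp (proj F.I {V})

/-- The algebra structure of the completion. -/
@[reducible]
def completionAlgebra : Algebra k (Completion F.I) :=
  ((of F.I).comp (algebraMap k F.R)).toAlgebra

/-- The completion of an augmented algebra. -/
def completion : AugmentedAlgebra A k where
  R := Completion F.I
  algebra := F.completionAlgebra
  θ V :=
    letI := F.completionAlgebra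
    { F.completionθ V with commutes' := fun c => (F.θ V).commutes c }

/-- The completion map. -/
def toCompletion : F.R →+* F.completion.R := of F.I

/-- The projections of the completion. -/
def completionProj (s : Multiset (Character A)) : F.completion.R →+* F.R ⧸ F.I s := proj F.I s

lemma completion_algebraMap (c : k) :
    algebraMap k F.completion.R c = F.toCompletion (algebraMap k F.R c) := rfl

lemma completionProj_toCompletion (s : Multiset (Character A)) (x : F.R) :
    F.completionProj s (F.toCompletion x) = Ideal.Quotient.mk _ x := rfl

lemma ker_completion_θ (V : Character A) :
    RingHom.ker (F.completion.θ V) = RingHom.ker (F.completionProj {V}) := by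
  ext x
  obtain ⟨r, hr⟩ := Ideal.Quotient.mk_surjective (F.completionProj {V} x)
  have θ_eq : F.completion.θ V x = F.θ V r :=
    (congrArg (Ideal.Quotient.lift (F.I {V}) (F.θ V : F.R →+* k)
      fun _ ha => (F.I_singleton V).le ha) hr).symm
  rw [RingHom.mem_ker, RingHom.mem_ker, θ_eq, ← hr, Ideal.Quotient.eq_zero_iff_mem, F.I_singleton,
    RingHom.mem_ker]

end AugmentedAlgebra

/-- An augmented algebra whose augmentation ideals are generated by regular elements. -/
structure PrincipalAugmentedAlgebra (A : Type) [AddCommGroup A] [Module (ZMod 2) A] (k : Type u)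
    [CommRing k] extends AugmentedAlgebra A k where
  E : Character A → R
  E_regular : ∀ V, E V ∈ nonZeroDivisors R
  span_E : ∀ V, Ideal.span {E V} = RingHom.ker (θ V)

namespace PrincipalAugmentedAlgebra

variable {A : Type} [AddCommGroup A] [Module (ZMod 2) A] {k : Type u} [CommRing k]
variable (P : PrincipalAugmentedAlgebra A k)

/-- The generator of the ideal `I s`. -/
def generator (s : Multiset (Character A)) : P.R := (s.map P.E).prod

lemma generator_singleton (V : Character A) : P.generator {V} = P.E V := by
  rw [generator, Multiset.map_singleton, Multiset.prod_singleton]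

lemma generator_cons (V : Character A) (s : Multiset (Character A)) :
    P.generator (V ::ₘ s) = P.E V * P.generator s := by
  rw [generator, Multiset.map_cons, Multiset.prod_cons, generator]

lemma generator_add (s t : Multiset (Character A)) :
    P.generator (s + t) = P.generator s * P.generator t := by
  rw [generator, Multiset.map_add, Multiset.prod_add, generator, generator]

lemma span_generator (s : Multiset (Character A)) : Ideal.span {P.generator s} = P.I s := by
  induction s using Multiset.induction_on with
  | empty => simp [generator, AugmentedAlgebra.I]
  | cons V s ih =>
    rw [generator_cons, ← Ideal.span_singleton_mul_span_singleton, ih, P.span_E, P.I_cons]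

lemma generator_mem (s : Multiset (Character A)) : P.generator s ∈ P.I s :=
  P.span_generator s ▸ Ideal.mem_span_singleton_self _

lemma mem_I {s : Multiset (Character A)} {x : P.R} : x ∈ P.I s ↔ P.generator s ∣ x := by
  rw [← span_generator, Ideal.mem_span_singleton]

lemma generator_regular (s : Multiset (Character A)) : P.generator s ∈ nonZeroDivisors P.R :=
  Submonoid.multiset_prod_mem _ _ (by simpa using fun V _ => P.E_regular V)

lemma mem_I_of_generator_mul_mem {s t : Multiset (Character A)} {a : P.R}
    (h : P.generator s * a ∈ P.I (s + t)) : a ∈ P.I t := by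
  obtain ⟨z, hz⟩ := P.mem_I.1 h
  rw [generator_add, mul_assoc] at hz
  exact P.mem_I.2 ⟨z, (mul_cancel_left_mem_nonZeroDivisors (P.generator_regular s)).1 hz⟩

lemma of_generator_regular (s : Multiset (Character A)) :
    of P.I (P.generator s) ∈ nonZeroDivisors (Completion P.I) := by
  rw [mem_nonZeroDivisors_iff_right]
  intro x hx
  refine Completion.ext_proj fun t => ?_
  obtain ⟨r, hr⟩ := Ideal.Quotient.mk_surjective (proj P.I (s + t) x)
  have mul_mem := congrArg (proj P.I (s + t)) hx
  rw [mul_comm, map_mul, proj_of, map_zero, ← hr, ← map_mul,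
    Ideal.Quotient.eq_zero_iff_mem] at mul_mem
  rw [← factor_proj P.I (P.I_add_le_right s t), ← hr, Ideal.Quotient.factor_mk, map_zero,
    Ideal.Quotient.eq_zero_iff_mem]
  exact P.mem_I_of_generator_mul_mem mul_mem

lemma exists_proj_add_eq_generator_mul {s : Multiset (Character A)} {x : Completion P.I}
    (hx : proj P.I s x = 0) (t : Multiset (Character A)) :
    ∃ z, proj P.I (s + t) x = Ideal.Quotient.mk _ (P.generator s * z) := by
  obtain ⟨r, hr⟩ := Ideal.Quotient.mk_surjective (proj P.I (s + t) x)
  rw [← factor_proj P.I (P.I_add_le_left s t), ← hr, Ideal.Quotient.factor_mk,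
    Ideal.Quotient.eq_zero_iff_mem] at hx
  obtain ⟨z, rfl⟩ := P.mem_I.1 hx
  exact ⟨z, hr.symm⟩

lemma of_generator_dvd {s : Multiset (Character A)} {x : Completion P.I}
    (hx : proj P.I s x = 0) : of P.I (P.generator s) ∣ x := by
  choose z hz using P.exists_proj_add_eq_generator_mul hx
  have z_compatible {t t' : Multiset (Character A)} (h : P.I t ≤ P.I t') : z t - z t' ∈ P.I t' := by
    refine P.mem_I_of_generator_mul_mem (s := s) ?_
    have I_le : P.I (s + t) ≤ P.I (s + t') := by
      rw [P.I_add, P.I_add]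
      exact Ideal.mul_mono_right h
    have mk_eq := factor_proj P.I I_le x
    rwa [hz, hz, Ideal.Quotient.factor_mk, Ideal.Quotient.eq, ← mul_sub] at mk_eq
  refine ⟨⟨fun t => Ideal.Quotient.mk _ (z t), fun t t' h => ?_⟩, Completion.ext_proj fun t => ?_⟩
  · rw [Ideal.Quotient.factor_mk, Ideal.Quotient.eq]
    exact z_compatible h
  · rw [← factor_proj P.I (P.I_add_le_right s t), hz, Ideal.Quotient.factor_mk, map_mul, map_mul,
      proj_of]
    rfl

lemma ker_completionProj (s : Multiset (Character A)) :
    RingHom.ker (P.completionProj s) = Ideal.span {P.toCompletion (P.generator s)} := by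
  refine le_antisymm (fun x hx => Ideal.mem_span_singleton.2 (P.of_generator_dvd hx)) ?_
  rw [Ideal.span_singleton_le_iff_mem, RingHom.mem_ker, P.completionProj_toCompletion,
    Ideal.Quotient.eq_zero_iff_mem]
  exact P.generator_mem s

lemma span_toCompletion_E (V : Character A) :
    Ideal.span {P.toCompletion (P.E V)} = RingHom.ker (P.completion.θ V) := by
  rw [P.ker_completion_θ, ker_completionProj, generator_singleton]

lemma completion_I (s : Multiset (Character A)) :
    P.completion.I s = RingHom.ker (P.completionProj s) := by
  rw [ker_completionProj]
  induction s using Multiset.induction_on with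
  | empty => simp [generator, AugmentedAlgebra.I]
  | cons V s ih =>
    rw [generator_cons, map_mul, ← Ideal.span_singleton_mul_span_singleton, ← ih,
      span_toCompletion_E, AugmentedAlgebra.I_cons]

lemma completion_complete : Function.Bijective (of P.completion.I) := by
  rw [show P.completion.I = fun s => RingHom.ker (P.completionProj s) from funext P.completion_I]
  exact bijective_of_ker_proj P.I

section Points

variable {P} {T : Type u} [CommRing T] {η : k →+* T}

/-- The restriction of a point of the completion along the completion map. -/
def restrictPoint (p : P.completion.Point η) : P.Point η where
  hom := p.hom.comp P.toCompletion
  hom_algebraMap c := p.hom_algebraMap c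
  cont := by
    obtain ⟨s, hs⟩ := p.cont
    refine ⟨s, fun a ha => hs ?_⟩
    rw [completion_I, RingHom.mem_ker, P.completionProj_toCompletion]
    exact Ideal.Quotient.eq_zero_iff_mem.2 ha

lemma hom_ext_toCompletion {Φ Ψ : P.completion.R →+* T}
    (hΦ : ∃ s, P.completion.I s ≤ RingHom.ker Φ) (hΨ : ∃ s, P.completion.I s ≤ RingHom.ker Ψ)
    (h : ∀ x, Φ (P.toCompletion x) = Ψ (P.toCompletion x)) : Φ = Ψ := by
  simp only [completion_I] at hΦ hΨ
  exact IsDiscreteCont.ext P.directed_I hΦ hΨ h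

lemma restrictPoint_injective : Function.Injective (restrictPoint (P := P) (η := η)) :=
  fun p q h => Point.ext <| hom_ext_toCompletion p.cont q.cont fun x =>
    RingHom.congr_fun (congrArg Point.hom h) x

lemma restrictPoint_ofθ (V : Character A) :
    restrictPoint (Point.ofθ P.completion η V) = Point.ofθ _ η V := rfl

end Points

end PrincipalAugmentedAlgebra

/-! ### Formal group laws from uncompleted ones -/

/-- The data from which a 2-torsion equivariant formal group law is obtained by completion: the
algebra is not assumed to be complete, and the comultiplication is replaced by a group structure on
its points. -/
structure UncompletedFGL (A : Type) [AddCommGroup A] [Module (ZMod 2) A] (k : Type u) [CommRing k]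
    extends PrincipalAugmentedAlgebra A k where
  add : ∀ {T : Type u} [CommRing T] {η : k →+* T}, toAugmentedAlgebra.Point η →
    toAugmentedAlgebra.Point η → toAugmentedAlgebra.Point η
  mapsTo_add : ∀ {T T' : Type u} [CommRing T] [CommRing T'] {η : k →+* T} {η' : k →+* T'}
    {φ : T →+* T'} {p q : toAugmentedAlgebra.Point η} {p' q' : toAugmentedAlgebra.Point η'},
    Point.MapsTo φ p p' → Point.MapsTo φ q q' → Point.MapsTo φ (add p q) (add p' q')
  add_comm : ∀ {T : Type u} [CommRing T] {η : k →+* T} (p q : toAugmentedAlgebra.Point η),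
    add p q = add q p
  add_assoc : ∀ {T : Type u} [CommRing T] {η : k →+* T} (p q r : toAugmentedAlgebra.Point η),
    add (add p q) r = add p (add q r)
  zero_add : ∀ {T : Type u} [CommRing T] {η : k →+* T} (p : toAugmentedAlgebra.Point η),
    add (Point.ofθ _ η 0) p = p
  add_self : ∀ {T : Type u} [CommRing T] {η : k →+* T} (p : toAugmentedAlgebra.Point η),
    add p p = Point.ofθ _ η 0
  add_ofθ : ∀ {T : Type u} [CommRing T] (η : k →+* T) (V W : Character A),
    add (Point.ofθ toAugmentedAlgebra η V) (Point.ofθ toAugmentedAlgebra η W) =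
      Point.ofθ _ η (V + W)

namespace UncompletedFGL

open PrincipalAugmentedAlgebra

variable {A : Type} [AddCommGroup A] [Module (ZMod 2) A] {k : Type u} [CommRing k]
variable (P : UncompletedFGL A k)

/-- The sum of the universal pair of points of the completion. -/
def pairSum (i : Multiset (Character A) × Multiset (Character A)) :
    P.Point (Point.pairη P.completion i) :=
  P.add (restrictPoint (Point.pairFst P.completion i))
    (restrictPoint (Point.pairSnd P.completion i))

/-- The comultiplication before completion of its source. -/
def Δ₀ : P.R →+* P.completion.Tensor₂ :=
  RingHom.codRestrict (RingHom.pi fun i => (P.pairSum i).hom) (Completion _) fun x _ _ h =>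
    P.mapsTo_add (φ := Ideal.Quotient.factor h)
      (fun a => factor_proj _ h (P.completion.inc₁₂ (P.toCompletion a)))
      (fun a => factor_proj _ h (P.completion.inc₂₂ (P.toCompletion a))) x

lemma proj_Δ₀ (i : Multiset (Character A) × Multiset (Character A)) (x : P.R) :
    proj _ i (P.Δ₀ x) = (P.pairSum i).hom x := rfl

lemma isCont_Δ₀ : IsCont P.I P.Δ₀ := fun i => (P.pairSum i).cont

/-- The comultiplication of the completion. -/
def completionΔ : P.completion.R →+* P.completion.Tensor₂ := extend P.directed_I P.isCont_Δ₀

lemma completionΔ_toCompletion (x : P.R) : P.completionΔ (P.toCompletion x) = P.Δ₀ x :=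
  extend_of _ _ x

/-- The completion as an augmented bialgebra. -/
@[reducible]
def completionBialgebra : AugmentedBialgebra A k where
  toAugmentedAlgebra := P.completion
  Δ := P.completionΔ
  Δ_algebraMap c := by
    rw [P.completion_algebraMap, completionΔ_toCompletion]
    exact Completion.ext_proj fun i => (P.pairSum i).hom_algebraMap c
  Δ_cont i := by
    obtain ⟨s, hs⟩ := P.isCont_Δ₀ i
    refine ⟨s, fun a ha => ?_⟩
    rw [completion_I, RingHom.mem_ker] at ha
    exact (proj_extend P.directed_I P.isCont_Δ₀ hs a).trans ((congrArg _ ha).trans (map_zero _))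

variable {T : Type u} [CommRing T] {η : k →+* T}

lemma restrictPoint_addPoint (p q : P.completion.Point η) :
    restrictPoint (P.completionBialgebra.addPoint p q) =
      P.add (restrictPoint p) (restrictPoint q) := by
  refine Point.ext (RingHom.ext fun x => ?_)
  change p.eval₂ q (P.completionΔ (P.toCompletion x)) = _
  rw [completionΔ_toCompletion]
  obtain ⟨i, ψ, h⟩ := (Point.isDiscreteCont_eval₂ p q).exists_factor
  rw [h, proj_Δ₀]
  exact P.mapsTo_add (fun a => (h _).symm.trans (Point.eval₂_inc₁₂ p q (P.toCompletion a)))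
    (fun a => (h _).symm.trans (Point.eval₂_inc₂₂ p q (P.toCompletion a))) x

lemma eval₂_completionΔ (p q r : P.completion.Point η)
    (h : P.add (restrictPoint p) (restrictPoint q) = restrictPoint r) (x : P.completion.R) :
    p.eval₂ q (P.completionΔ x) = r.hom x :=
  RingHom.congr_fun (congrArg Point.hom
    (restrictPoint_injective ((P.restrictPoint_addPoint p q).trans h))) x

/-- The formal group law obtained by completion. -/
def completedFGL : EquivariantFGL A k where
  toAugmentedBialgebra := P.completionBialgebra
  y := P.toCompletion (P.E 0)
  complete := P.completion_complete
  cocomm x := P.completion.tensor₂_ext_eval₂ fun T _ η p q => by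
    refine (Point.eval₂_swapHat p q _).trans
      (P.eval₂_completionΔ q p (P.completionBialgebra.addPoint p q) ?_ x)
    rw [restrictPoint_addPoint, P.add_comm]
  coassoc x := P.completion.tensor₃_ext_eval₃ fun T _ η p q r => by
    refine (P.completionBialgebra.eval₃_ΔHatId p q r _).trans (Eq.trans ?_
      (P.completionBialgebra.eval₃_idHatΔ p q r _).symm)
    refine P.eval₂_completionΔ _ _
      (P.completionBialgebra.addPoint p (P.completionBialgebra.addPoint q r)) ?_ x
    rw [restrictPoint_addPoint, restrictPoint_addPoint, restrictPoint_addPoint, P.add_assoc]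
  counit x := P.completion.completion_ext_eval₁ fun T _ η p => by
    refine (Point.eval₁_θHatId p 0 _).trans (P.eval₂_completionΔ _ p p ?_ x)
    rw [restrictPoint_ofθ, P.zero_add]
  θ_Δ V W x := Completion.ext_proj fun _ => by
    refine (Point.proj_θHatθ V W _).trans
      (P.eval₂_completionΔ _ _ (Point.ofθ P.completion (Ideal.Quotient.mk _) (V + W)) ?_ x)
    rw [restrictPoint_ofθ, restrictPoint_ofθ, restrictPoint_ofθ, P.add_ofθ]
  y_regular := P.generator_singleton 0 ▸ P.of_generator_regular {0}
  span_y := P.span_toCompletion_E 0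

lemma completedFGL_isTwoTorsion : P.completedFGL.IsTwoTorsion := by
  refine P.completion.completion_ext_eval₁ fun T _ η p => ?_
  refine (Point.eval₁_mulHat p _).trans
    ((P.eval₂_completionΔ p p (Point.ofθ P.completion η 0) ?_ _).trans ?_)
  · rw [restrictPoint_ofθ, P.add_self]
  · exact P.completedFGL.zero_hom_y.trans (map_zero p.eval₁).symm

lemma restrictPoint_add (p q : P.completedFGL.Point η) :
    restrictPoint (p + q) = P.add (restrictPoint p) (restrictPoint q) :=
  P.restrictPoint_addPoint p q

end UncompletedFGL

/-! ### Translations and the uniqueness of morphisms -/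

namespace EquivariantFGL

variable {A : Type} [AddCommGroup A] [Module (ZMod 2) A]
variable {k' k T : Type u} [CommRing k'] [CommRing k] [CommRing T] {η : k →+* T}

/-- The completion map of a complete algebra. -/
def completionEquiv (F : EquivariantFGL A k) : F.R ≃+* Completion F.I :=
  RingEquiv.ofBijective (of F.I) F.complete

variable {F : EquivariantFGL A k}

lemma hom_completionEquiv_symm (p : F.Point η) (x : Completion F.I) :
    p.hom (F.completionEquiv.symm x) = p.eval₁ x := by
  rw [← Point.eval₁_of]
  exact congrArg p.eval₁ (F.completionEquiv.apply_symm_apply x)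

lemma ext_points {x y : F.R}
    (h : ∀ (T : Type u) [CommRing T] (η : k →+* T) (p : F.Point η), p.hom x = p.hom y) : x = y :=
  F.complete.1 (F.completion_ext_eval₁ fun T _ η p => h T η p)

/-- The translation by the point `θ(V)`. -/
def translate (F : EquivariantFGL A k) (V : Character A) : F.R →+* F.R :=
  (F.completionEquiv.symm : Completion F.I →+* F.R).comp ((F.θHatId V).comp F.Δ)

lemma hom_translate (p : F.Point η) (V : Character A) (x : F.R) :
    p.hom (F.translate V x) = (F.θPoint η V + p).hom x :=
  (hom_completionEquiv_symm p _).trans (Point.eval₁_θHatId p V _)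

lemma translate_translate (hF : F.IsTwoTorsion) (V : Character A) (x : F.R) :
    F.translate V (F.translate V x) = x :=
  ext_points fun T _ η p => by
    rw [hom_translate, hom_translate, ← add_assoc, hF.add_self, zero_add]

lemma θ_zero_translate (V : Character A) (x : F.R) : F.θ 0 (F.translate V x) = F.θ V x := by
  have θ_translate := hom_translate (F.θPoint (RingHom.id k) 0) V x
  rwa [← map_add, add_zero] at θ_translate

lemma θ_translate_y (hF : F.IsTwoTorsion) (V : Character A) : F.θ V (F.translate V F.y) = 0 := by
  rw [← θ_zero_translate, translate_translate hF, F.θ_y]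

lemma exists_eq_add_translate_mul (hF : F.IsTwoTorsion) (V : Character A) (x : F.R) :
    ∃ q, x = algebraMap k F.R (F.θ V x) + F.translate V F.y * q := by
  obtain ⟨q, hq⟩ := F.exists_y_mul_eq (F.translate V x)
  have θ_eq : F.translate V (algebraMap k F.R (F.θ V x)) = algebraMap k F.R (F.θ V x) :=
    ext_points fun T _ η p => by
      rw [hom_translate, Point.hom_algebraMap, Point.hom_algebraMap]
  refine ⟨F.translate V q, ?_⟩
  rw [← map_mul, hq, θ_zero_translate, map_sub, translate_translate hF, θ_eq, add_sub_cancel]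

lemma exists_hom_eq_and_sub_mem_I (hF : F.IsTwoTorsion) {p q : F.Point η}
    (h : ∀ V, (F.θPoint η V + p).hom F.y = (F.θPoint η V + q).hom F.y)
    (s : Multiset (Character A)) (r : F.R) : ∃ z, p.hom z = q.hom z ∧ r - z ∈ F.I s := by
  induction s using Multiset.induction_on generalizing r with
  | empty => exact ⟨0, by simp [AugmentedAlgebra.I]⟩
  | cons V s ih =>
    obtain ⟨r₁, hr₁⟩ := exists_eq_add_translate_mul hF V r
    obtain ⟨z, hz, sub_mem⟩ := ih r₁
    refine ⟨algebraMap k F.R (F.θ V r) + F.translate V F.y * z, ?_, ?_⟩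
    · rw [map_add, map_add, map_mul, map_mul, hz, hom_translate, hom_translate, h, p.agree q]
    · have sub_eq : r - (algebraMap k F.R (F.θ V r) + F.translate V F.y * z) =
          F.translate V F.y * (r₁ - z) := by linear_combination hr₁
      rw [sub_eq, AugmentedAlgebra.I_cons]
      exact Ideal.mul_mem_mul (θ_translate_y hF V) sub_mem

lemma point_ext_add_y (hF : F.IsTwoTorsion) {p q : F.Point η}
    (h : ∀ V, (F.θPoint η V + p).hom F.y = (F.θPoint η V + q).hom F.y) : p = q := by
  obtain ⟨s, hs⟩ := p.cont
  obtain ⟨t, ht⟩ := q.cont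
  refine Point.ext (RingHom.ext fun r => ?_)
  obtain ⟨z, hz, sub_mem⟩ := exists_hom_eq_and_sub_mem_I hF h (s + t) r
  have hp : p.hom (r - z) = 0 := hs (F.I_add_le_left s t sub_mem)
  have hq : q.hom (r - z) = 0 := ht (F.I_add_le_right s t sub_mem)
  rw [map_sub, sub_eq_zero] at hp hq
  rw [hp, hq, hz]

lemma HomOver.hom_θPoint_add_pullHom_y {G : EquivariantFGL A k'} {f : k →+* k'} {η : k' →+* T}
    (g : HomOver (LinearMap.id : A →ₗ[ZMod 2] A) f F G) (V : Character A) (p : G.Point η) :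
    (F.θPoint (η.comp f) V + g.pullHom η p).hom F.y = (G.θPoint η V + p).hom G.y := by
  have pullHom_θPoint : g.pullHom η (G.θPoint η V) = F.θPoint (η.comp f) V :=
    Point.ext (RingHom.ext fun x => congrArg η (g.map_θ V x))
  rw [← pullHom_θPoint, ← map_add]
  exact congrArg (G.θPoint η V + p).hom g.map_y

lemma HomOver.ext_of_isTwoTorsion (hF : F.IsTwoTorsion) {G : EquivariantFGL A k'} {f : k →+* k'}
    (g g' : HomOver (LinearMap.id : A →ₗ[ZMod 2] A) f F G) : g = g' := by
  have φ_eq : g.φ = g'.φ := RingHom.ext fun x => ext_points fun T _ η p => by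
    have pull_eq : g.pullHom η p = g'.pullHom η p := point_ext_add_y hF fun V => by
      rw [g.hom_θPoint_add_pullHom_y, g'.hom_θPoint_add_pullHom_y]
    exact RingHom.congr_fun (congrArg Point.hom pull_eq) x
  obtain ⟨⟨φ, _, _, _⟩, _⟩ := g
  obtain ⟨⟨φ', _, _, _⟩, _⟩ := g'
  obtain rfl : φ = φ' := φ_eq
  rfl

end EquivariantFGL

namespace UncompletedFGL

open PrincipalAugmentedAlgebra

variable {A B : Type} [AddCommGroup A] [Module (ZMod 2) A] [AddCommGroup B] [Module (ZMod 2) B]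
variable {k' k T : Type u} [CommRing k'] [CommRing k] [CommRing T] {η : k' →+* T}

/-- The analogue of `EquivariantFGL.PreHom` for maps out of an uncompleted formal group law. -/
structure PreHom (δ : B →ₗ[ZMod 2] A) (f : k →+* k') (P : UncompletedFGL B k)
    (G : EquivariantFGL A k') where
  φ : P.R →+* G.R
  map_algebraMap : ∀ c, φ (algebraMap k P.R c) = algebraMap k' G.R (f c)
  map_θ : ∀ (V : Character A) (x : P.R), G.θ V (φ x) = f (P.θ (V ∘ₗ δ) x)
  map_E : φ (P.E 0) = G.y

namespace PreHom

variable {P : UncompletedFGL B k} {G : EquivariantFGL A k'} {δ : B →ₗ[ZMod 2] A} {f : k →+* k'}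
variable (g : PreHom δ f P G)

lemma isCont : IsCont P.I ((of G.I).comp g.φ) :=
  IsCont.of_comp (fun s => ⟨_, AugmentedAlgebra.I_le_comap g.map_θ s⟩) (isCont_of G.I)

/-- The image of a point. -/
def pull (p : G.Point η) : P.Point (η.comp f) :=
  p.comap g.φ g.map_algebraMap fun s => ⟨_, AugmentedAlgebra.I_le_comap g.map_θ s⟩

/-- The continuous extension to the completion. -/
def completedMap : P.completedFGL.R →+* G.R :=
  (G.completionEquiv.symm : Completion G.I →+* G.R).comp (extend P.directed_I g.isCont)

lemma completedMap_toCompletion (x : P.R) : g.completedMap (P.toCompletion x) = g.φ x :=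
  (congrArg G.completionEquiv.symm (extend_of P.directed_I g.isCont x)).trans
    (G.completionEquiv.symm_apply_apply _)

lemma of_completedMap (x : P.completedFGL.R) :
    of G.I (g.completedMap x) = extend P.directed_I g.isCont x :=
  G.completionEquiv.apply_symm_apply _

lemma completion_I_le_comap (s : Multiset (Character A)) :
    P.completion.I (s.map fun V => V ∘ₗ δ) ≤ (G.I s).comap g.completedMap := by
  intro x hx
  rw [completion_I, RingHom.mem_ker] at hx
  have I_le : P.I (s.map fun V => V ∘ₗ δ) ≤
      RingHom.ker ((proj G.I s).comp ((of G.I).comp g.φ)) := fun a ha =>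
    Ideal.Quotient.eq_zero_iff_mem.2 (AugmentedAlgebra.I_le_comap g.map_θ s ha)
  refine (Ideal.Quotient.eq_zero_iff_mem (I := G.I s)).1 ?_
  exact (congrArg (proj G.I s) (g.of_completedMap x)).trans
    ((proj_extend P.directed_I g.isCont I_le x).trans ((congrArg _ hx).trans (map_zero _)))

lemma θ_completedMap (V : Character A) (x : P.completedFGL.R) :
    G.θ V (g.completedMap x) = f (P.completedFGL.θ (V ∘ₗ δ) x) := by
  refine RingHom.congr_fun (hom_ext_toCompletion (Φ := (G.θ V : G.R →+* k').comp g.completedMap)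
    (Ψ := f.comp (P.completion.θ (V ∘ₗ δ) : P.completion.R →+* k))
    ⟨({V} : Multiset (Character A)).map fun V => V ∘ₗ δ, ?_⟩ ⟨{V ∘ₗ δ}, ?_⟩ fun x => ?_) x
  · exact (g.completion_I_le_comap {V}).trans (Ideal.comap_mono (G.I_singleton V).le)
  · exact (P.completion.I_singleton _).trans_le (ker_le_ker_comp _ f)
  · exact (congrArg (G.θ V) (g.completedMap_toCompletion x)).trans (g.map_θ V x)

/-- The extension to the completion preserves the augmentations and orientations. -/
def completedPreHom : EquivariantFGL.PreHom δ f P.completedFGL G where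
  φ := g.completedMap
  map_algebraMap c := (g.completedMap_toCompletion _).trans (g.map_algebraMap c)
  map_θ := g.θ_completedMap
  map_y := (g.completedMap_toCompletion _).trans g.map_E

lemma restrictPoint_pull (p : G.Point η) : restrictPoint (g.completedPreHom.pull p) = g.pull p :=
  Point.ext (RingHom.ext fun x => congrArg p.hom (g.completedMap_toCompletion x))

/-- The extension to the completion is a morphism if `g` is compatible with the addition of
points. -/
def completedHom (hadd : ∀ {T : Type u} [CommRing T] {η : k' →+* T} (p q : G.Point η),
    g.pull (p + q) = P.add (g.pull p) (g.pull q)) :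
    EquivariantFGL.HomOver δ f P.completedFGL G where
  toPreHom := g.completedPreHom
  map_Δ x := G.tensor₂_ext_eval₂ fun T _ η p q => by
    rw [EquivariantFGL.PreHom.eval₂_hat]
    refine (P.eval₂_completionΔ _ _ (g.completedPreHom.pull (p + q)) ?_ x).symm
    rw [restrictPoint_pull, restrictPoint_pull, restrictPoint_pull, hadd]

end PreHom

end UncompletedFGL

/-! ### Base change for algebras with principal augmentation ideals -/

/-- A commutative square of rings `k → k'`, `S → S'` in which both vertical maps `k → S` and
`k' → S'` are equipped with a family of retractions, whose kernels are generated by compatible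
elements that are regular in `S'`. Such a square is a pushout for those homomorphisms out of `S`
that vanish on a product of generators, see `exists_lift` and `lift_ext`. -/
structure AugmentedSquare (k k' S S' : Type u) [CommRing k] [CommRing k'] [CommRing S] [CommRing S']
    [Algebra k k'] [Algebra k S] (ι : Type) where
  E : ι → S
  θ : ι → S →+* k
  θ_E : ∀ i, θ i (E i) = 0
  exists_eq : ∀ i x, ∃ q, x = algebraMap k S (θ i x) + E i * q
  incl : k' →+* S'
  map : S →+* S'
  agree : ∀ c, incl (algebraMap k k' c) = map (algebraMap k S c)
  θ' : ι → S' →+* k'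
  θ'_incl : ∀ i c, θ' i (incl c) = c
  θ'_map : ∀ i x, θ' i (map x) = algebraMap k k' (θ i x)
  exists_eq' : ∀ i x, ∃ q, x = incl (θ' i x) + map (E i) * q
  cancel : ∀ i x y, map (E i) * x = map (E i) * y → x = y

namespace AugmentedSquare

variable {k k' S S' T : Type u} [CommRing k] [CommRing k'] [CommRing S] [CommRing S'] [CommRing T]
  [Algebra k k'] [Algebra k S] {ι : Type} (d : AugmentedSquare k k' S S' ι)

/-- The comparison of the base change with `S'`. -/
def comparison : k' ⊗[k] S →+* S' := tensorLift d.incl d.map d.agree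

lemma comparison_inl (c : k') : d.comparison (inl k k' S c) = d.incl c := tensorLift_inl _ _

lemma comparison_inr (x : S) : d.comparison (inr k k' S x) = d.map x := tensorLift_inr _ _

/-- The product of the generators belonging to a multiset of indices. -/
def generator (s : Multiset ι) : S := (s.map d.E).prod

lemma generator_zero : d.generator 0 = 1 := by rw [generator, Multiset.map_zero, Multiset.prod_zero]

lemma generator_cons (i : ι) (s : Multiset ι) :
    d.generator (i ::ₘ s) = d.E i * d.generator s := by
  rw [generator, Multiset.map_cons, Multiset.prod_cons, generator]

lemma exists_eq_inl_add (i : ι) (x : k' ⊗[k] S) :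
    ∃ c q, x = inl k k' S c + inr k k' S (d.E i) * q := by
  induction x using TensorProduct.induction_on with
  | zero => exact ⟨0, 0, by simp⟩
  | tmul c x =>
    obtain ⟨q, hq⟩ := d.exists_eq i x
    refine ⟨c * algebraMap k k' (d.θ i x), inl k k' S c * inr k k' S q, ?_⟩
    rw [tmul_eq_inl_mul_inr, map_mul, inl_algebraMap]
    nth_rewrite 1 [hq]
    rw [map_add, map_mul]
    ring
  | add x y hx hy =>
    obtain ⟨c, q, rfl⟩ := hx
    obtain ⟨c', q', rfl⟩ := hy
    exact ⟨c + c', q + q', by rw [map_add]; ring⟩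

lemma exists_eq_comparison_add (s : Multiset ι) (z : S') :
    ∃ x w, z = d.comparison x + d.map (d.generator s) * w := by
  induction s using Multiset.induction_on generalizing z with
  | empty => exact ⟨0, z, by rw [generator_zero, map_zero, map_one, zero_add, one_mul]⟩
  | cons i s ih =>
    obtain ⟨q, hq⟩ := d.exists_eq' i z
    obtain ⟨x, w, rfl⟩ := ih q
    refine ⟨inl k k' S (d.θ' i z) + inr k k' S (d.E i) * x, w, ?_⟩
    nth_rewrite 1 [hq]
    rw [map_add, map_mul, comparison_inl, comparison_inr, generator_cons, map_mul]
    ring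

lemma inr_generator_dvd (s : Multiset ι) {x : k' ⊗[k] S}
    (h : d.map (d.generator s) ∣ d.comparison x) : inr k k' S (d.generator s) ∣ x := by
  induction s using Multiset.induction_on generalizing x with
  | empty => rw [generator_zero, map_one]; exact one_dvd x
  | cons i s ih =>
    obtain ⟨w, hw⟩ := h
    obtain ⟨c, q, rfl⟩ := d.exists_eq_inl_add i x
    rw [generator_cons, map_add, map_mul, map_mul, comparison_inl, comparison_inr, mul_assoc] at hw
    have θ'_map_E : d.θ' i (d.map (d.E i)) = 0 := by rw [d.θ'_map, d.θ_E, map_zero]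
    obtain rfl : c = 0 := by
      have := congrArg (d.θ' i) hw
      rwa [map_add, map_mul, map_mul, θ'_map_E, zero_mul, zero_mul, add_zero, d.θ'_incl] at this
    rw [map_zero, zero_add] at hw
    rw [map_zero, zero_add, generator_cons, map_mul]
    exact mul_dvd_mul_left _ (ih ⟨w, d.cancel i _ _ hw⟩)

lemma exists_lift {g : k' →+* T} {f : S →+* T}
    (h : ∀ c, g (algebraMap k k' c) = f (algebraMap k S c)) {s : Multiset ι}
    (hs : f (d.generator s) = 0) :
    ∃ Φ : S' →+* T, (∀ c, Φ (d.incl c) = g c) ∧ ∀ x, Φ (d.map x) = f x := by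
  let π : k' ⊗[k] S →+* S' ⧸ Ideal.span {d.map (d.generator s)} :=
    (Ideal.Quotient.mk _).comp d.comparison
  have surjective_π : Function.Surjective π := fun y => by
    obtain ⟨z, rfl⟩ := Ideal.Quotient.mk_surjective y
    obtain ⟨x, w, rfl⟩ := d.exists_eq_comparison_add s z
    refine ⟨x, (Ideal.Quotient.eq.2 ?_).symm⟩
    rw [add_sub_cancel_left, Ideal.mem_span_singleton]
    exact dvd_mul_right _ _
  have ker_π_le : RingHom.ker π ≤ RingHom.ker (tensorLift g f h) := fun x hx => by
    obtain ⟨z, rfl⟩ := d.inr_generator_dvd s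
      (Ideal.mem_span_singleton.1 (Ideal.Quotient.eq_zero_iff_mem.1 hx))
    rw [RingHom.mem_ker, map_mul, tensorLift_inr, hs, zero_mul]
  let Ψ : S' ⧸ Ideal.span {d.map (d.generator s)} →+* T :=
    π.liftOfSurjective surjective_π ⟨tensorLift g f h, ker_π_le⟩
  have Ψ_π (x) : Ψ (π x) = tensorLift g f h x :=
    π.liftOfRightInverse_comp_apply _ _ ⟨tensorLift g f h, ker_π_le⟩ x
  refine ⟨Ψ.comp (Ideal.Quotient.mk _), fun c => ?_, fun x => ?_⟩
  · rw [RingHom.comp_apply, ← d.comparison_inl c]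
    exact (Ψ_π _).trans (tensorLift_inl _ _)
  · rw [RingHom.comp_apply, ← d.comparison_inr x]
    exact (Ψ_π _).trans (tensorLift_inr _ _)

lemma lift_ext {Φ Ψ : S' →+* T} (h_incl : ∀ c, Φ (d.incl c) = Ψ (d.incl c))
    (h_map : ∀ x, Φ (d.map x) = Ψ (d.map x)) {s : Multiset ι}
    (hs : Φ (d.map (d.generator s)) = 0) : Φ = Ψ := by
  have comp_eq : Φ.comp d.comparison = Ψ.comp d.comparison := tensor_ringHom_ext
    (fun c => by rw [RingHom.comp_apply, RingHom.comp_apply, comparison_inl, h_incl])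
    (fun x => by rw [RingHom.comp_apply, RingHom.comp_apply, comparison_inr, h_map])
  ext z
  obtain ⟨x, w, rfl⟩ := d.exists_eq_comparison_add s z
  have comparison_eq : Φ (d.comparison x) = Ψ (d.comparison x) := RingHom.congr_fun comp_eq x
  rw [map_add, map_add, map_mul, map_mul, ← h_map, hs, comparison_eq, zero_mul, zero_mul]

end AugmentedSquare

/-! ### The value of a global group law at `B × C₂` -/

namespace El₂

/-- The product of an elementary abelian 2-group with `C₂`. -/
abbrev plus (B : El₂) : El₂ := FGModuleCat.of (ZMod 2) (B × ZMod 2)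

variable {A B C : El₂}

/-- The projection `B × C₂ → B`. -/
def fst (B : El₂) : B.plus →ₗ[ZMod 2] B := LinearMap.fst (ZMod 2) B (ZMod 2)

/-- The projection `B × C₂ → C₂`. -/
def snd (B : El₂) : Character B.plus := LinearMap.snd (ZMod 2) B (ZMod 2)

/-- The homomorphism to `B × C₂` with the given components. -/
def pair (β : C →ₗ[ZMod 2] B) (U : Character C) : C →ₗ[ZMod 2] B.plus := LinearMap.prod β U

lemma fst_comp_pair (β : C →ₗ[ZMod 2] B) (U : Character C) : B.fst ∘ₗ pair β U = β := rfl

/-- The graph of a character. -/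
def graph (U : Character B) : B →ₗ[ZMod 2] B.plus := pair LinearMap.id U

/-- The homomorphism `α × id`. -/
def plusMap (α : C →ₗ[ZMod 2] B) : C.plus →ₗ[ZMod 2] B.plus := pair (α ∘ₗ C.fst) C.snd

/-- The character `(b, c) ↦ U(b) + c` of `B × C₂`, whose kernel is the graph of `U`. -/
def graphCharacter (U : Character B) : Character B.plus := U ∘ₗ B.fst + B.snd

lemma graphCharacter_apply_one (U : Character B) : graphCharacter U ((0, 1) : B × ZMod 2) = 1 := by
  simp [graphCharacter, fst, snd]

lemma projKer_graphCharacter (U : Character B) :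
    (graphCharacter U).projKer ((0, 1) : B × ZMod 2) = graph U ∘ₗ B.fst := by
  refine LinearMap.ext fun c => Prod.ext ?_ ?_
  · change c.1 - (U c.1 + c.2) • (0 : B) = c.1
    rw [smul_zero, sub_zero]
  · change c.2 - (U c.1 + c.2) • (1 : ZMod 2) = U c.1
    rw [smul_eq_mul, mul_one, sub_add_cancel_right, ZModModule.neg_eq_self]

end El₂

namespace GlobalGroupLaw

open El₂

variable (X : GlobalGroupLaw.{u}) {A B C : El₂}

lemma euler_dvd_euler_add_sub (U W : Character B) : X.euler U ∣ X.euler (U + W) - X.euler W := by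
  by_cases hU : U = 0
  · rw [hU, zero_add, sub_self]
    exact dvd_zero _
  · obtain ⟨b, hb⟩ := Character.exists_eq_one hU
    have comp_projKer : U ∘ₗ U.projKer b = 0 := by
      ext a
      simp [Character.projKer_apply, hb]
    refine X.euler_dvd hb ?_
    rw [map_sub, restrict_euler, restrict_euler, LinearMap.add_comp, comp_projKer, zero_add,
      sub_self]

/-- The Euler class of the character of `B × C₂` with kernel the graph of `U`. It generates the
kernel of the restriction along the graph of `U`. -/
def graphEuler (U : Character B) : X.X.obj (op B.plus) := X.euler (graphCharacter U)

lemma restrict_pair_graphEuler (U : Character B) (β : C →ₗ[ZMod 2] B) (W : Character C) :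
    X.X.restrict (pair β W) (X.graphEuler U) = X.euler (U ∘ₗ β + W) := X.restrict_euler _ _

lemma restrict_plusMap_graphEuler (U : Character B) (α : C →ₗ[ZMod 2] B) :
    X.X.restrict (plusMap α) (X.graphEuler U) = X.graphEuler (U ∘ₗ α) := X.restrict_euler _ _

lemma restrict_graph_graphEuler (U : Character B) :
    X.X.restrict (graph U) (X.graphEuler U) = 0 := by
  rw [graph, restrict_pair_graphEuler, LinearMap.comp_id, ZModModule.add_self, X.euler_zero]

lemma graphEuler_mul_cancel (U : Character B) {x y : X.X.obj (op B.plus)}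
    (h : X.graphEuler U * x = X.graphEuler U * y) : x = y :=
  X.euler_mul_cancel (A := B.plus) (graphCharacter_apply_one U) h

lemma exists_eq_restrict_add (U : Character B) (x : X.X.obj (op B.plus)) :
    ∃ q, x = X.X.restrict B.fst (X.X.restrict (graph U) x) + X.graphEuler U * q := by
  obtain ⟨q, hq⟩ := X.euler_dvd_sub (A := B.plus) (graphCharacter_apply_one U) x
  rw [projKer_graphCharacter, ← X.X.restrict_restrict] at hq
  exact ⟨q, by rw [graphEuler, ← hq, add_sub_cancel]⟩

/-- The augmented square given by the restriction along `α × id`. -/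
def augmentedSquare (α : C →ₗ[ZMod 2] B) :
    letI := (X.X.restrict α).toAlgebra
    letI := (X.X.restrict B.fst).toAlgebra
    AugmentedSquare (X.X.obj (op B)) (X.X.obj (op C)) (X.X.obj (op B.plus)) (X.X.obj (op C.plus))
      (Character B) :=
  letI := (X.X.restrict α).toAlgebra
  letI := (X.X.restrict B.fst).toAlgebra
  { E := X.graphEuler
    θ := fun U => X.X.restrict (graph U)
    θ_E := X.restrict_graph_graphEuler
    exists_eq := X.exists_eq_restrict_add
    incl := X.X.restrict C.fst
    map := X.X.restrict (plusMap α)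
    agree := fun c =>
      (X.X.restrict_restrict _ _ _).trans (X.X.restrict_restrict B.fst (plusMap α) c).symm
    θ' := fun U => X.X.restrict (graph (U ∘ₗ α))
    θ'_incl := fun U c => (X.X.restrict_restrict _ _ _).trans (X.X.restrict_id c)
    θ'_map := fun U x =>
      (X.X.restrict_restrict _ _ _).trans (X.X.restrict_restrict (graph U) α x).symm
    exists_eq' := fun U x => by
      rw [restrict_plusMap_graphEuler]
      exact X.exists_eq_restrict_add (U ∘ₗ α) x
    cancel := fun U x y h => by
      rw [restrict_plusMap_graphEuler] at h
      exact X.graphEuler_mul_cancel _ h }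

variable {T : Type u} [CommRing T]

lemma exists_lift_plus (α : C →ₗ[ZMod 2] B) {g : X.X.obj (op C) →+* T}
    {f : X.X.obj (op B.plus) →+* T} (h : ∀ c, g (X.X.restrict α c) = f (X.X.restrict B.fst c))
    {s : Multiset (Character B)} (hs : f (s.map X.graphEuler).prod = 0) :
    ∃ Φ : X.X.obj (op C.plus) →+* T,
      (∀ c, Φ (X.X.restrict C.fst c) = g c) ∧ ∀ x, Φ (X.X.restrict (plusMap α) x) = f x :=
  letI := (X.X.restrict α).toAlgebra
  letI := (X.X.restrict B.fst).toAlgebra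
  (X.augmentedSquare α).exists_lift h hs

lemma plus_ringHom_ext (α : C →ₗ[ZMod 2] B) {Φ Ψ : X.X.obj (op C.plus) →+* T}
    (h_fst : ∀ c, Φ (X.X.restrict C.fst c) = Ψ (X.X.restrict C.fst c))
    (h_plusMap : ∀ x, Φ (X.X.restrict (plusMap α) x) = Ψ (X.X.restrict (plusMap α) x))
    {s : Multiset (Character B)}
    (hs : Φ (X.X.restrict (plusMap α) (s.map X.graphEuler).prod) = 0) : Φ = Ψ :=
  letI := (X.X.restrict α).toAlgebra
  letI := (X.X.restrict B.fst).toAlgebra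
  (X.augmentedSquare α).lift_ext h_fst h_plusMap hs

end GlobalGroupLaw

/-! ### The formal group laws associated with a global group law -/

lemma dvd_prod_map_sub_prod_map {κ R : Type*} [CommRing R] {x : R} {y z : κ → R}
    (h : ∀ j, x ∣ z j - y j) (t : Multiset κ) : x ∣ (t.map z).prod - (t.map y).prod := by
  rw [← Ideal.mem_span_singleton, ← Ideal.Quotient.eq, map_multiset_prod, map_multiset_prod,
    Multiset.map_map, Multiset.map_map]
  exact congrArg _ (Multiset.map_congr rfl fun j _ =>
    Ideal.Quotient.eq.2 (Ideal.mem_span_singleton.2 (h j)))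

lemma prod_bind_map_eq_zero {ι κ R : Type*} [CommRing R] {x : ι → R} {y : κ → R} {z : ι → κ → R}
    {s : Multiset ι} {t : Multiset κ} (h : ∀ i j, x i ∣ z i j - y j) (hx : (s.map x).prod = 0)
    (hy : (t.map y).prod = 0) : (s.bind fun i => t.map (z i)).prod = 0 := by
  have dvd_prod (i : ι) : x i ∣ (t.map (z i)).prod := by
    simpa only [hy, sub_zero] using dvd_prod_map_sub_prod_map (h i) t
  rw [Multiset.prod_bind, ← zero_dvd_iff, ← hx]
  exact Multiset.prod_dvd_prod_of_dvd _ _ fun i _ => dvd_prod i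

namespace PrincipalAugmentedAlgebra

variable {A : Type} [AddCommGroup A] [Module (ZMod 2) A] {k T : Type u} [CommRing k] [CommRing T]
variable (P : PrincipalAugmentedAlgebra A k)

lemma I_le_ker_iff {f : P.R →+* T} {s : Multiset (Character A)} :
    P.I s ≤ RingHom.ker f ↔ f (P.generator s) = 0 := by
  rw [← span_generator, Ideal.span_singleton_le_iff_mem, RingHom.mem_ker]

lemma map_generator (f : P.R →+* T) (s : Multiset (Character A)) :
    f (P.generator s) = (s.map fun V => f (P.E V)).prod := by
  rw [generator, map_multiset_prod, Multiset.map_map]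
  rfl

end PrincipalAugmentedAlgebra

namespace El₂

/-- The homomorphism `B × C₂ × C₂ → B × C₂` given by the addition of `C₂`. -/
def sumMap (B : El₂) : B.plus.plus →ₗ[ZMod 2] B.plus :=
  pair (B.fst ∘ₗ B.plus.fst) (B.snd ∘ₗ B.plus.fst + B.plus.snd)

/-- The homomorphism `B × C₂ × C₂ → B × C₂ × C₂` that exchanges the factors `C₂`. -/
def swapMap (B : El₂) : B.plus.plus →ₗ[ZMod 2] B.plus.plus :=
  pair (plusMap B.fst) (B.snd ∘ₗ B.plus.fst)

lemma sumMap_comp_swapMap (B : El₂) : B.sumMap ∘ₗ B.swapMap = B.sumMap :=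
  LinearMap.ext fun (c : (B × ZMod 2) × ZMod 2) => Prod.ext rfl (add_comm c.2 c.1.2)

lemma sumMap_comp_plusMap_sumMap (B : El₂) :
    B.sumMap ∘ₗ plusMap B.sumMap = B.sumMap ∘ₗ B.plus.sumMap :=
  LinearMap.ext fun (c : ((B × ZMod 2) × ZMod 2) × ZMod 2) =>
    Prod.ext rfl (add_assoc c.1.1.2 c.1.2 c.2)

lemma sumMap_comp_zero (B : El₂) : B.sumMap ∘ₗ pair (pair B.fst 0) B.snd = LinearMap.id :=
  LinearMap.ext fun c => Prod.ext rfl (zero_add c.2)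

lemma sumMap_comp_diag (B : El₂) :
    B.sumMap ∘ₗ pair LinearMap.id B.snd = graph (0 : Character B) ∘ₗ B.fst :=
  LinearMap.ext fun c => Prod.ext rfl (ZModModule.add_self c.2)

lemma graphCharacter_add_comp_sumMap {B : El₂} (U W : Character B) :
    graphCharacter (U + W) ∘ₗ B.sumMap =
      graphCharacter U ∘ₗ B.plus.fst + graphCharacter W ∘ₗ plusMap B.fst :=
  LinearMap.ext fun (c : (B × ZMod 2) × ZMod 2) => by
    change U c.1.1 + W c.1.1 + (c.1.2 + c.2) = U c.1.1 + c.1.2 + (W c.1.1 + c.2)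
    abel

end El₂

namespace GlobalGroupLaw

open El₂

variable (X : GlobalGroupLaw.{u}) {A B : El₂} (α : B →ₗ[ZMod 2] A)

/-- The augmented algebra with underlying ring the value at `B × C₂` of a global group law and with
augmentations the restrictions along the graphs of the characters that factor through `α`. -/
@[reducible]
def plusAlgebra : PrincipalAugmentedAlgebra A (X.X.obj (op B)) where
  R := X.X.obj (op B.plus)
  algebra := (X.X.restrict B.fst).toAlgebra
  θ V :=
    letI := (X.X.restrict B.fst).toAlgebra
    { X.X.restrict (graph (V ∘ₗ α)) with
      commutes' := fun c => (X.X.restrict_restrict _ _ _).trans (X.X.restrict_id c) }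
  E V := X.graphEuler (V ∘ₗ α)
  E_regular V := mem_nonZeroDivisors_iff_right.2 fun x hx =>
    X.graphEuler_mul_cancel (V ∘ₗ α) ((mul_comm _ _).trans (hx.trans (mul_zero _).symm))
  span_E V := by
    refine le_antisymm ((Ideal.span_singleton_le_iff_mem _).2 (X.restrict_graph_graphEuler _))
      fun x (hx : X.X.restrict (graph (V ∘ₗ α)) x = 0) => ?_
    obtain ⟨q, hq⟩ := X.exists_eq_restrict_add (V ∘ₗ α) x
    rw [hx, map_zero, zero_add] at hq
    exact Ideal.mem_span_singleton.2 ⟨q, hq⟩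

variable {X α}
variable {T T' : Type u} [CommRing T] [CommRing T'] {η : X.X.obj (op B) →+* T}
  {η' : X.X.obj (op B) →+* T'}

lemma hom_restrict_fst (p : (X.plusAlgebra α).Point η) (c : X.X.obj (op B)) :
    p.hom (X.X.restrict B.fst c) = η c := p.hom_algebraMap c

lemma exists_hom_prod_graphEuler_eq_zero (p : (X.plusAlgebra α).Point η) :
    ∃ s : Multiset (Character B), p.hom (s.map X.graphEuler).prod = 0 := by
  obtain ⟨s, hs⟩ := p.cont
  refine ⟨s.map fun V => V ∘ₗ α, ?_⟩
  rw [Multiset.map_map]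
  exact (X.plusAlgebra α).I_le_ker_iff.1 hs

lemma exists_pairHom (p q : (X.plusAlgebra α).Point η) :
    ∃ Φ : X.X.obj (op B.plus.plus) →+* T, (∀ c, Φ (X.X.restrict B.plus.fst c) = p.hom c) ∧
      ∀ x, Φ (X.X.restrict (plusMap B.fst) x) = q.hom x := by
  obtain ⟨s, hs⟩ := exists_hom_prod_graphEuler_eq_zero q
  exact X.exists_lift_plus B.fst
    (fun c => (hom_restrict_fst p c).trans (hom_restrict_fst q c).symm) hs

/-- The homomorphism determined by two points. -/
def pairHom (p q : (X.plusAlgebra α).Point η) : X.X.obj (op B.plus.plus) →+* T :=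
  (exists_pairHom p q).choose

lemma pairHom_fst (p q : (X.plusAlgebra α).Point η) (c : X.X.obj (op B.plus)) :
    pairHom p q (X.X.restrict B.plus.fst c) = p.hom c := (exists_pairHom p q).choose_spec.1 c

lemma pairHom_plusMap (p q : (X.plusAlgebra α).Point η) (x : X.X.obj (op B.plus)) :
    pairHom p q (X.X.restrict (plusMap B.fst) x) = q.hom x :=
  (exists_pairHom p q).choose_spec.2 x

lemma eq_pairHom {p q : (X.plusAlgebra α).Point η} {Φ : X.X.obj (op B.plus.plus) →+* T}
    (h_fst : ∀ c, Φ (X.X.restrict B.plus.fst c) = p.hom c)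
    (h_plusMap : ∀ x, Φ (X.X.restrict (plusMap B.fst) x) = q.hom x) : Φ = pairHom p q := by
  obtain ⟨s, hs⟩ := exists_hom_prod_graphEuler_eq_zero q
  refine X.plus_ringHom_ext B.fst (fun c => ?_) (fun x => ?_) (s := s) ?_
  · rw [h_fst, pairHom_fst]
  · rw [h_plusMap, pairHom_plusMap]
  · rw [h_plusMap, hs]

lemma hom_E_dvd_pairHom_sub (p q : (X.plusAlgebra α).Point η) (V W : Character A) :
    p.hom (X.graphEuler (V ∘ₗ α)) ∣
      pairHom p q (X.X.restrict B.sumMap (X.graphEuler ((V + W) ∘ₗ α))) -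
        q.hom (X.graphEuler (W ∘ₗ α)) := by
  rw [← pairHom_fst p q, ← pairHom_plusMap p q, ← map_sub, graphEuler, graphEuler, graphEuler,
    restrict_euler, restrict_euler, restrict_euler, LinearMap.add_comp,
    graphCharacter_add_comp_sumMap]
  exact map_dvd _ (X.euler_dvd_euler_add_sub _ _)

/-- The sum of two points. -/
def addPoint (p q : (X.plusAlgebra α).Point η) : (X.plusAlgebra α).Point η where
  hom := (pairHom p q).comp (X.X.restrict B.sumMap)
  hom_algebraMap c := by
    change pairHom p q (X.X.restrict B.sumMap (X.X.restrict B.fst c)) = _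
    rw [X.X.restrict_restrict, sumMap, fst_comp_pair, ← X.X.restrict_restrict, pairHom_fst,
      hom_restrict_fst]
  cont := by
    obtain ⟨s, hs⟩ := p.cont
    obtain ⟨t, ht⟩ := q.cont
    refine ⟨s.bind fun V => t.map fun W => V + W, ?_⟩
    rw [PrincipalAugmentedAlgebra.I_le_ker_iff, PrincipalAugmentedAlgebra.map_generator] at hs ht ⊢
    rw [Multiset.map_bind]
    simp only [Multiset.map_map]
    exact prod_bind_map_eq_zero (hom_E_dvd_pairHom_sub p q) hs ht

lemma addPoint_hom (p q : (X.plusAlgebra α).Point η) (x : X.X.obj (op B.plus)) :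
    (addPoint p q).hom x = pairHom p q (X.X.restrict B.sumMap x) := rfl

lemma addPoint_eq {p q r : (X.plusAlgebra α).Point η} {Φ : X.X.obj (op B.plus.plus) →+* T}
    (h_fst : ∀ c, Φ (X.X.restrict B.plus.fst c) = p.hom c)
    (h_plusMap : ∀ x, Φ (X.X.restrict (plusMap B.fst) x) = q.hom x)
    (h_sumMap : ∀ x, Φ (X.X.restrict B.sumMap x) = r.hom x) : addPoint p q = r := by
  obtain rfl : Φ = pairHom p q := eq_pairHom h_fst h_plusMap
  exact Point.ext (RingHom.ext h_sumMap)

lemma mapsTo_addPoint {φ : T →+* T'} {p q : (X.plusAlgebra α).Point η}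
    {p' q' : (X.plusAlgebra α).Point η'} (hp : Point.MapsTo φ p p') (hq : Point.MapsTo φ q q') :
    Point.MapsTo φ (addPoint p q) (addPoint p' q') := by
  have comp_pairHom : φ.comp (pairHom p q) = pairHom p' q' := eq_pairHom
    (fun c => by rw [RingHom.comp_apply, pairHom_fst, hp])
    (fun x => by rw [RingHom.comp_apply, pairHom_plusMap, hq])
  intro x
  rw [addPoint_hom, addPoint_hom, ← comp_pairHom, RingHom.comp_apply]

lemma addPoint_comm (p q : (X.plusAlgebra α).Point η) : addPoint p q = addPoint q p := by
  refine addPoint_eq (Φ := (pairHom q p).comp (X.X.restrict B.swapMap)) (fun c => ?_)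
    (fun x => ?_) fun x => ?_
  · rw [RingHom.comp_apply, X.X.restrict_restrict]
    exact pairHom_plusMap q p c
  · rw [RingHom.comp_apply, X.X.restrict_restrict]
    exact pairHom_fst q p x
  · rw [RingHom.comp_apply, X.X.restrict_restrict, addPoint_hom, sumMap_comp_swapMap]

lemma exists_tripleHom (p q r : (X.plusAlgebra α).Point η) :
    ∃ Ψ : X.X.obj (op B.plus.plus.plus) →+* T,
      (∀ c, Ψ (X.X.restrict B.plus.plus.fst c) = pairHom p q c) ∧
        ∀ x, Ψ (X.X.restrict (plusMap (B.fst ∘ₗ B.plus.fst)) x) = r.hom x := by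
  obtain ⟨s, hs⟩ := exists_hom_prod_graphEuler_eq_zero r
  refine X.exists_lift_plus (B.fst ∘ₗ B.plus.fst) (fun c => ?_) hs
  rw [← X.X.restrict_restrict, pairHom_fst, hom_restrict_fst, hom_restrict_fst]

lemma addPoint_assoc (p q r : (X.plusAlgebra α).Point η) :
    addPoint (addPoint p q) r = addPoint p (addPoint q r) := by
  obtain ⟨Ψ, Ψ_fst, Ψ_plusMap⟩ := exists_tripleHom p q r
  have comp_drop_first : Ψ.comp (X.X.restrict (plusMap (plusMap B.fst))) = pairHom q r :=
    eq_pairHom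
      (fun c => by
        rw [RingHom.comp_apply, X.X.restrict_restrict, ← pairHom_plusMap p q, ← Ψ_fst,
          X.X.restrict_restrict]
        rfl)
      (fun x => by
        rw [RingHom.comp_apply, X.X.restrict_restrict]
        exact Ψ_plusMap x)
  have comp_add_last : Ψ.comp (X.X.restrict B.plus.sumMap) = pairHom p (addPoint q r) :=
    eq_pairHom
      (fun c => by
        rw [RingHom.comp_apply, X.X.restrict_restrict, ← pairHom_fst p q, ← Ψ_fst,
          X.X.restrict_restrict]
        rfl)
      (fun x => by
        rw [RingHom.comp_apply, X.X.restrict_restrict, addPoint_hom, ← comp_drop_first,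
          RingHom.comp_apply, X.X.restrict_restrict]
        rfl)
  refine addPoint_eq (Φ := Ψ.comp (X.X.restrict (plusMap B.sumMap))) (fun c => ?_) (fun x => ?_)
    fun x => ?_
  · rw [RingHom.comp_apply, X.X.restrict_restrict, addPoint_hom, ← Ψ_fst, X.X.restrict_restrict]
    rfl
  · rw [RingHom.comp_apply, X.X.restrict_restrict]
    exact Ψ_plusMap x
  · rw [addPoint_hom, ← comp_add_last, RingHom.comp_apply, RingHom.comp_apply,
      X.X.restrict_restrict, X.X.restrict_restrict, sumMap_comp_plusMap_sumMap]

lemma zero_addPoint (p : (X.plusAlgebra α).Point η) : addPoint (Point.ofθ _ η 0) p = p := by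
  refine addPoint_eq (Φ := p.hom.comp (X.X.restrict (pair (pair B.fst 0) B.snd))) (fun c => ?_)
    (fun x => ?_) fun x => ?_ <;> rw [RingHom.comp_apply, X.X.restrict_restrict]
  · change _ = η (X.X.restrict (graph ((0 : Character A) ∘ₗ α)) c)
    rw [← hom_restrict_fst p, X.X.restrict_restrict]
    rfl
  · exact congrArg p.hom (X.X.restrict_id x)
  · rw [sumMap_comp_zero, X.X.restrict_id]

lemma addPoint_self (p : (X.plusAlgebra α).Point η) : addPoint p p = Point.ofθ _ η 0 := by
  refine addPoint_eq (Φ := p.hom.comp (X.X.restrict (pair LinearMap.id B.snd))) (fun c => ?_)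
    (fun x => ?_) fun x => ?_ <;> rw [RingHom.comp_apply, X.X.restrict_restrict]
  · exact congrArg p.hom (X.X.restrict_id c)
  · exact congrArg p.hom (X.X.restrict_id x)
  · rw [sumMap_comp_diag, ← X.X.restrict_restrict, hom_restrict_fst]
    rfl

lemma addPoint_ofθ (η : X.X.obj (op B) →+* T) (V W : Character A) :
    addPoint (Point.ofθ (X.plusAlgebra α).toAugmentedAlgebra η V) (Point.ofθ _ η W) =
      Point.ofθ _ η (V + W) := by
  refine addPoint_eq (Φ := η.comp (X.X.restrict (pair (graph (V ∘ₗ α)) (W ∘ₗ α)))) (fun c => ?_)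
    (fun x => ?_) fun x => ?_ <;> exact congrArg η (X.X.restrict_restrict _ _ _)

variable (X α)

/-- The uncompleted formal group law at `B × C₂` of a global group law. -/
@[reducible]
def uncompletedFGL : UncompletedFGL A (X.X.obj (op B)) where
  toPrincipalAugmentedAlgebra := X.plusAlgebra α
  add := addPoint
  mapsTo_add := mapsTo_addPoint
  add_comm := addPoint_comm
  add_assoc := addPoint_assoc
  zero_add := zero_addPoint
  add_self := addPoint_self
  add_ofθ := addPoint_ofθ

/-- The `A`-equivariant formal group law over `X(B)` associated with a global group law `X` and a
homomorphism `α : B → A`. -/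
def fgl : EquivariantFGL A (X.X.obj (op B)) := (X.uncompletedFGL α).completedFGL

lemma fgl_isTwoTorsion : (X.fgl α).IsTwoTorsion := (X.uncompletedFGL α).completedFGL_isTwoTorsion

lemma fgl_euler (V : Character A) : (X.fgl α).euler V = X.euler (V ∘ₗ α) := by
  change X.X.restrict (graph (V ∘ₗ α)) (X.graphEuler ((0 : Character A) ∘ₗ α)) = _
  rw [graph, restrict_pair_graphEuler, LinearMap.zero_comp, LinearMap.zero_comp, zero_add]

end GlobalGroupLaw

/-! ### Functoriality of the formal group laws of a global group law -/

lemma bijective_quotientMap_of_comp {S R R' : Type*} [CommRing S] [CommRing R] [CommRing R']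
    {φ : R →+* R'} {I : Ideal R} {J : Ideal R'} (hIJ : I ≤ J.comap φ) (τ : S →+* R)
    (hI : Function.Surjective ((Ideal.Quotient.mk I).comp τ))
    (hJ : Function.Surjective ((Ideal.Quotient.mk J).comp (φ.comp τ)))
    (hτ : ∀ r, φ (τ r) ∈ J → τ r ∈ I) : Function.Bijective (Ideal.quotientMap J φ hIJ) := by
  refine ⟨(injective_iff_map_eq_zero _).2 fun x hx => ?_, fun y => ?_⟩
  · obtain ⟨r, rfl⟩ := hI x
    exact Ideal.Quotient.eq_zero_iff_mem.2 (hτ r (Ideal.Quotient.eq_zero_iff_mem.1 hx))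
  · obtain ⟨r, rfl⟩ := hJ y
    exact ⟨Ideal.Quotient.mk I (τ r), Ideal.quotientMap_mk⟩

namespace PrincipalAugmentedAlgebra

variable {A : Type} [AddCommGroup A] [Module (ZMod 2) A] {k : Type u} [CommRing k]
variable (P : PrincipalAugmentedAlgebra A k)

lemma toCompletion_mem_I {s : Multiset (Character A)} {x : P.R} :
    P.toCompletion x ∈ P.completion.I s ↔ x ∈ P.I s := by
  rw [completion_I, RingHom.mem_ker, P.completionProj_toCompletion, Ideal.Quotient.eq_zero_iff_mem]

lemma surjective_mk_comp_toCompletion (s : Multiset (Character A)) :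
    Function.Surjective ((Ideal.Quotient.mk (P.completion.I s)).comp P.toCompletion) := fun y => by
  obtain ⟨y, rfl⟩ := Ideal.Quotient.mk_surjective y
  obtain ⟨r, hr⟩ := Ideal.Quotient.mk_surjective (P.completionProj s y)
  refine ⟨r, Ideal.Quotient.eq.2 ?_⟩
  rw [completion_I, RingHom.mem_ker, map_sub, P.completionProj_toCompletion, hr, sub_self]

end PrincipalAugmentedAlgebra

namespace GlobalGroupLaw

open El₂ PrincipalAugmentedAlgebra

variable (X : GlobalGroupLaw.{u}) {A A' B B' : El₂}

section Restriction

variable {α : B →ₗ[ZMod 2] A} {α' : B' →ₗ[ZMod 2] A'} {γ : B' →ₗ[ZMod 2] B} {δ : A →ₗ[ZMod 2] A'}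
  {f : X.X.obj (op B) →+* X.X.obj (op B')} (hα : δ ∘ₗ α ∘ₗ γ = α')
  (hf : ∀ c, f c = X.X.restrict γ c)

/-- The restriction along `γ × id` as a map out of an uncompleted formal group law. -/
def restrictPreHom : UncompletedFGL.PreHom δ f (X.uncompletedFGL α) (X.fgl α') where
  φ := (X.uncompletedFGL α').toCompletion.comp (X.X.restrict (plusMap γ))
  map_algebraMap c := by
    rw [hf]
    exact congrArg (X.uncompletedFGL α').toCompletion
      ((X.X.restrict_restrict B.fst (plusMap γ) c).trans (X.X.restrict_restrict γ B'.fst c).symm)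
  map_θ V x := by
    rw [hf]
    subst hα
    exact (X.X.restrict_restrict (plusMap γ) (graph (V ∘ₗ δ ∘ₗ α ∘ₗ γ)) x).trans
      (X.X.restrict_restrict (graph ((V ∘ₗ δ) ∘ₗ α)) γ x).symm
  map_E := congrArg (X.uncompletedFGL α').toCompletion
    (X.restrict_plusMap_graphEuler ((0 : Character A) ∘ₗ α) γ)

lemma restrictPreHom_pull_add {T : Type u} [CommRing T] {η : X.X.obj (op B') →+* T}
    (p q : (X.fgl α').Point η) :
    (X.restrictPreHom hα hf).pull (p + q) =
      addPoint ((X.restrictPreHom hα hf).pull p) ((X.restrictPreHom hα hf).pull q) := by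
  have restrictPoint_add : restrictPoint (p + q) = addPoint (restrictPoint p) (restrictPoint q) :=
    (X.uncompletedFGL α').restrictPoint_add p q
  refine (addPoint_eq (Φ := (pairHom (restrictPoint p) (restrictPoint q)).comp
    (X.X.restrict (plusMap (plusMap γ)))) (fun c => ?_) (fun x => ?_) fun x => ?_).symm
  · rw [RingHom.comp_apply, X.X.restrict_restrict]
    refine Eq.trans ?_
      (pairHom_fst (restrictPoint p) (restrictPoint q) (X.X.restrict (plusMap γ) c))
    rw [X.X.restrict_restrict]
    rfl
  · rw [RingHom.comp_apply, X.X.restrict_restrict]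
    refine Eq.trans ?_
      (pairHom_plusMap (restrictPoint p) (restrictPoint q) (X.X.restrict (plusMap γ) x))
    rw [X.X.restrict_restrict]
    rfl
  · refine Eq.trans ?_
      (RingHom.congr_fun (congrArg Point.hom restrictPoint_add) (X.X.restrict (plusMap γ) x)).symm
    rw [addPoint_hom, RingHom.comp_apply, X.X.restrict_restrict, X.X.restrict_restrict]
    rfl

/-- The morphism of formal group laws induced by the restriction along `γ × id`. -/
def restrictHom : EquivariantFGL.HomOver δ f (X.fgl α) (X.fgl α') :=
  (X.restrictPreHom hα hf).completedHom (X.restrictPreHom_pull_add hα hf)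

lemma restrictHom_toCompletion (x : X.X.obj (op B.plus)) :
    (X.restrictHom hα hf).φ ((X.uncompletedFGL α).toCompletion x) =
      (X.uncompletedFGL α').toCompletion (X.X.restrict (plusMap γ) x) :=
  (X.restrictPreHom hα hf).completedMap_toCompletion x

end Restriction

section Pushforward

variable (α : B →ₗ[ZMod 2] A)

/-- The morphism from the `B`-equivariant formal group law over `X(B)` to its push-forward. -/
def pushforwardHom :
    EquivariantFGL.HomOver α (RingHom.id _) (X.fgl (LinearMap.id : B →ₗ[ZMod 2] B)) (X.fgl α) :=
  X.restrictHom (γ := LinearMap.id) rfl fun c => (X.X.restrict_id c).symm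

lemma pushforwardHom_comp_toCompletion :
    (X.pushforwardHom α).φ.comp (X.uncompletedFGL LinearMap.id).toCompletion =
      (X.uncompletedFGL α).toCompletion :=
  RingHom.ext fun x => (X.restrictHom_toCompletion _ _ x).trans
    (congrArg (X.uncompletedFGL α).toCompletion (X.X.restrict_id x))

lemma mem_uncompletedFGL_I_map {s : Multiset (Character A)} {x : X.X.obj (op B.plus)} :
    x ∈ (X.uncompletedFGL (LinearMap.id : B →ₗ[ZMod 2] B)).I (s.map fun V => V ∘ₗ α) ↔
      x ∈ (X.uncompletedFGL α).I s := by
  rw [PrincipalAugmentedAlgebra.mem_I, PrincipalAugmentedAlgebra.mem_I, generator, generator,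
    Multiset.map_map]
  rfl

lemma fgl_isPushforward :
    EquivariantFGL.IsPushforward α (X.fgl (LinearMap.id : B →ₗ[ZMod 2] B)) (X.fgl α) := by
  refine ⟨X.pushforwardHom α, fun s => bijective_quotientMap_of_comp
    ((X.pushforwardHom α).I_le_comap s) (X.uncompletedFGL LinearMap.id).toCompletion
    (surjective_mk_comp_toCompletion _ _) ?_ fun r hr => ?_⟩
  · exact (congrArg (fun τ => Function.Surjective ((Ideal.Quotient.mk ((X.fgl α).I s)).comp τ))
      (X.pushforwardHom_comp_toCompletion α)).mpr (surjective_mk_comp_toCompletion _ s)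
  · have mem_I : (X.uncompletedFGL α).toCompletion r ∈ (X.uncompletedFGL α).completion.I s :=
      (congrArg (· ∈ (X.fgl α).I s)
        (RingHom.congr_fun (X.pushforwardHom_comp_toCompletion α) r)).mp hr
    exact (toCompletion_mem_I _).2
      ((X.mem_uncompletedFGL_I_map α).2 ((toCompletion_mem_I _).1 mem_I))

/-- The morphism of `A`-equivariant formal group laws over the restriction along `α`. -/
def baseChangeHom : EquivariantFGL.HomOver (LinearMap.id : A →ₗ[ZMod 2] A) (X.X.restrict α)
    (X.fgl (LinearMap.id : A →ₗ[ZMod 2] A)) (X.fgl α) :=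
  X.restrictHom (γ := α) rfl fun _ => rfl

end Pushforward

end GlobalGroupLaw

/-! ### The universal formal group laws -/

namespace Character

open El₂

variable {B : El₂} {M : Type*} [AddCommMonoid M]

lemma eq_comp_fst_add_smul_snd (W : Character B.plus) :
    W = (W ∘ₗ graph (0 : Character B)) ∘ₗ B.fst + W ((0, 1) : B × ZMod 2) • B.snd := by
  refine LinearMap.ext fun (c : B × ZMod 2) => ?_
  change W c = W ((c.1, 0) : B × ZMod 2) + W ((0, 1) : B × ZMod 2) * c.2
  rw [mul_comm, ← smul_eq_mul, ← map_smul, ← map_add]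
  congr 1
  exact Prod.ext (by simp) (by simp)

lemma plus_hom_ext {x x' : Character B.plus →+ M}
    (h_fst : ∀ V : Character B, x (V ∘ₗ B.fst) = x' (V ∘ₗ B.fst)) (h_snd : x B.snd = x' B.snd) :
    x = x' := by
  refine AddMonoidHom.ext fun W => ?_
  rw [eq_comp_fst_add_smul_snd W, map_add, map_add, h_fst]
  rcases eq_zero_or_one W ((0, 1) : B × ZMod 2) with h | h
  · rw [h, zero_smul, map_zero, map_zero]
  · rw [h, one_smul, h_snd]

/-- The extension of a homomorphism from the characters of `B` to the characters of `B × C₂`, with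
the given value at the second projection. -/
def plusExtend (x : Character B →+ M) (t : M) (ht : t + t = 0) : Character B.plus →+ M :=
  twist ((0, 1) : B × ZMod 2) (x.comp (comap (graph (0 : Character B)))) t ht

variable (x : Character B →+ M) {s t : M} (hs : s + s = 0) (ht : t + t = 0)

lemma plusExtend_fst (V : Character B) : plusExtend x t ht (V ∘ₗ B.fst) = x V := by
  change x V + ite (V 0 = 0) 0 t = x V
  rw [if_pos (map_zero V), add_zero]

lemma plusExtend_snd : plusExtend x t ht B.snd = t := by
  change x 0 + ite ((1 : ZMod 2) = 0) 0 t = t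
  rw [if_neg one_ne_zero, map_zero, zero_add]

lemma plusExtend_graphCharacter_zero :
    plusExtend x t ht (graphCharacter (0 : Character B)) = t := by
  rw [graphCharacter, map_add, plusExtend_fst, plusExtend_snd, map_zero, zero_add]

lemma plusExtend_comp_comap_fst : (plusExtend x t ht).comp (comap B.fst) = x :=
  AddMonoidHom.ext fun V => plusExtend_fst x ht V

lemma plusExtend_plusExtend_comp_comap_plusMap :
    (plusExtend (plusExtend x s hs) t ht).comp (comap (plusMap B.fst)) = plusExtend x t ht := by
  refine plus_hom_ext (fun V => ?_) ?_
  · change plusExtend (plusExtend x s hs) t ht ((V ∘ₗ B.fst) ∘ₗ B.plus.fst) = _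
    rw [plusExtend_fst, plusExtend_fst, plusExtend_fst]
  · change plusExtend (plusExtend x s hs) t ht B.plus.snd = _
    rw [plusExtend_snd, plusExtend_snd]

lemma plusExtend_plusExtend_comp_comap_sumMap (hst : s + t + (s + t) = 0) :
    (plusExtend (plusExtend x s hs) t ht).comp (comap B.sumMap) = plusExtend x (s + t) hst := by
  refine plus_hom_ext (fun V => ?_) ?_
  · change plusExtend (plusExtend x s hs) t ht ((V ∘ₗ B.fst) ∘ₗ B.plus.fst) = _
    rw [plusExtend_fst, plusExtend_fst, plusExtend_fst]
  · change plusExtend (plusExtend x s hs) t ht (B.snd ∘ₗ B.plus.fst + B.plus.snd) = _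
    rw [map_add, plusExtend_fst, plusExtend_snd, plusExtend_snd, plusExtend_snd]

end Character

/-- The 2-torsion `A`-equivariant formal group law over the value at `A` of the initial global group
law. -/
def lazardFGL (A : El₂) : EquivariantFGL A (Laz.{u} A) := lazardLaw.{u}.fgl LinearMap.id

lemma lazardFGL_isTwoTorsion (A : El₂) : (lazardFGL.{u} A).IsTwoTorsion :=
  lazardLaw.fgl_isTwoTorsion _

namespace EquivariantFGL

open El₂ GlobalGroupLaw

lemma classify_lazardFGL_restrict {A B : El₂} (α : B →ₗ[ZMod 2] A) (z : Laz.{u} A) :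
    classify (lazardFGL_isTwoTorsion B) (lazardLaw.X.restrict α z) =
      lazardLaw.X.restrict α (classify (lazardFGL_isTwoTorsion A) z) := by
  have via_pushforward := classify_eq_of_homOver (lazardFGL_isTwoTorsion B)
    (lazardLaw.{u}.fgl_isTwoTorsion α) (lazardLaw.{u}.pushforwardHom α) z
  have via_baseChange := classify_eq_of_homOver (lazardFGL_isTwoTorsion A)
    (lazardLaw.{u}.fgl_isTwoTorsion α) (lazardLaw.{u}.baseChangeHom α) z
  rw [lazardLaw.X.restrict_id] at via_baseChange
  exact via_pushforward.symm.trans via_baseChange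

/-- The classifying homomorphisms of the formal group laws `lazardFGL A` as an endomorphism of the
initial global group law. -/
def classifyLazardFGL : lazardLaw.{u}.Hom lazardLaw.{u} where
  app A := classify (lazardFGL_isTwoTorsion A)
  naturality := classify_lazardFGL_restrict
  app_e := by
    have classify_euler_id := classify_euler (A := C₂) (lazardFGL_isTwoTorsion.{u} C₂)
      (LinearMap.id : ZMod 2 →ₗ[ZMod 2] ZMod 2)
    rw [lazardLaw.{u}.euler_id] at classify_euler_id
    exact classify_euler_id.trans
      ((lazardLaw.{u}.fgl_euler (A := C₂) LinearMap.id LinearMap.id).trans lazardLaw.euler_id)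

lemma classify_lazardFGL (A : El₂) (z : Laz.{u} A) : classify (lazardFGL_isTwoTorsion A) z = z :=
  RingHom.congr_fun (Hom.lazard_ext classifyLazardFGL (.ofNatTrans (𝟙 _) rfl) A) z

section Universal

variable {A : El₂} {k : Type u} [CommRing k] {G : EquivariantFGL A k} (hG : G.IsTwoTorsion)
variable {T T' : Type u} [CommRing T] [CommRing T'] {η' : k →+* T'} {η : k →+* T}

/-- The function on points defined by an element of the value at `A × C₂` of the initial global
group law. -/
def plusEval (p : G.Point η) : Laz.{u} A.plus →+* T :=
  lazEval hG (Character.plusExtend (G.θPoint η) p (hG.add_self p))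

lemma map_plusEval {φ : T →+* T'} {p : G.Point η} {p' : G.Point η'} (h : Point.MapsTo φ p p')
    (z : Laz.{u} A.plus) : φ (plusEval hG p z) = plusEval hG p' z :=
  map_lazEval hG (TestPoint.mapsTo_twist (fun _ => Point.mapsTo_ofθ h.comp_eq _) h) z

/-- The element of the completed algebra with the values `plusEval hG p z` at the points `p`. -/
def plusEvalCompletion : Laz.{u} A.plus →+* Completion G.I :=
  RingHom.codRestrict (RingHom.pi fun s => plusEval hG (Point.taut G.toAugmentedAlgebra s))
    (Completion G.I) fun z _ _ h => map_plusEval hG (φ := Ideal.Quotient.factor h) (fun _ => rfl) z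

lemma hom_plusEvalCompletion (p : G.Point η) (z : Laz.{u} A.plus) :
    p.hom (G.completionEquiv.symm (plusEvalCompletion hG z)) = plusEval hG p z := by
  rw [hom_completionEquiv_symm]
  exact map_plusEval hG (p := Point.taut G.toAugmentedAlgebra p.cont.choose) (p' := p)
    (φ := Ideal.Quotient.lift _ p.hom fun _ ha => p.cont.choose_spec ha) (fun _ => rfl) z

lemma plusEval_restrict_fst (p : G.Point η) (c : Laz.{u} A) :
    plusEval hG p (lazardLaw.X.restrict A.fst c) = η (classify hG c) := by
  rw [plusEval, lazEval_restrict, Character.plusExtend_comp_comap_fst, classify]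
  exact (map_lazEval hG (fun _ _ => rfl) c).symm

lemma plusEval_θPoint (V : Character A) (z : Laz.{u} A.plus) :
    plusEval hG (G.θPoint (RingHom.id k) V) z = classify hG (lazardLaw.X.restrict (graph V) z) := by
  rw [classify, lazEval_restrict]
  exact congrArg (lazEval hG · z) (Character.plus_hom_ext
    (Character.plusExtend_fst _ _) (Character.plusExtend_snd _ _))

lemma plusEval_graphEuler_zero (p : G.Point η) :
    plusEval hG p (lazardLaw.graphEuler 0) = p.hom G.y := by
  rw [plusEval, graphEuler, lazEval_euler, Character.plusExtend_graphCharacter_zero]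

/-- The homomorphism from the value at `A × C₂` of the initial global group law to the algebra of
a 2-torsion `A`-equivariant formal group law. -/
def lazardPreHom :
    UncompletedFGL.PreHom LinearMap.id (classify hG)
      (lazardLaw.{u}.uncompletedFGL (LinearMap.id : A →ₗ[ZMod 2] A)) G where
  φ := (G.completionEquiv.symm : Completion G.I →+* G.R).comp (plusEvalCompletion hG)
  map_algebraMap c := ext_points fun _ _ _ p =>
    (hom_plusEvalCompletion hG p _).trans
      ((plusEval_restrict_fst hG p c).trans (p.hom_algebraMap _).symm)
  map_θ V x :=
    (hom_plusEvalCompletion hG (G.θPoint (RingHom.id k) V) x).trans (plusEval_θPoint hG V x)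
  map_E := ext_points fun _ _ _ p =>
    (hom_plusEvalCompletion hG p _).trans (plusEval_graphEuler_zero hG p)

lemma lazardPreHom_pull_hom (p : G.Point η) (z : Laz.{u} A.plus) :
    ((lazardPreHom hG).pull p).hom z = plusEval hG p z := hom_plusEvalCompletion hG p z

lemma lazardPreHom_pull_add (p q : G.Point η) :
    (lazardPreHom hG).pull (p + q) =
      addPoint ((lazardPreHom hG).pull p) ((lazardPreHom hG).pull q) := by
  let x := Character.plusExtend (G.θPoint η) p (hG.add_self p)
  refine (addPoint_eq (Φ := lazEval hG (Character.plusExtend x q (hG.add_self q)))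
    (fun c => ?_) (fun z => ?_) fun z => ?_).symm
  · exact (lazEval_restrict hG _ _ c).trans ((congrArg (lazEval hG · c)
      (Character.plusExtend_comp_comap_fst x _)).trans (lazardPreHom_pull_hom hG p c).symm)
  · exact (lazEval_restrict hG _ _ z).trans ((congrArg (lazEval hG · z)
      (Character.plusExtend_plusExtend_comp_comap_plusMap _ _ _)).trans
        (lazardPreHom_pull_hom hG q z).symm)
  · exact (lazEval_restrict hG _ _ z).trans ((congrArg (lazEval hG · z)
      (Character.plusExtend_plusExtend_comp_comap_sumMap _ _ _ (hG.add_self _))).trans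
        (lazardPreHom_pull_hom hG (p + q) z).symm)

/-- The morphism of formal group laws from `lazardFGL A` to a 2-torsion formal group law. -/
def fromLazardFGL : HomOver (LinearMap.id : A →ₗ[ZMod 2] A) (classify hG) (lazardFGL.{u} A) G :=
  (lazardPreHom hG).completedHom (lazardPreHom_pull_add hG)

lemma eq_classify_of_homOver {f : Laz.{u} A →+* k}
    (g : HomOver (LinearMap.id : A →ₗ[ZMod 2] A) f (lazardFGL.{u} A) G) : f = classify hG :=
  RingHom.ext fun z => by
    rw [classify_eq_of_homOver (lazardFGL_isTwoTorsion A) hG g, lazardLaw.X.restrict_id,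
      classify_lazardFGL]

end Universal

end EquivariantFGL

open EquivariantFGL in
lemma lazardFGL_isUniversal (A : El₂) : (lazardFGL.{u} A).IsUniversalTwoTorsion := by
  refine ⟨lazardFGL_isTwoTorsion A, fun k' _ G hG => ⟨⟨⟨⟨_, fromLazardFGL hG⟩⟩, fun ⟨f, g⟩ => ?_⟩⟩⟩
  obtain rfl := eq_classify_of_homOver hG g
  exact congrArg (Sigma.mk _) (HomOver.ext_of_isTwoTorsion (lazardFGL_isTwoTorsion A) _ _)

/-- The global Lazard ring whose underlying functor is the initial global group law. -/
def lazardRing : GlobalLazardRing.{u} where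
  L := lazardLaw.X
  F := lazardFGL
  universal := lazardFGL_isUniversal
  res_classifies α :=
    ⟨lazardLaw.fgl α.hom.hom, lazardLaw.fgl_isPushforward _, ⟨lazardLaw.baseChangeHom _⟩⟩

/-! ### Comparison of the global Lazard ring with the initial global group law -/

namespace EquivariantFGL

lemma HomOver.isTwoTorsion {A B : Type} [AddCommGroup A] [Module (ZMod 2) A] [AddCommGroup B]
    [Module (ZMod 2) B] {k k' : Type u} [CommRing k] [CommRing k'] {α : B →ₗ[ZMod 2] A}
    {f : k →+* k'} {F : EquivariantFGL B k} {G : EquivariantFGL A k'} (g : HomOver α f F G)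
    (hF : F.IsTwoTorsion) : G.IsTwoTorsion := by
  refine G.completion_ext_eval₁ fun T _ η p => ?_
  refine (p.eval₁_mulHat _).trans (Eq.trans ?_ (map_zero p.eval₁).symm)
  change (p + p).hom G.y = 0
  rw [← g.map_y]
  change (g.pullHom η (p + p)).hom F.y = 0
  rw [map_add, hF.add_self, F.zero_hom_y]

lemma classify_bijective {A : El₂} {k : Type u} [CommRing k] {F : EquivariantFGL A k}
    (hF : F.IsUniversalTwoTorsion) : Function.Bijective (classify hF.1) := by
  obtain ⟨⟨⟨⟨f, g⟩⟩, -⟩⟩ := hF.2 _ (lazardFGL A) (lazardFGL_isTwoTorsion A)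
  refine Function.bijective_iff_has_inverse.2 ⟨f, fun z => ?_, fun c => ?_⟩
  · rw [← lazardLaw.X.restrict_id z, ← classify_eq_of_homOver hF.1 (lazardFGL_isTwoTorsion A) g,
      classify_lazardFGL, lazardLaw.X.restrict_id]
  · obtain ⟨_⟩ := hF.2 _ F hF.1
    exact RingHom.congr_fun (congrArg Sigma.fst (Subsingleton.elim (α := F.Hom F)
      ⟨_, (fromLazardFGL hF.1).comp g rfl⟩ ⟨_, HomOver.id F⟩)) c

end EquivariantFGL

namespace GlobalLazardRing

variable (𝓛 : GlobalLazardRing.{u}) {A B : El₂}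

/-- The isomorphism from the value at `A` of the initial global group law to the ground ring of the
universal formal group law. -/
def comparison (A : El₂) : Laz.{u} A ≃+* 𝓛.L.obj (op A) :=
  RingEquiv.ofBijective _ (EquivariantFGL.classify_bijective (𝓛.universal A))

lemma comparison_restrict (α : B →ₗ[ZMod 2] A) (z : Laz.{u} A) :
    𝓛.comparison B (lazardLaw.X.restrict α z) = 𝓛.L.restrict α (𝓛.comparison A z) := by
  obtain ⟨G, ⟨c, -⟩, ⟨g⟩⟩ := 𝓛.res_classifies (FGModuleCat.ofHom α : B ⟶ A)
  have hG := g.isTwoTorsion (𝓛.universal A).1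
  have via_pushforward := EquivariantFGL.classify_eq_of_homOver (𝓛.universal B).1 hG c z
  have via_restrict := EquivariantFGL.classify_eq_of_homOver (𝓛.universal A).1 hG g z
  rw [lazardLaw.X.restrict_id] at via_restrict
  exact via_pushforward.symm.trans via_restrict

lemma comparison_euler (V : Character A) :
    𝓛.comparison A (lazardLaw.euler V) = (𝓛.F A).euler V :=
  EquivariantFGL.classify_euler _ V

lemma comparison_e : 𝓛.comparison C₂ lazardLaw.e = 𝓛.eσ := by
  rw [← lazardLaw.euler_id, comparison_euler]
  rfl

/-- The isomorphism of functors from the initial global group law. -/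
def comparisonIso : lazardLaw.{u}.X ≅ 𝓛.L :=
  NatIso.ofComponents (fun A => (𝓛.comparison A.unop).toCommRingCatIso) fun f =>
    CommRingCat.hom_ext <| RingHom.ext fun z => 𝓛.comparison_restrict f.unop.hom.hom z

lemma comparison_euler_eq_pullback (V : Character A) :
    𝓛.comparison A (lazardLaw.euler V) = 𝓛.L.pullback 𝓛.eσ V := by
  rw [← comparison_e]
  exact 𝓛.comparison_restrict (A := C₂) V _

lemma euler_eq_pullback (V : Character A) : (𝓛.F A).euler V = 𝓛.L.pullback 𝓛.eσ V := by
  rw [← comparison_euler, comparison_euler_eq_pullback]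

lemma isCoordinate : 𝓛.L.IsCoordinate 𝓛.eσ := by
  refine El₂Algebra.isCoordinate_of_projKer (fun A => ?_) (fun {A V b} hb x hx => ?_)
    (fun {A V b} hb x hx => ?_)
  · rw [← comparison_euler_eq_pullback, lazardLaw.euler_zero, map_zero]
  · obtain ⟨z, rfl⟩ := (𝓛.comparison A).surjective x
    rw [← comparison_euler_eq_pullback, ← map_mul, EmbeddingLike.map_eq_zero_iff] at hx
    rw [lazardLaw.euler_mul_cancel hb (y := 0) (hx.trans (mul_zero _).symm), map_zero]
  · obtain ⟨z, rfl⟩ := (𝓛.comparison A).surjective x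
    rw [← comparison_restrict, EmbeddingLike.map_eq_zero_iff] at hx
    rw [← comparison_euler_eq_pullback]
    exact map_dvd _ (lazardLaw.euler_dvd hb hx)

lemma euler_mem_nonZeroDivisors {V : Character A} (hV : V ≠ 0) :
    (𝓛.F A).euler V ∈ nonZeroDivisors (𝓛.L.obj (op A)) := by
  rw [euler_eq_pullback, mem_nonZeroDivisors_iff_right]
  intro x hx
  exact (𝓛.isCoordinate A V hV).1 ((mul_comm _ _).trans (hx.trans (mul_zero _).symm))

/-- The global group law underlying a global Lazard ring. -/
def toGlobalGroupLaw : GlobalGroupLaw.{u} := ⟨𝓛.L, 𝓛.eσ, 𝓛.isCoordinate⟩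

end GlobalLazardRing

namespace GlobalGroupLaw.IsInitial

variable {X Y : GlobalGroupLaw.{u}}

lemma of_iso (hX : X.IsInitial) (i : X.X ≅ Y.X) (hi : (i.hom.app (op C₂)).hom X.e = Y.e) :
    Y.IsInitial := by
  intro Z
  obtain ⟨φ, hφ, φ_unique⟩ := hX Z
  have inv_e : (i.inv.app (op C₂)).hom Y.e = X.e := by
    rw [← hi]
    exact ConcreteCategory.congr_hom (i.hom_inv_id_app (op C₂)) X.e
  exact ⟨i.inv ≫ φ, (congrArg (φ.app (op C₂)).hom inv_e).trans hφ, fun ψ hψ =>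
    (Iso.eq_inv_comp i).2 (φ_unique _ ((congrArg (ψ.app (op C₂)).hom hi).trans hψ))⟩

lemma existsUnique_iso (hX : X.IsInitial) (hY : Y.IsInitial) :
    ∃! i : X.X ≅ Y.X, (i.hom.app (op C₂)).hom X.e = Y.e := by
  obtain ⟨φ, hφ, φ_unique⟩ := hX Y
  obtain ⟨ψ, hψ, -⟩ := hY X
  refine ⟨⟨φ, ψ, (hX X).unique ?_ rfl, (hY Y).unique ?_ rfl⟩, hφ,
    fun i hi => Iso.ext (φ_unique _ hi)⟩
  · exact (congrArg (ψ.app (op C₂)).hom hφ).trans hψ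
  · exact (congrArg (φ.app (op C₂)).hom hψ).trans hφ

end GlobalGroupLaw.IsInitial

lemma GlobalLazardRing.toGlobalGroupLaw_isInitial (𝓛 : GlobalLazardRing.{u}) :
    𝓛.toGlobalGroupLaw.IsInitial :=
  GlobalGroupLaw.lazardLaw_isInitial.of_iso 𝓛.comparisonIso 𝓛.comparison_e

end

theorem mainTheorem7 :
    (∃ X : GlobalGroupLaw.{u}, X.IsInitial) ∧
    Nonempty GlobalLazardRing.{u} ∧
    ∀ 𝓛 : GlobalLazardRing.{u},
      (∀ X : GlobalGroupLaw.{u}, X.IsInitial →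
        ∃! i : 𝓛.L ≅ X.X, (i.hom.app (op C₂)).hom 𝓛.eσ = X.e) ∧
      𝓛.L.IsCoordinate 𝓛.eσ ∧
      ∀ (A : El₂) (V : Character A), V ≠ 0 →
        (𝓛.F A).euler V ∈ nonZeroDivisors (𝓛.L.obj (op A)) := by
  refine ⟨⟨lazardLaw, GlobalGroupLaw.lazardLaw_isInitial⟩, ⟨lazardRing⟩, fun 𝓛 =>
    ⟨fun X hX => ?_, 𝓛.isCoordinate, fun A V hV => ?_⟩⟩
  · exact 𝓛.toGlobalGroupLaw_isInitial.existsUnique_iso hX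
  · exact 𝓛.euler_mem_nonZeroDivisors hV
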